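/- **Theorem (Second Moment Method).** For $K>0$ let $p_K=\mathbb P(|g|\le K)$, where $g$ is a standard normal variable, and let $\alpha_c(K)=-\log 2/\log p_K$. For $\alpha>0$ let $K_c(\alpha)$ be the unique $K>0$ with $\alpha_c(K)=\alpha$. For a real $m\times n$ matrix $A$ put $$Z_K(A)=\{\sigma\in\{-1,1\}^n:\ \|A\sigma\|_\infty\le K\},\qquad \mathrm{disc}(A)=\min_{\sigma\in\{-1,1\}^n}\|A\sigma\|_\infty .$$ For every $K>0$ there is a constant $C>0$, depending only on $K$, such that the following holds for every sequence $\alpha=\alpha(n)$ with $0<\alpha(n)\le\alpha_c(K)$ for all $n$, and for every $n\ge 1$. If $A$ is a random $m\times n$ matrix with $m=\lfloor\alpha(n)\,n\rfloor$ rows (so $m=\alpha(n)\,n$ whenever this is an integer), whose entries are independent normal variables with mean $0$ and variance $1/n$, and $|Z_{K,\alpha}|$ denotes the number of elements of $Z_K(A)$, then $$\frac{\mathbb E\,|Z_{K,\alpha}|^2}{\big(\mathbb E\,|Z_{K,\alpha}|\big)^2}<C \qquad\text{and}\qquad \mathbb P\big(\mathrm{disc}(A)\le K_c(\alpha(n))\big)>C^{-1}.$$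 (For $m=0$ one has $\|A\sigma\|_\infty=0$.) -/

import Mathlib

open MeasureTheory ProbabilityTheory

noncomputable section

namespace SymPerceptron

/-- The probability `p_K = P(|Z| ≤ K)` for a standard normal variable `Z`. -/
def pK (K : ℝ) : ℝ := (gaussianReal 0 1).real {x : ℝ | |x| ≤ K}

/-- The critical density `α_c(K) = - log 2 / log p_K`. -/
def criticalDensity (K : ℝ) : ℝ := -Real.log 2 / Real.log (pK K)

lemma pK_zero : pK 0 = 0 := by
  have : {x : ℝ | |x| ≤ 0} = {0} := by ext x; simp
  rw [pK, this]
  have := nullSingletonClass_gaussianReal (μ := 0) (v := 1) one_ne_zero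
  rw [measureReal_def, measure_singleton, ENNReal.toReal_zero]

lemma pK_lt {a b : ℝ} (ha : 0 ≤ a) (hab : a < b) : pK a < pK b := by
  have hsub : {x : ℝ | |x| ≤ a} ⊆ {x : ℝ | |x| ≤ b} := fun x hx => le_trans hx hab.le
  have hmeas : MeasurableSet {x : ℝ | |x| ≤ a} := measurableSet_le (by fun_prop) (by fun_prop)
  have hd : 0 < (gaussianReal 0 1).real ({x : ℝ | |x| ≤ b} \ {x : ℝ | |x| ≤ a}) := by
    have hio : Set.Ioo a b ⊆ {x : ℝ | |x| ≤ b} \ {x : ℝ | |x| ≤ a} := by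
      rintro x ⟨h1, h2⟩
      have : |x| = x := abs_of_pos (lt_of_le_of_lt ha h1)
      simp only [Set.mem_sdiff, Set.mem_ofPred_eq, this]
      exact ⟨h2.le, not_le.2 h1⟩
    refine lt_of_lt_of_le ?_ (measureReal_mono hio)
    rw [measureReal_def, ENNReal.toReal_pos_iff]
    refine ⟨?_, measure_lt_top _ _⟩
    rw [pos_iff_ne_zero]
    intro h0
    have := gaussianReal_absolutelyContinuous' 0 (v := 1) one_ne_zero h0
    rw [Real.volume_Ioo, ENNReal.ofReal_eq_zero] at this
    linarith
  have := measureReal_sdiff (μ := gaussianReal 0 1) hsub hmeas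
  rw [this] at hd
  simpa [pK] using hd

lemma pK_lt_one (K : ℝ) : pK K < 1 := by
  have h1 : pK |K| < pK (|K| + 1) := pK_lt (abs_nonneg K) (by linarith)
  have h2 : pK (|K| + 1) ≤ 1 := measureReal_le_one
  have h3 : pK K ≤ pK |K| := measureReal_mono fun x hx => le_trans hx (le_abs_self K)
  linarith

lemma pK_pos {K : ℝ} (hK : 0 < K) : 0 < pK K := by
  simpa [pK_zero] using pK_lt le_rfl hK

lemma pK_eq_integral {K : ℝ} (hK : 0 ≤ K) :
    pK K = ∫ x in (-K)..K, gaussianPDFReal 0 1 x := by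
  have hs : {x : ℝ | |x| ≤ K} = Set.Icc (-K) K := by ext x; simp [abs_le]
  rw [pK, hs, measureReal_def, gaussianReal_apply_eq_integral _ one_ne_zero,
    ENNReal.toReal_ofReal (integral_nonneg fun x => gaussianPDFReal_nonneg _ _ _),
    intervalIntegral.integral_of_le (by linarith), integral_Icc_eq_integral_Ioc]

lemma continuousOn_pK : ContinuousOn pK (Set.Ici 0) := by
  have hi : Integrable (gaussianPDFReal 0 1) := integrable_gaussianPDFReal 0 1
  have hc : Continuous fun K : ℝ => ∫ x in (0 : ℝ)..K, gaussianPDFReal 0 1 x :=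
    intervalIntegral.continuous_primitive (fun a b => hi.intervalIntegrable) 0
  have hc2 : Continuous fun K : ℝ => ∫ x in (-K)..K, gaussianPDFReal 0 1 x := by
    have : (fun K : ℝ => ∫ x in (-K)..K, gaussianPDFReal 0 1 x) = fun K : ℝ =>
        (∫ x in (0 : ℝ)..K, gaussianPDFReal 0 1 x) -
          ∫ x in (0 : ℝ)..(-K), gaussianPDFReal 0 1 x := by
      ext K
      rw [intervalIntegral.integral_interval_sub_left hi.intervalIntegrable
        hi.intervalIntegrable]
    rw [this]
    exact hc.sub (hc.comp continuous_neg)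
  exact hc2.continuousOn.congr fun K hK => pK_eq_integral hK

lemma tendsto_pK : Filter.Tendsto pK Filter.atTop (nhds 1) := by
  have h := tendsto_measure_iUnion_atTop (μ := gaussianReal 0 1)
    (s := fun K : ℝ => {x : ℝ | |x| ≤ K}) (fun a b hab x hx => le_trans hx hab)
  have hu : (⋃ K : ℝ, {x : ℝ | |x| ≤ K}) = Set.univ := by
    ext x; simp only [Set.mem_iUnion, Set.mem_ofPred_eq, Set.mem_univ, iff_true]
    exact ⟨|x|, le_rfl⟩
  rw [hu, measure_univ] at h
  have := (ENNReal.tendsto_toReal ENNReal.one_ne_top).comp h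
  exact this

/-- The equation that defines `K_c(α)` has exactly one solution. -/
theorem existsUnique_criticalDensity_eq {α : ℝ} (hα : 0 < α) :
    ∃! K : ℝ, 0 < K ∧ criticalDensity K = α := by
  have hl2 : 0 < Real.log 2 := Real.log_pos one_lt_two
  have key : ∀ K : ℝ, 0 < K →
      (criticalDensity K = α ↔ pK K = Real.exp (-Real.log 2 / α)) := by
    intro K hK
    have hlog : Real.log (pK K) < 0 := Real.log_neg (pK_pos hK) (pK_lt_one K)
    have hiff : pK K = Real.exp (-Real.log 2 / α) ↔ Real.log (pK K) = -Real.log 2 / α := by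
      constructor
      · intro h; rw [h, Real.log_exp]
      · intro h; rw [← h, Real.exp_log (pK_pos hK)]
    rw [hiff, criticalDensity, div_eq_iff hlog.ne, eq_div_iff hα.ne', mul_comm, eq_comm]
  have ht0 : 0 < Real.exp (-Real.log 2 / α) := Real.exp_pos _
  have ht1 : Real.exp (-Real.log 2 / α) < 1 := by
    rw [Real.exp_lt_one_iff]
    exact div_neg_of_neg_of_pos (by linarith) hα
  obtain ⟨B, hB0, hB⟩ : ∃ B : ℝ, 0 < B ∧ Real.exp (-Real.log 2 / α) < pK B :=
    ((Filter.eventually_gt_atTop 0).and (tendsto_pK.eventually (lt_mem_nhds ht1))).exists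
  obtain ⟨K, hKm, hKe⟩ : Real.exp (-Real.log 2 / α) ∈ pK '' Set.Icc 0 B :=
    intermediate_value_Icc hB0.le (continuousOn_pK.mono fun x hx => hx.1)
      ⟨by rw [pK_zero]; exact ht0.le, hB.le⟩
  have hK0 : 0 < K := by
    rcases hKm.1.eq_or_lt with h | h
    · rw [← h, pK_zero] at hKe; linarith
    · exact h
  refine ⟨K, ⟨hK0, (key K hK0).2 hKe⟩, ?_⟩
  rintro L ⟨hL0, hL⟩
  have hLe := (key L hL0).1 hL
  rcases lt_trichotomy L K with h | h | h
  · have := pK_lt hL0.le h; linarith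
  · exact h
  · have := pK_lt hK0.le h; linarith

/-- The critical value `K_c(α)`: the unique positive solution `K` of `α_c(K) = α`. -/
def criticalK (α : ℝ) : ℝ := sInf {K : ℝ | 0 < K ∧ criticalDensity K = α}

lemma criticalK_spec {α : ℝ} (hα : 0 < α) :
    0 < criticalK α ∧ criticalDensity (criticalK α) = α := by
  obtain ⟨K, hK, hu⟩ := existsUnique_criticalDensity_eq hα
  have hs : {K : ℝ | 0 < K ∧ criticalDensity K = α} = {K} := by
    ext x; exact ⟨fun hx => hu x hx, fun hx => by rw [Set.mem_singleton_iff.1 hx]; exact hK⟩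
  rw [criticalK, hs, csInf_singleton]
  exact hK

/-- The law of an `m × n` matrix with i.i.d. normal entries of mean `0` and variance `1 / n`. -/
def gaussianEnsemble (m n : ℕ) : Measure (Fin m → Fin n → ℝ) :=
  Measure.pi fun _ => Measure.pi fun _ => gaussianReal 0 (1 / (n : NNReal))

instance (m n : ℕ) : IsProbabilityMeasure (gaussianEnsemble m n) := by
  unfold gaussianEnsemble; infer_instance

/-- The vector `A σ ∈ ℝ^m` of a matrix `A` and a sign vector `σ ∈ {-1, 1}^n`; its norm in
`Fin m → ℝ` is the sup norm. -/
def mulSign {m n : ℕ} (A : Fin m → Fin n → ℝ) (σ : Fin n → ℤˣ) : Fin m → ℝ :=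
  (Matrix.of A).mulVec fun j => (((σ j : ℤˣ) : ℤ) : ℝ)

/-- The discrepancy `min_σ ‖A σ‖_∞` over all sign vectors. -/
def disc {m n : ℕ} (A : Fin m → Fin n → ℝ) : ℝ := ⨅ σ : Fin n → ℤˣ, ‖mulSign A σ‖

open Classical in
/-- The solutions `Z_K(A)`: the sign vectors `σ` with `‖A σ‖_∞ ≤ K`. -/
def solutions {m n : ℕ} (K : ℝ) (A : Fin m → Fin n → ℝ) : Finset (Fin n → ℤˣ) :=
  Finset.univ.filter fun σ => ‖mulSign A σ‖ ≤ K

end SymPerceptron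

end

/-!
Write `a` for the reciprocal of the critical density `α_c(K)`, so that `p ^ (1 / a) = 1 / 2` for
`p = pK K`. By linearity, `E|Z|² / (E|Z|)² = 2⁻ⁿ ∑ₖ (n choose k) (qₖ / p²) ^ m`, where `qₖ` is the
probability that two sign vectors which differ in `k` coordinates both satisfy a given row
(`integral_card_solutions_sq`). A bound on this ratio gives the probability bound by the
Paley–Zygmund inequality (`sq_integral_div_le_measureReal_pos`). The latter is applied at
`K_c(α(n))` in place of `K`, so the bound has to be uniform in `K`.

The two row values are `U ± V` for independent Gaussian variables `U`, `V`, hence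
`qₖ = P(cos α |g₁| + sin α |g₂| ≤ K)` with `sin α ^ 2 = k / n`. In polar coordinates this is an
integral over an interval of directions that only moves with `α` (`overlapProb`), so its derivative
is elementary (`hasDerivAt_overlapProb`), and it decreases and is convex on `[0, π / 4]`.

In terms of the overlap `ρ = cos (2 α) = 1 - 2 k / n` and the entropy defect
`ι(ρ) = log 2 - h((1 + ρ) / 2)`, the `k`-th term is `exp (-n ι)` up to a polynomial factor, times
`(q / p²) ^ m` with `m ≤ n / a`. The sum is bounded once, for some `η > 0`, the inequality
`log (q / p²) ≤ (1 - η) a ι` holds for `ρ` up to some `ρ₀ < 1` and, for `ρ` beyond `ρ₀`, the term is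
at most `exp (-ν √k)` relative to the diagonal term `k = 0` (`OverlapGap`,
`exists_second_moment_sum_le`). Everything else establishes this gap for all `K > 0` (`overlapGap`).

* *Large overlap* (`tail_gap`). By convexity `(p - q) / α` decreases in `α`, whereas
  `(1 - exp (-a (log 2 - ι))) / α` increases as long as `a (log 2 - ι)` is small. So a gap at `ρ₀`
  propagates to the whole range beyond it.
* *Small overlap* (`overlapGap_of_sinh_le`). At `ρ = 0` both `q` and
  `p² (1 + κ (exp (a ι) - 1))` equal `p²`, so it is enough to compare derivatives. With
  `c = K ^ 2`, `r = massRatio c` and `y = artanh ρ` this is the inequality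
  `exp (-c ρ² / (1 - ρ²)) sinh (c ρ / (1 - ρ²)) ≤ κ c r² a √(1 - ρ²) y exp (a ι)`, with `κ < 1`.

The differential inequality is proved on ranges of `c`. In the middle range the logarithmic
derivative of its left side, relative to `√(1 - ρ²) y`, is bounded by a multiple of `ι'` through
rational functions (`SlopeBound`), and `r` and `a` are bounded by their Taylor polynomials and
tangents. For wide strips the Mills ratio gives a lower bound for `r² a`, and
`sinh x ≤ x exp (x ^ 2 / 6)` and `sinh x ≤ exp x / 2` cover small and larger overlaps
(`overlapGap_of_le_sq_massRatio`). For narrow strips `q ≤ p² / √(1 - ρ²)`, which bounds `q / p²`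
directly (`log_overlapProb_le`); there `ρ₀` depends on `K` and approaches `1` as `K → 0`.
-/

open Real Set

namespace SymPerceptron

/-! ### The standard Gaussian pair in polar coordinates -/

lemma setLIntegral_Ioc_mul_exp_neg_sq {R : ℝ} (hR : 0 ≤ R) :
    ∫⁻ r in Ioc 0 R, ENNReal.ofReal (r * exp (-r ^ 2 / 2) / (2 * π)) =
      ENNReal.ofReal ((1 - exp (-R ^ 2 / 2)) / (2 * π)) := by
  have hd : ∀ r ∈ uIcc 0 R, HasDerivAt (fun r : ℝ => -exp (-r ^ 2 / 2) / (2 * π))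
      (r * exp (-r ^ 2 / 2) / (2 * π)) r := by
    intro r _
    have h1 : HasDerivAt (fun r : ℝ => -r ^ 2 / 2) (-r) r := by
      have := ((hasDerivAt_pow 2 r).neg).div_const 2
      convert! this using 1
      ring
    have := (h1.exp.neg).div_const (2 * π)
    convert! this using 1
    ring
  have hc : Continuous fun r : ℝ => r * exp (-r ^ 2 / 2) / (2 * π) := by fun_prop
  have hi := hc.intervalIntegrable (μ := volume) 0 R
  rw [← ofReal_integral_eq_lintegral_ofReal hi.1]
  · rw [← intervalIntegral.integral_of_le hR, intervalIntegral.integral_eq_sub_of_hasDerivAt hd hi]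
    congr 1
    simp
    ring
  · filter_upwards [ae_restrict_mem measurableSet_Ioc] with r hr
    have := hr.1.le
    simp only [Pi.zero_apply]
    positivity

/-- Polar coordinates for a standard Gaussian pair `z`: given the direction `ψ` of `z`, the event
`N z ≤ K` for a positively homogeneous `N` says that the radius, which has density
`r * exp (-r ^ 2 / 2)`, is at most `K / N (cos ψ, sin ψ)`. -/
lemma gaussian_prod_homogeneous_le {N : ℝ × ℝ → ℝ} (hN : Measurable N) {K : ℝ} (hK : 0 < K)
    (hom : ∀ r ψ, 0 < r → N (r * cos ψ, r * sin ψ) = r * N (cos ψ, sin ψ))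
    (hpos : ∀ᵐ ψ ∂(volume : Measure ℝ), 0 < N (cos ψ, sin ψ)) :
    ((gaussianReal 0 1).prod (gaussianReal 0 1)) {z | N z ≤ K} =
      ∫⁻ ψ in Ioo (-π) π,
        ENNReal.ofReal ((1 - exp (-K ^ 2 / (2 * N (cos ψ, sin ψ) ^ 2))) / (2 * π)) := by
  have hS : MeasurableSet {z | N z ≤ K} := measurableSet_le hN measurable_const
  rw [gaussianReal_of_var_ne_zero _ one_ne_zero,
    prod_withDensity (measurable_gaussianPDF _ _) (measurable_gaussianPDF _ _),
    withDensity_apply _ hS, ← lintegral_indicator hS]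
  have hvol : (volume : Measure ℝ).prod volume = (volume : Measure (ℝ × ℝ)) := rfl
  rw [hvol, ← lintegral_comp_polarCoord_symm, polarCoord_target, ← hvol, ← Measure.prod_restrict,
    lintegral_prod_symm]
  · refine setLIntegral_congr_fun_ae measurableSet_Ioo ?_
    filter_upwards [hpos] with ψ hψ _
    set ν := N (cos ψ, sin ψ) with hν
    have hR : 0 ≤ K / ν := by positivity
    have e1 : -K ^ 2 / (2 * ν ^ 2) = -(K / ν) ^ 2 / 2 := by field_simp
    rw [e1, ← setLIntegral_Ioc_mul_exp_neg_sq hR,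
      ← lintegral_indicator measurableSet_Ioc, ← lintegral_indicator measurableSet_Ioi]
    refine lintegral_congr fun r => ?_
    by_cases hr : 0 < r
    · rw [indicator_of_mem (show r ∈ Ioi 0 from hr)]
      simp only [polarCoord_symm_apply, smul_eq_mul]
      by_cases hm : r ≤ K / ν
      · have hm' : N (r * cos ψ, r * sin ψ) ≤ K := by
          rw [hom r ψ hr]
          exact (le_div_iff₀ hψ).1 hm
        rw [indicator_of_mem (show r ∈ Ioc 0 (K / ν) from ⟨hr, hm⟩),
          indicator_of_mem (show (r * cos ψ, r * sin ψ) ∈ {z | N z ≤ K} from hm')]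
        simp only [gaussianPDF]
        rw [← ENNReal.ofReal_mul (gaussianPDFReal_nonneg _ _ _), ← ENNReal.ofReal_mul hr.le]
        congr 1
        simp only [gaussianPDFReal, NNReal.coe_one, mul_one, sub_zero]
        have h2 : √(2 * π) * √(2 * π) = 2 * π := mul_self_sqrt (by positivity)
        have h3 : exp (-(r * cos ψ) ^ 2 / 2) * exp (-(r * sin ψ) ^ 2 / 2) =
            exp (-r ^ 2 / 2) := by
          rw [← Real.exp_add]
          congr 1
          have := sin_sq_add_cos_sq ψ
          linear_combination (-r ^ 2 / 2) * this
        have h4 : (√(2 * π))⁻¹ * (√(2 * π))⁻¹ = (2 * π)⁻¹ := by rw [← mul_inv, h2]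
        rw [← h3, div_eq_mul_inv _ (2 * π), ← h4]
        ring
      · have hm' : ¬ N (r * cos ψ, r * sin ψ) ≤ K := by
          rw [hom r ψ hr]
          exact fun h => hm ((le_div_iff₀ hψ).2 h)
        rw [indicator_of_notMem (show r ∉ Ioc 0 (K / ν) from fun h => hm h.2),
          indicator_of_notMem (show (r * cos ψ, r * sin ψ) ∉ {z | N z ≤ K} from hm'), mul_zero]
    · rw [indicator_of_notMem (show r ∉ Ioi 0 from hr),
        indicator_of_notMem (show r ∉ Ioc 0 (K / ν) from fun h => hr h.1)]
  · refine Measurable.aemeasurable ?_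
    refine (measurable_fst.ennreal_ofReal).smul ?_
    have : Measurable fun z : ℝ × ℝ => gaussianPDF 0 1 z.1 * gaussianPDF 0 1 z.2 :=
      ((measurable_gaussianPDF 0 1).comp measurable_fst).mul
        ((measurable_gaussianPDF 0 1).comp measurable_snd)
    exact (this.indicator hS).comp continuous_polarCoord_symm.measurable

lemma ae_cos_sin_ne_zero : ∀ᵐ ψ ∂(volume : Measure ℝ), cos ψ ≠ 0 ∧ sin ψ ≠ 0 := by
  have hc : {ψ : ℝ | sin ψ * cos ψ = 0}.Countable := by
    have : {ψ : ℝ | sin ψ * cos ψ = 0} ⊆ range fun k : ℤ => k * π / 2 := by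
      intro ψ hψ
      have : sin (2 * ψ) = 0 := by rw [sin_two_mul, mul_assoc, show sin ψ * cos ψ = 0 from hψ]; simp
      obtain ⟨k, hk⟩ := sin_eq_zero_iff.1 this
      exact ⟨k, by simp only; linarith⟩
    exact (countable_range _).mono this
  filter_upwards [hc.ae_notMem volume] with ψ hψ
  constructor
  · intro h; exact hψ (by simp [h])
  · intro h; exact hψ (by simp [h])

/-- The real-valued form of `gaussian_prod_homogeneous_le` for an `N` that depends on the absolute
values of the coordinates only: the four quadrants contribute equally. -/
lemma gaussian_prod_real_homogeneous_le {N : ℝ × ℝ → ℝ} (hN : Measurable N) {K : ℝ} (hK : 0 < K)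
    (hom : ∀ r ψ, 0 < r → N (r * cos ψ, r * sin ψ) = r * N (cos ψ, sin ψ))
    (hpos : ∀ x y, x ≠ 0 → y ≠ 0 → 0 < N (x, y)) (habs : ∀ x y, N (x, y) = N (|x|, |y|)) :
    ((gaussianReal 0 1).prod (gaussianReal 0 1)).real {z | N z ≤ K} =
      2 / π * ∫ ψ in 0..(π / 2), (1 - exp (-K ^ 2 / (2 * N (cos ψ, sin ψ) ^ 2))) := by
  set F : ℝ → ℝ := fun ψ => 1 - exp (-K ^ 2 / (2 * N (cos ψ, sin ψ) ^ 2)) with hF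
  have hF0 : ∀ ψ, 0 ≤ F ψ := fun ψ => by
    have : -K ^ 2 / (2 * N (cos ψ, sin ψ) ^ 2) ≤ 0 :=
      div_nonpos_of_nonpos_of_nonneg (by nlinarith) (by positivity)
    have := exp_le_one_iff.2 this
    simp only [hF]; linarith
  have hF1 : ∀ ψ, F ψ ≤ 1 := fun ψ => by
    have := exp_pos (-K ^ 2 / (2 * N (cos ψ, sin ψ) ^ 2))
    simp only [hF]; linarith
  have hFm : Measurable F := by
    have : Measurable fun ψ : ℝ => N (cos ψ, sin ψ) := hN.comp (by fun_prop)
    fun_prop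
  have hFi : ∀ a b, IntervalIntegrable F volume a b := by
    intro a b
    refine (intervalIntegrable_const (c := (1 : ℝ))).mono_fun hFm.aestronglyMeasurable ?_
    filter_upwards with ψ
    rw [norm_of_nonneg (hF0 ψ)]; simpa using hF1 ψ
  have hpos' : ∀ᵐ ψ ∂(volume : Measure ℝ), 0 < N (cos ψ, sin ψ) := by
    filter_upwards [ae_cos_sin_ne_zero] with ψ hψ
    exact hpos _ _ hψ.1 hψ.2
  have hI : ∫ ψ in (-π)..π, F ψ = 4 * ∫ ψ in 0..(π / 2), F ψ := by
    have hneg : ∀ ψ, F (-ψ) = F ψ := fun ψ => by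
      simp only [hF]
      rw [habs (cos (-ψ)), habs (cos ψ), cos_neg, sin_neg, abs_neg]
    have hsub : ∀ ψ, F (π - ψ) = F ψ := fun ψ => by
      simp only [hF]
      rw [habs (cos (π - ψ)), habs (cos ψ), cos_pi_sub, sin_pi_sub, abs_neg]
    have h1 : ∫ ψ in (-π)..0, F ψ = ∫ ψ in 0..π, F ψ := by
      have := intervalIntegral.integral_comp_neg (a := 0) (b := π) F
      simp only [hneg, neg_zero] at this
      exact this.symm
    have h2 : ∫ ψ in (π / 2)..π, F ψ = ∫ ψ in 0..(π / 2), F ψ := by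
      have := intervalIntegral.integral_comp_sub_left (a := 0) (b := π / 2) F π
      simp only [hsub, sub_zero] at this
      rw [this]; congr 1; ring
    rw [← intervalIntegral.integral_add_adjacent_intervals (hFi (-π) 0) (hFi 0 π), h1,
      ← intervalIntegral.integral_add_adjacent_intervals (hFi 0 (π / 2)) (hFi (π / 2) π), h2]
    ring
  rw [measureReal_def, gaussian_prod_homogeneous_le hN hK hom hpos',
    ← ofReal_integral_eq_lintegral_ofReal, ENNReal.toReal_ofReal, ← integral_Ioc_eq_integral_Ioo,
    ← intervalIntegral.integral_of_le (by linarith [pi_pos]), intervalIntegral.integral_div, hI]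
  · field_simp; ring
  · exact integral_nonneg fun ψ => div_nonneg (hF0 ψ) (by positivity)
  · have := ((hFi (-π) π).1.mono_set Ioo_subset_Ioc_self).div_const (2 * π)
    exact this
  · filter_upwards with ψ
    exact div_nonneg (hF0 ψ) (by positivity)

/-! ### The probability that two overlapping sign vectors satisfy a row -/

/-- The density over directions `φ` in the definition of `overlapProb`: the probability that a
standard Gaussian pair pointing at angle `φ` from the normal of a line at distance `K` from the
origin does not reach that line. -/
noncomputable def angleDensity (K φ : ℝ) : ℝ := 1 - exp (-K ^ 2 / (2 * cos φ ^ 2))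

/-- The probability `P(cos α |g₁| + sin α |g₂| ≤ K)` for a standard Gaussian pair, written in polar
coordinates. For sign vectors that differ in a proportion `sin α ^ 2` of the coordinates this is
the probability that both satisfy a given row; the correlation of the two row values is
`cos (2 α)`. -/
noncomputable def overlapProb (K α : ℝ) : ℝ := 2 / π * ∫ φ in (-α)..(π / 2 - α), angleDensity K φ

lemma angleDensity_nonneg (K φ : ℝ) : 0 ≤ angleDensity K φ := by
  have : -K ^ 2 / (2 * cos φ ^ 2) ≤ 0 :=
    div_nonpos_of_nonpos_of_nonneg (by nlinarith) (by positivity)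
  have := exp_le_one_iff.2 this
  simp only [angleDensity]; linarith

lemma angleDensity_le_one (K φ : ℝ) : angleDensity K φ ≤ 1 := by
  have := exp_pos (-K ^ 2 / (2 * cos φ ^ 2))
  simp only [angleDensity]; linarith

lemma angleDensity_neg (K φ : ℝ) : angleDensity K (-φ) = angleDensity K φ := by
  simp [angleDensity]

lemma intervalIntegrable_angleDensity (K a b : ℝ) :
    IntervalIntegrable (angleDensity K) volume a b := by
  have hm : Measurable (angleDensity K) := by unfold angleDensity; fun_prop
  refine (intervalIntegrable_const (c := (1 : ℝ))).mono_fun hm.aestronglyMeasurable ?_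
  filter_upwards with ψ
  rw [norm_of_nonneg (angleDensity_nonneg K ψ)]; simpa using angleDensity_le_one K ψ

theorem gaussian_prod_overlap {K : ℝ} (hK : 0 < K) {α : ℝ} (h0 : 0 ≤ α) (h1 : α ≤ π / 2) :
    ((gaussianReal 0 1).prod (gaussianReal 0 1)).real
      {z | cos α * |z.1| + sin α * |z.2| ≤ K} = overlapProb K α := by
  have hc : 0 ≤ cos α := cos_nonneg_of_neg_pi_div_two_le_of_le (by linarith [pi_pos]) h1
  have hs : 0 ≤ sin α := sin_nonneg_of_nonneg_of_le_pi h0 (by linarith [pi_pos])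
  rw [gaussian_prod_real_homogeneous_le (N := fun z : ℝ × ℝ => cos α * |z.1| + sin α * |z.2|)
    (by fun_prop) hK, overlapProb]
  · congr 1
    have := intervalIntegral.integral_comp_sub_right (a := 0) (b := π / 2) (angleDensity K) α
    rw [zero_sub] at this
    rw [← this]
    refine intervalIntegral.integral_congr fun ψ hψ => ?_
    rw [uIcc_of_le (by linarith [pi_pos])] at hψ
    have e1 : |cos ψ| = cos ψ :=
      abs_of_nonneg (cos_nonneg_of_neg_pi_div_two_le_of_le (by linarith [hψ.1, pi_pos]) hψ.2)
    have e2 : |sin ψ| = sin ψ :=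
      abs_of_nonneg (sin_nonneg_of_nonneg_of_le_pi hψ.1 (by linarith [hψ.2, pi_pos]))
    simp only [angleDensity, cos_sub]
    rw [e1, e2, mul_comm (cos α), mul_comm (sin α)]
  · intro r ψ hr
    simp only [abs_mul, abs_of_pos hr]
    ring
  · intro x y hx hy
    have hx := abs_pos.2 hx
    have hy := abs_pos.2 hy
    simp only
    rcases hc.eq_or_lt with h | h
    · have : 0 < sin α := by
        rcases hs.eq_or_lt with h' | h'
        · have := sin_sq_add_cos_sq α
          rw [← h, ← h'] at this
          norm_num at this
        · exact h'
      nlinarith [mul_pos this hy]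
    · nlinarith [mul_pos h hx, mul_nonneg hs hy.le]
  · intro x y; simp

lemma overlapProb_zero {K : ℝ} (hK : 0 < K) : overlapProb K 0 = pK K := by
  rw [← gaussian_prod_overlap hK le_rfl (by positivity)]
  have : {z : ℝ × ℝ | cos 0 * |z.1| + sin 0 * |z.2| ≤ K} = {x : ℝ | |x| ≤ K} ×ˢ univ := by
    ext z; simp
  rw [this, measureReal_prod_prod, pK]
  simp

lemma overlapProb_pi_div_four {K : ℝ} (hK : 0 < K) : overlapProb K (π / 4) = pK K ^ 2 := by
  have h := gaussian_prod_real_homogeneous_le (N := fun z : ℝ × ℝ => max |z.1| |z.2|)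
    (by fun_prop) hK ?_ ?_ ?_
  · have e : {z : ℝ × ℝ | max |z.1| |z.2| ≤ K} = {x : ℝ | |x| ≤ K} ×ˢ {x : ℝ | |x| ≤ K} := by
      ext z; simp
    rw [e, measureReal_prod_prod] at h
    rw [sq, pK, h, overlapProb, show π / 2 - π / 4 = π / 4 by ring]
    congr 1
    have i1 : ∫ φ in (-(π / 4))..0, angleDensity K φ = ∫ φ in 0..(π / 4), angleDensity K φ := by
      have := intervalIntegral.integral_comp_neg (a := 0) (b := π / 4) (angleDensity K)
      simp only [angleDensity_neg, neg_zero] at this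
      exact this.symm
    have hp := pi_pos
    have j1 : ∫ ψ in 0..(π / 4), (1 - exp (-K ^ 2 / (2 * max |cos ψ| |sin ψ| ^ 2))) =
        ∫ φ in 0..(π / 4), angleDensity K φ := by
      refine intervalIntegral.integral_congr fun ψ hψ => ?_
      rw [uIcc_of_le (by linarith)] at hψ
      have a1 : 0 ≤ cos ψ :=
        cos_nonneg_of_neg_pi_div_two_le_of_le (by linarith [hψ.1]) (by linarith [hψ.2])
      have a2 : 0 ≤ sin ψ := sin_nonneg_of_nonneg_of_le_pi hψ.1 (by linarith [hψ.2])
      have a3 : sin ψ ≤ cos ψ := by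
        rw [← cos_pi_div_two_sub]
        exact cos_le_cos_of_nonneg_of_le_pi hψ.1 (by linarith [hψ.1]) (by linarith [hψ.2])
      simp only [angleDensity]
      rw [abs_of_nonneg a1, abs_of_nonneg a2, max_eq_left a3]
    have j2 : ∫ ψ in (π / 4)..(π / 2), (1 - exp (-K ^ 2 / (2 * max |cos ψ| |sin ψ| ^ 2))) =
        ∫ ψ in 0..(π / 4), (1 - exp (-K ^ 2 / (2 * max |cos ψ| |sin ψ| ^ 2))) := by
      have := intervalIntegral.integral_comp_sub_left (a := 0) (b := π / 4)
        (fun ψ => 1 - exp (-K ^ 2 / (2 * max |cos ψ| |sin ψ| ^ 2))) (π / 2)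
      simp only [cos_pi_div_two_sub, sin_pi_div_two_sub, sub_zero] at this
      rw [show π / 2 - π / 4 = π / 4 by ring] at this
      rw [← this]
      refine intervalIntegral.integral_congr fun ψ _ => ?_
      rw [max_comm]
    have hi : ∀ a b, IntervalIntegrable
        (fun ψ => 1 - exp (-K ^ 2 / (2 * max |cos ψ| |sin ψ| ^ 2))) volume a b := by
      intro a b
      refine (intervalIntegrable_const (c := (1 : ℝ))).mono_fun ?_ ?_
      · exact (by fun_prop : Measurable _).aestronglyMeasurable
      · filter_upwards with ψ
        have : -K ^ 2 / (2 * max |cos ψ| |sin ψ| ^ 2) ≤ 0 :=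
          div_nonpos_of_nonpos_of_nonneg (by nlinarith) (by positivity)
        have h1 := exp_le_one_iff.2 this
        have h2 := exp_pos (-K ^ 2 / (2 * max |cos ψ| |sin ψ| ^ 2))
        rw [norm_of_nonneg (by linarith)]
        simp only [norm_one]
        linarith
    rw [← intervalIntegral.integral_add_adjacent_intervals
      (intervalIntegrable_angleDensity K _ 0) (intervalIntegrable_angleDensity K 0 _), i1,
      ← intervalIntegral.integral_add_adjacent_intervals (hi 0 (π / 4)) (hi (π / 4) (π / 2)),
      j2, j1]
  · intro r ψ hr
    simp only [abs_mul, abs_of_pos hr]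
    rw [mul_max_of_nonneg _ _ hr.le]
  · intro x y hx _
    exact lt_max_of_lt_left (abs_pos.2 hx)
  · intro x y; simp

lemma overlapProb_pi_div_two_sub (K α : ℝ) : overlapProb K (π / 2 - α) = overlapProb K α := by
  rw [overlapProb, overlapProb, show π / 2 - (π / 2 - α) = α by ring]
  congr 1
  have := intervalIntegral.integral_comp_neg (a := -(π / 2 - α)) (b := α) (angleDensity K)
  simp only [angleDensity_neg, neg_neg] at this
  exact this

/-- Minus the derivative of `overlapProb K` at `α`. -/
noncomputable def overlapRate (K α : ℝ) : ℝ :=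
  2 / π * (exp (-K ^ 2 / (2 * cos α ^ 2)) - exp (-K ^ 2 / (2 * sin α ^ 2)))

lemma hasDerivAt_overlapProb (K : ℝ) {α : ℝ} (h0 : 0 < α) (h1 : α < π / 2) :
    HasDerivAt (overlapProb K) (-overlapRate K α) α := by
  have hcos : ∀ φ, -(π / 2) < φ → φ < π / 2 → ContinuousAt (angleDensity K) φ := by
    intro φ ha hb
    have : cos φ ≠ 0 := (cos_pos_of_mem_Ioo ⟨ha, hb⟩).ne'
    unfold angleDensity
    fun_prop (disch := positivity)
  have hm : ∀ φ, StronglyMeasurableAtFilter (angleDensity K) (nhds φ) volume := fun φ => by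
    have hm : Measurable (angleDensity K) := by unfold angleDensity; fun_prop
    exact hm.stronglyMeasurable.stronglyMeasurableAtFilter
  have hF := intervalIntegral.integral_hasStrictFDerivAt
    (intervalIntegrable_angleDensity K (-α) (π / 2 - α)) (hm _) (hm _)
    (hcos (-α) (by linarith) (by linarith [pi_pos]))
    (hcos (π / 2 - α) (by linarith [pi_pos]) (by linarith))
  have hpair : HasDerivAt (fun a : ℝ => ((-a, π / 2 - a) : ℝ × ℝ)) (-1, -1) α :=
    ((hasDerivAt_id α).neg).prodMk (by simpa using (hasDerivAt_id α).const_sub (π / 2))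
  have := (hF.hasFDerivAt.comp_hasDerivAt α hpair).const_mul (2 / π)
  refine this.congr_deriv ?_
  simp only [overlapRate, angleDensity, sub_apply,
    ContinuousLinearMap.smulRight_apply, ContinuousLinearMap.coe_fst', ContinuousLinearMap.coe_snd',
    cos_neg, cos_pi_div_two_sub, smul_eq_mul]
  ring

lemma continuous_overlapProb (K : ℝ) : Continuous (overlapProb K) := by
  have h0 : Continuous fun x => ∫ φ in (0 : ℝ)..x, angleDensity K φ :=
    intervalIntegral.continuous_primitive (fun a b => intervalIntegrable_angleDensity K a b) 0
  have : overlapProb K = fun α => 2 / π * ((∫ φ in (0 : ℝ)..(π / 2 - α), angleDensity K φ) -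
      ∫ φ in (0 : ℝ)..(-α), angleDensity K φ) := by
    ext α
    rw [overlapProb, intervalIntegral.integral_interval_sub_left
      (intervalIntegrable_angleDensity _ _ _) (intervalIntegrable_angleDensity _ _ _)]
  rw [this]
  exact continuous_const.mul ((h0.comp (by fun_prop)).sub (h0.comp (by fun_prop)))

lemma overlapRate_antitoneOn (K : ℝ) : AntitoneOn (overlapRate K) (Ioc 0 (π / 4)) := by
  intro a ha b hb hab
  have hp := pi_pos
  have ca : 0 < cos b := cos_pos_of_mem_Ioo ⟨by linarith [hb.1], by linarith [hb.2]⟩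
  have cb : cos b ≤ cos a := cos_le_cos_of_nonneg_of_le_pi ha.1.le (by linarith [hb.2]) hab
  have sa : 0 < sin a := sin_pos_of_pos_of_lt_pi ha.1 (by linarith [ha.2])
  have sb : sin a ≤ sin b :=
    sin_le_sin_of_le_of_le_pi_div_two (by linarith [ha.1]) (by linarith [hb.2]) hab
  have e1 : exp (-K ^ 2 / (2 * cos b ^ 2)) ≤ exp (-K ^ 2 / (2 * cos a ^ 2)) := by
    apply exp_le_exp.2
    rw [neg_div, neg_div]
    apply neg_le_neg
    gcongr
  have e2 : exp (-K ^ 2 / (2 * sin a ^ 2)) ≤ exp (-K ^ 2 / (2 * sin b ^ 2)) := by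
    apply exp_le_exp.2
    rw [neg_div, neg_div]
    apply neg_le_neg
    gcongr
  unfold overlapRate
  gcongr

lemma overlapRate_nonneg (K : ℝ) {α : ℝ} (h0 : 0 < α) (h1 : α ≤ π / 4) : 0 ≤ overlapRate K α := by
  have : overlapRate K (π / 4) = 0 := by simp [overlapRate]
  rw [← this]
  exact overlapRate_antitoneOn K ⟨h0, h1⟩ ⟨by positivity, le_rfl⟩ h1

lemma antitoneOn_overlapProb (K : ℝ) : AntitoneOn (overlapProb K) (Icc 0 (π / 4)) := by
  refine antitoneOn_of_hasDerivWithinAt_nonpos (f' := fun α => -overlapRate K α)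
    (convex_Icc _ _) (continuous_overlapProb K).continuousOn ?_ ?_
  · intro α hα
    rw [interior_Icc] at hα
    exact (hasDerivAt_overlapProb K hα.1 (by linarith [hα.2, pi_pos])).hasDerivWithinAt
  · intro α hα
    rw [interior_Icc] at hα
    linarith [overlapRate_nonneg K hα.1 hα.2.le]

lemma convexOn_overlapProb (K : ℝ) : ConvexOn ℝ (Icc 0 (π / 4)) (overlapProb K) := by
  refine MonotoneOn.convexOn_of_deriv (convex_Icc _ _) (continuous_overlapProb K).continuousOn ?_ ?_
  · intro α hα
    rw [interior_Icc] at hα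
    exact (hasDerivAt_overlapProb K hα.1
      (by linarith [hα.2, pi_pos])).differentiableAt.differentiableWithinAt
  · rw [interior_Icc]
    intro a ha b hb hab
    rw [(hasDerivAt_overlapProb K ha.1 (by linarith [ha.2, pi_pos])).deriv,
      (hasDerivAt_overlapProb K hb.1 (by linarith [hb.2, pi_pos])).deriv]
    have := overlapRate_antitoneOn K ⟨ha.1, ha.2.le⟩ ⟨hb.1, hb.2.le⟩ hab
    linarith

/-! ### Moments of the number of solutions -/

/-- The number of coordinates in which two sign vectors differ. -/
def disagree {n : ℕ} (σ τ : Fin n → ℤˣ) : ℕ := (Finset.univ.filter fun j => σ j ≠ τ j).card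

/-- The angle of a pair of sign vectors of length `n` that differ in `k` coordinates: the row
values of the pair have correlation `cos (2 * overlapAngle n k) = 1 - 2 * k / n`. -/
noncomputable def overlapAngle (n k : ℕ) : ℝ := arcsin √(k / n)

lemma map_signed_sum_gaussian {n : ℕ} (v : NNReal) (w : Fin n → ℝ) (hw : ∀ i, w i ^ 2 = 1)
    (s : Finset (Fin n)) :
    (Measure.pi fun _ : Fin n => gaussianReal 0 v).map (fun a => ∑ i ∈ s, a i * w i) =
      gaussianReal 0 (s.card * v) := by
  classical
  induction s using Finset.induction_on with
  | empty => simp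
  | insert i s hi ih =>
    have hX : (Measure.pi fun _ : Fin n => gaussianReal 0 v).map (fun a => a i * w i) =
        gaussianReal 0 v := by
      have : (fun a : Fin n → ℝ => a i * w i) = (fun x : ℝ => x * w i) ∘ (fun a => a i) := rfl
      rw [this, ← Measure.map_map (by fun_prop) (by fun_prop),
        (measurePreserving_eval (fun _ : Fin n => gaussianReal 0 v) i).map_eq,
        gaussianReal_map_mul_const, mul_zero]
      congr 1
      ext
      simp [hw i]
    have hind : iIndepFun (fun j (a : Fin n → ℝ) => a j * w j)
        (Measure.pi fun _ : Fin n => gaussianReal 0 v) :=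
      iIndepFun_pi (X := fun j (x : ℝ) => x * w j) fun j => by fun_prop
    have h2 := (hind.indepFun_finsetSum_of_notMem (fun j => by fun_prop) hi).symm
    have e : (fun a : Fin n → ℝ => ∑ j ∈ insert i s, a j * w j) =
        (fun a => a i * w i) + ∑ j ∈ s, fun a : Fin n → ℝ => a j * w j := by
      ext a
      simp [Finset.sum_insert hi]
    rw [e, gaussianReal_add_gaussianReal_of_indepFun h2 hX (v₂ := s.card * v) (m₂ := 0)]
    · rw [Finset.card_insert_of_notMem hi, add_zero]
      congr 1
      push_cast
      ring
    · rw [← ih]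
      congr 1
      ext a
      simp

/-- The row values `∑ aⱼσⱼ` and `∑ aⱼτⱼ` are `U + V` and `U - V`, where `U` and `V` collect the
coordinates in which `σ` and `τ` agree and differ. These are independent, and both row values are
at most `K` in absolute value exactly when `|U| + |V| ≤ K`. -/
lemma row_pair_prob {K : ℝ} (hK : 0 < K) {n : ℕ} (hn : 1 ≤ n) (σ τ : Fin n → ℤˣ) :
    (Measure.pi fun _ : Fin n => gaussianReal 0 (1 / (n : NNReal))).real
      {a | |∑ j, a j * ((σ j : ℤ) : ℝ)| ≤ K ∧ |∑ j, a j * ((τ j : ℤ) : ℝ)| ≤ K} =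
      overlapProb K (overlapAngle n (disagree σ τ)) := by
  classical
  set μ := Measure.pi fun _ : Fin n => gaussianReal 0 (1 / (n : NNReal)) with hμ
  set w : Fin n → ℝ := fun j => ((σ j : ℤ) : ℝ) with hw
  have hw2 : ∀ j, w j ^ 2 = 1 := fun j => by
    rcases Int.units_eq_one_or (σ j) with h | h <;> simp [hw, h]
  set D := Finset.univ.filter fun j => σ j ≠ τ j with hD
  set E := Finset.univ.filter fun j => ¬ σ j ≠ τ j with hE
  set U : (Fin n → ℝ) → ℝ := fun a => ∑ j ∈ E, a j * w j with hU
  set V : (Fin n → ℝ) → ℝ := fun a => ∑ j ∈ D, a j * w j with hV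
  have hcard : D.card + E.card = n := by
    have := Finset.card_filter_add_card_filter_not (s := (Finset.univ : Finset (Fin n)))
      (fun j => σ j ≠ τ j)
    rw [Finset.card_univ, Fintype.card_fin] at this
    exact this
  have hσ : ∀ a : Fin n → ℝ, ∑ j, a j * ((σ j : ℤ) : ℝ) = U a + V a := by
    intro a
    rw [add_comm]
    exact (Finset.sum_filter_add_sum_filter_not _ _ _).symm
  have hτ : ∀ a : Fin n → ℝ, ∑ j, a j * ((τ j : ℤ) : ℝ) = U a - V a := by
    intro a
    rw [← Finset.sum_filter_add_sum_filter_not _ (fun j => σ j ≠ τ j)]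
    have h1 : ∑ j ∈ D, a j * ((τ j : ℤ) : ℝ) = -V a := by
      rw [hV, ← Finset.sum_neg_distrib]
      refine Finset.sum_congr rfl fun j hj => ?_
      have hne : σ j ≠ τ j := (Finset.mem_filter.1 hj).2
      rcases Int.units_eq_one_or (σ j) with h | h <;>
        rcases Int.units_eq_one_or (τ j) with h' | h' <;> simp_all
    have h2 : ∑ j ∈ E, a j * ((τ j : ℤ) : ℝ) = U a := by
      refine Finset.sum_congr rfl fun j hj => ?_
      have heq : σ j = τ j := not_not.1 (Finset.mem_filter.1 hj).2
      simp [hw, heq]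
    rw [h1, h2]
    ring
  have hset : {a : Fin n → ℝ | |∑ j, a j * ((σ j : ℤ) : ℝ)| ≤ K ∧
      |∑ j, a j * ((τ j : ℤ) : ℝ)| ≤ K} = (fun a => (U a, V a)) ⁻¹' {z | |z.1| + |z.2| ≤ K} := by
    ext a
    simp only [mem_ofPred_eq, mem_preimage, hσ, hτ]
    constructor
    · rintro ⟨h1, h2⟩
      rw [abs_le] at h1 h2
      rcases abs_cases (U a) with h | h <;> rcases abs_cases (V a) with h' | h' <;> linarith
    · intro h
      exact ⟨(abs_add_le _ _).trans h, (abs_sub _ _).trans h⟩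
  have hUm : Measurable U := by fun_prop
  have hVm : Measurable V := by fun_prop
  have hind : iIndepFun (fun j (a : Fin n → ℝ) => a j * w j) μ :=
    iIndepFun_pi (X := fun j (x : ℝ) => x * w j) fun j => by fun_prop
  have hdisj : Disjoint E D := (Finset.disjoint_filter_filter_not _ _ _).symm
  have hUV : IndepFun U V μ := by
    have := (hind.indepFun_finset E D hdisj (fun j => by fun_prop)).comp
      (φ := fun f : E → ℝ => ∑ j, f j) (ψ := fun f : D → ℝ => ∑ j, f j)
      (by fun_prop) (by fun_prop)
    convert! this using 1
    · ext a
      simp only [hU, Function.comp]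
      exact (Finset.sum_coe_sort E (fun j => a j * w j)).symm
    · ext a
      simp only [hV, Function.comp]
      exact (Finset.sum_coe_sort D (fun j => a j * w j)).symm
  have hn0 : (0 : ℝ) < n := by exact_mod_cast hn
  set α := overlapAngle n D.card with hα
  have hk1 : (D.card : ℝ) / n ≤ 1 := by
    rw [div_le_one hn0]
    exact_mod_cast (by omega : D.card ≤ n)
  have hsin : sin α = √(D.card / n) :=
    sin_arcsin (le_trans (by norm_num) (sqrt_nonneg _)) (sqrt_le_one.2 hk1)
  have hcos : cos α = √(E.card / n) := by
    rw [hα, overlapAngle, cos_arcsin, sq_sqrt (by positivity)]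
    congr 1
    have : (D.card : ℝ) + E.card = n := by exact_mod_cast hcard
    rw [eq_div_iff hn0.ne', sub_mul, div_mul_cancel₀ _ hn0.ne']
    linarith
  have hmap : μ.map (fun a => (U a, V a)) =
      ((gaussianReal 0 1).prod (gaussianReal 0 1)).map
        (Prod.map (fun x => cos α * x) (fun x => sin α * x)) := by
    rw [(indepFun_iff_map_prod_eq_prod_map_map hUm.aemeasurable hVm.aemeasurable).1 hUV,
      ← Measure.map_prod_map _ _ (by fun_prop) (by fun_prop), gaussianReal_map_const_mul,
      gaussianReal_map_const_mul, hμ, map_signed_sum_gaussian _ w hw2,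
      map_signed_sum_gaussian _ w hw2, hsin, hcos]
    congr 2
    · simp
    · ext
      push_cast
      rw [sq_sqrt (by positivity)]
      ring
    · simp
    · ext
      push_cast
      rw [sq_sqrt (by positivity)]
      ring
  have hms : MeasurableSet {z : ℝ × ℝ | |z.1| + |z.2| ≤ K} :=
    measurableSet_le (by fun_prop) (by fun_prop)
  have hα0 : 0 ≤ α := arcsin_nonneg.2 (sqrt_nonneg _)
  have hα1 : α ≤ π / 2 := arcsin_le_pi_div_two _
  have hc : 0 ≤ cos α := hcos ▸ sqrt_nonneg _
  have hs : 0 ≤ sin α := hsin ▸ sqrt_nonneg _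
  have hdis : disagree σ τ = D.card := rfl
  rw [hset, ← map_measureReal_apply (by fun_prop) hms, hmap,
    map_measureReal_apply (by fun_prop) hms, hdis, ← hα, ← gaussian_prod_overlap hK hα0 hα1]
  congr 1
  ext z
  simp [abs_mul, abs_of_nonneg hc, abs_of_nonneg hs]

lemma norm_mulSign_le_iff {m n : ℕ} {K : ℝ} (hK : 0 ≤ K) (A : Fin m → Fin n → ℝ)
    (σ : Fin n → ℤˣ) : ‖mulSign A σ‖ ≤ K ↔ ∀ i, |∑ j, A i j * ((σ j : ℤ) : ℝ)| ≤ K := by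
  rw [pi_norm_le_iff_of_nonneg hK]
  rfl

lemma ensemble_pair_prob {K : ℝ} (hK : 0 < K) (m : ℕ) {n : ℕ} (hn : 1 ≤ n) (σ τ : Fin n → ℤˣ) :
    (gaussianEnsemble m n).real {A | ‖mulSign A σ‖ ≤ K ∧ ‖mulSign A τ‖ ≤ K} =
      overlapProb K (overlapAngle n (disagree σ τ)) ^ m := by
  have hset : {A : Fin m → Fin n → ℝ | ‖mulSign A σ‖ ≤ K ∧ ‖mulSign A τ‖ ≤ K} =
      univ.pi fun _ => {a | |∑ j, a j * ((σ j : ℤ) : ℝ)| ≤ K ∧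
        |∑ j, a j * ((τ j : ℤ) : ℝ)| ≤ K} := by
    ext A
    simp only [mem_ofPred_eq, norm_mulSign_le_iff hK.le, mem_univ_pi, forall_and]
  rw [hset, gaussianEnsemble, measureReal_def, Measure.pi_pi, ENNReal.toReal_prod,
    Finset.prod_const, Finset.card_univ, Fintype.card_fin, ← measureReal_def,
    row_pair_prob hK hn]

lemma measurable_mulSign {m n : ℕ} (σ : Fin n → ℤˣ) :
    Measurable fun A : Fin m → Fin n → ℝ => mulSign A σ := by
  refine measurable_pi_lambda _ fun i => ?_
  show Measurable fun A : Fin m → Fin n → ℝ => ∑ j, A i j * ((σ j : ℤ) : ℝ)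
  fun_prop

lemma measurableSet_norm_mulSign_le {m n : ℕ} (K : ℝ) (σ : Fin n → ℤˣ) :
    MeasurableSet {A : Fin m → Fin n → ℝ | ‖mulSign A σ‖ ≤ K} :=
  measurableSet_le (measurable_mulSign σ).norm measurable_const

lemma overlapAngle_zero (n : ℕ) : overlapAngle n 0 = 0 := by simp [overlapAngle]

lemma ensemble_prob {K : ℝ} (hK : 0 < K) (m : ℕ) {n : ℕ} (hn : 1 ≤ n) (σ : Fin n → ℤˣ) :
    (gaussianEnsemble m n).real {A | ‖mulSign A σ‖ ≤ K} = pK K ^ m := by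
  have := ensemble_pair_prob hK m hn σ σ
  simp only [and_self] at this
  rw [this, disagree]
  simp [overlapAngle_zero, overlapProb_zero hK]

lemma card_solutions_eq {m n : ℕ} (K : ℝ) (A : Fin m → Fin n → ℝ) :
    ((solutions K A).card : ℝ) =
      ∑ σ : Fin n → ℤˣ, indicator {A : Fin m → Fin n → ℝ | ‖mulSign A σ‖ ≤ K} 1 A := by
  classical
  rw [solutions, Finset.card_filter]
  push_cast
  refine Finset.sum_congr rfl fun σ _ => ?_
  by_cases h : ‖mulSign A σ‖ ≤ K
  · rw [if_pos h, indicator_of_mem (show A ∈ {A | ‖mulSign A σ‖ ≤ K} from h)]; rfl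
  · rw [if_neg h, indicator_of_notMem (show A ∉ {A | ‖mulSign A σ‖ ≤ K} from h)]

lemma integral_card_solutions {K : ℝ} (hK : 0 < K) (m : ℕ) {n : ℕ} (hn : 1 ≤ n) :
    ∫ A, ((solutions K A).card : ℝ) ∂(gaussianEnsemble m n) = 2 ^ n * pK K ^ m := by
  simp_rw [card_solutions_eq]
  rw [integral_finsetSum]
  · simp_rw [integral_indicator_one (measurableSet_norm_mulSign_le K _), ensemble_prob hK m hn]
    simp [Fintype.card_pi]
  · intro σ _
    exact (integrable_const (1 : ℝ)).indicator (measurableSet_norm_mulSign_le K σ)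

lemma card_solutions_sq_eq {m n : ℕ} (K : ℝ) (A : Fin m → Fin n → ℝ) :
    ((solutions K A).card : ℝ) ^ 2 = ∑ σ : Fin n → ℤˣ, ∑ τ : Fin n → ℤˣ,
      indicator {A : Fin m → Fin n → ℝ | ‖mulSign A σ‖ ≤ K ∧ ‖mulSign A τ‖ ≤ K} 1 A := by
  rw [card_solutions_eq, sq, Finset.sum_mul_sum]
  refine Finset.sum_congr rfl fun σ _ => Finset.sum_congr rfl fun τ _ => ?_
  rw [← inter_indicator_mul]
  simp only [Pi.one_apply, mul_one]
  rfl

lemma disagree_eq_card_filter {n : ℕ} (σ ε : Fin n → ℤˣ) :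
    disagree σ (σ * ε) = (Finset.univ.filter fun j => ε j = -1).card := by
  unfold disagree
  congr 1
  ext j
  simp only [Finset.mem_filter, Finset.mem_univ, true_and, Pi.mul_apply]
  rcases Int.units_eq_one_or (ε j) with h | h <;>
    rcases Int.units_eq_one_or (σ j) with h' | h' <;> simp [h, h']

lemma sum_disagree {n : ℕ} (σ : Fin n → ℤˣ) (f : ℕ → ℝ) :
    ∑ τ : Fin n → ℤˣ, f (disagree σ τ) = ∑ k ∈ Finset.range (n + 1), n.choose k * f k := by
  classical
  rw [← Equiv.sum_comp (Equiv.mulLeft σ)]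
  simp only [Equiv.coe_mulLeft, disagree_eq_card_filter]
  have e := Finset.sum_powerset_apply_card (f := f) (x := (Finset.univ : Finset (Fin n)))
  simp only [Finset.card_univ, Fintype.card_fin, nsmul_eq_mul] at e
  rw [← e, Finset.powerset_univ]
  refine Finset.sum_bij' (fun ε _ => Finset.univ.filter fun j => ε j = -1)
    (fun s _ j => if j ∈ s then -1 else 1) (by simp) (by simp) ?_ ?_ (by simp)
  · intro ε _
    ext j
    rcases Int.units_eq_one_or (ε j) with h | h <;> simp [h]
  · intro s _
    ext j
    by_cases h : j ∈ s <;> simp [h]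

lemma integral_card_solutions_sq {K : ℝ} (hK : 0 < K) (m : ℕ) {n : ℕ} (hn : 1 ≤ n) :
    ∫ A, ((solutions K A).card : ℝ) ^ 2 ∂(gaussianEnsemble m n) =
      2 ^ n * ∑ k ∈ Finset.range (n + 1),
        n.choose k * overlapProb K (overlapAngle n k) ^ m := by
  simp_rw [card_solutions_sq_eq]
  have hms : ∀ σ τ : Fin n → ℤˣ,
      MeasurableSet {A : Fin m → Fin n → ℝ | ‖mulSign A σ‖ ≤ K ∧ ‖mulSign A τ‖ ≤ K} := fun σ τ =>
    (measurableSet_norm_mulSign_le K σ).inter (measurableSet_norm_mulSign_le K τ)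
  have hi : ∀ σ τ : Fin n → ℤˣ, Integrable (indicator
      {A : Fin m → Fin n → ℝ | ‖mulSign A σ‖ ≤ K ∧ ‖mulSign A τ‖ ≤ K} (1 : (Fin m → Fin n → ℝ) → ℝ))
      (gaussianEnsemble m n) := fun σ τ => (integrable_const (1 : ℝ)).indicator (hms σ τ)
  rw [integral_finsetSum _ fun σ _ => integrable_finsetSum _ fun τ _ => hi σ τ]
  have : ∀ σ : Fin n → ℤˣ, ∫ A, ∑ τ : Fin n → ℤˣ, indicator
      {A : Fin m → Fin n → ℝ | ‖mulSign A σ‖ ≤ K ∧ ‖mulSign A τ‖ ≤ K} (1 : (Fin m → Fin n → ℝ) → ℝ) A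
        ∂(gaussianEnsemble m n) = ∑ k ∈ Finset.range (n + 1),
        n.choose k * overlapProb K (overlapAngle n k) ^ m := by
    intro σ
    rw [integral_finsetSum _ fun τ _ => hi σ τ]
    simp_rw [integral_indicator_one (hms _ _), ensemble_pair_prob hK m hn]
    exact sum_disagree σ fun k => overlapProb K (overlapAngle n k) ^ m
  simp_rw [this]
  simp [Fintype.card_pi]

/-- The Paley–Zygmund inequality at level zero. -/
lemma sq_integral_div_le_measureReal_pos {Ω : Type*} [MeasurableSpace Ω] {μ : Measure Ω}
    [IsProbabilityMeasure μ] {X : Ω → ℝ} (hX : Integrable X μ) (hX2 : Integrable (fun ω => X ω ^ 2) μ)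
    {S : Set Ω} (hS : MeasurableSet S) (h0 : ∀ ω, ω ∉ S → X ω = 0) (hpos : 0 < ∫ ω, X ω ∂μ) :
    (∫ ω, X ω ∂μ) ^ 2 / ∫ ω, X ω ^ 2 ∂μ ≤ μ.real S := by
  set a := ∫ ω, X ω ∂μ with ha
  set b := ∫ ω, X ω ^ 2 ∂μ with hb
  have key : ∀ t : ℝ, 0 ≤ b - 2 * t * a + t ^ 2 * μ.real S := by
    intro t
    have hi : Integrable (indicator S (1 : Ω → ℝ)) μ := (integrable_const (1 : ℝ)).indicator hS
    have e : ∀ ω, (X ω - t * indicator S 1 ω) ^ 2 =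
        X ω ^ 2 - 2 * t * X ω + t ^ 2 * indicator S 1 ω := by
      intro ω
      by_cases h : ω ∈ S
      · simp [h]; ring
      · simp [h, h0 ω h]
    have h1 : 0 ≤ ∫ ω, (X ω - t * indicator S 1 ω) ^ 2 ∂μ := integral_nonneg fun ω => sq_nonneg _
    simp_rw [e] at h1
    rw [integral_add (f := fun ω => X ω ^ 2 - 2 * t * X ω) (hX2.sub (hX.const_mul _))
      (hi.const_mul _), integral_sub hX2 (hX.const_mul _), integral_const_mul, integral_const_mul,
      integral_indicator_one hS] at h1
    exact h1
  have hb0 : 0 < b := by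
    have h2 : 0 ≤ ∫ ω, (X ω - a) ^ 2 ∂μ := integral_nonneg fun ω => sq_nonneg _
    have e : ∀ ω, (X ω - a) ^ 2 = X ω ^ 2 - 2 * a * X ω + a ^ 2 := fun ω => by ring
    simp_rw [e] at h2
    rw [integral_add (f := fun ω => X ω ^ 2 - 2 * a * X ω) (hX2.sub (hX.const_mul _))
      (integrable_const _), integral_sub hX2 (hX.const_mul _), integral_const_mul, integral_const] at h2
    simp only [probReal_univ, one_smul] at h2
    nlinarith
  have := key (b / a)
  rw [div_le_iff₀ hb0]
  have e : b - 2 * (b / a) * a + (b / a) ^ 2 * μ.real S = b / a ^ 2 * (μ.real S * b - a ^ 2) := by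
    field_simp; ring
  rw [e] at this
  have h3 := nonneg_of_mul_nonneg_right this (by positivity)
  linarith

/-! ### The entropy defect -/

/-- The relative entropy `log 2 - h((1 + ρ) / 2)` of a coin of bias `ρ` with respect to a fair one,
where `h` is the binary entropy in nats. -/
noncomputable def entropyDefect (ρ : ℝ) : ℝ := ((1 + ρ) * log (1 + ρ) + (1 - ρ) * log (1 - ρ)) / 2

/-- The inverse hyperbolic tangent, the derivative of the entropy defect. -/
noncomputable def halfLogOdds (ρ : ℝ) : ℝ := (log (1 + ρ) - log (1 - ρ)) / 2

lemma hasDerivAt_entropyDefect {ρ : ℝ} (h0 : -1 < ρ) (h1 : ρ < 1) :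
    HasDerivAt entropyDefect (halfLogOdds ρ) ρ := by
  have a : HasDerivAt (fun x : ℝ => 1 + x) 1 ρ := by simpa using (hasDerivAt_id ρ).const_add 1
  have b : HasDerivAt (fun x : ℝ => 1 - x) (-1) ρ := by simpa using (hasDerivAt_id ρ).const_sub 1
  have h1' : 1 + ρ ≠ 0 := by linarith
  have h2' : 1 - ρ ≠ 0 := by linarith
  have := ((a.mul (a.log h1')).add (b.mul (b.log h2'))).div_const 2
  refine this.congr_deriv ?_
  unfold halfLogOdds
  field_simp
  ring

lemma hasDerivAt_halfLogOdds {ρ : ℝ} (h0 : -1 < ρ) (h1 : ρ < 1) :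
    HasDerivAt halfLogOdds (1 / (1 - ρ ^ 2)) ρ := by
  have a : HasDerivAt (fun x : ℝ => 1 + x) 1 ρ := by simpa using (hasDerivAt_id ρ).const_add 1
  have b : HasDerivAt (fun x : ℝ => 1 - x) (-1) ρ := by simpa using (hasDerivAt_id ρ).const_sub 1
  have h1' : 1 + ρ ≠ 0 := by linarith
  have h2' : 1 - ρ ≠ 0 := by linarith
  have := ((a.log h1').sub (b.log h2')).div_const 2
  refine this.congr_deriv ?_
  rw [show 1 - ρ ^ 2 = (1 + ρ) * (1 - ρ) by ring]
  field_simp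
  ring

lemma continuous_entropyDefect : Continuous entropyDefect := by
  unfold entropyDefect
  have := Real.continuous_mul_log
  exact ((this.comp (continuous_const.add continuous_id)).add
    (this.comp (continuous_const.sub continuous_id))).div_const 2

@[simp] lemma entropyDefect_zero : entropyDefect 0 = 0 := by simp [entropyDefect]

@[simp] lemma entropyDefect_one : entropyDefect 1 = log 2 := by
  simp [entropyDefect]; norm_num

@[simp] lemma halfLogOdds_zero : halfLogOdds 0 = 0 := by simp [halfLogOdds]

lemma entropyDefect_neg (ρ : ℝ) : entropyDefect (-ρ) = entropyDefect ρ := by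
  simp only [entropyDefect]; ring_nf

/-- A function on `[0, b]` that is nonnegative at `0` and has nonnegative derivative inside is
nonnegative. -/
lemma nonneg_of_hasDerivAt_nonneg {f f' : ℝ → ℝ} {b : ℝ} (hc : ContinuousOn f (Icc 0 b))
    (hd : ∀ x, 0 < x → x < b → HasDerivAt f (f' x) x) (hn : ∀ x, 0 < x → x < b → 0 ≤ f' x)
    (h0 : 0 ≤ f 0) {x : ℝ} (hx0 : 0 ≤ x) (hxb : x ≤ b) : 0 ≤ f x := by
  have : MonotoneOn f (Icc 0 b) := by
    refine monotoneOn_of_hasDerivWithinAt_nonneg (f' := f') (convex_Icc _ _) hc ?_ ?_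
    · intro y hy
      rw [interior_Icc] at hy
      exact (hd y hy.1 hy.2).hasDerivWithinAt
    · intro y hy
      rw [interior_Icc] at hy
      exact hn y hy.1 hy.2
  exact h0.trans (this ⟨le_rfl, hx0.trans hxb⟩ ⟨hx0, hxb⟩ hx0)

lemma le_halfLogOdds {ρ : ℝ} (h0 : 0 ≤ ρ) (h1 : ρ < 1) : ρ ≤ halfLogOdds ρ := by
  have := nonneg_of_hasDerivAt_nonneg (f := fun x => halfLogOdds x - x)
    (f' := fun x => 1 / (1 - x ^ 2) - 1) (b := ρ) ?_ ?_ ?_ ?_ h0 le_rfl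
  · simpa using this
  · intro x hx
    exact ((hasDerivAt_halfLogOdds (by linarith [hx.1]) (by linarith [hx.2])).continuousAt.sub
      continuousAt_id).continuousWithinAt
  · intro x hx hx'
    exact (hasDerivAt_halfLogOdds (by linarith) (by linarith)).sub (hasDerivAt_id x)
  · intro x hx hx'
    have : 0 < 1 - x ^ 2 := by nlinarith
    rw [sub_nonneg, le_div_iff₀ this]; nlinarith
  · simp

lemma halfLogOdds_nonneg {ρ : ℝ} (h0 : 0 ≤ ρ) (h1 : ρ < 1) : 0 ≤ halfLogOdds ρ :=
  h0.trans (le_halfLogOdds h0 h1)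

lemma entropyDefect_abs (ρ : ℝ) : entropyDefect |ρ| = entropyDefect ρ := by
  rcases abs_cases ρ with h | h <;> simp [h.1, entropyDefect_neg]

lemma half_sq_le_entropyDefect {ρ : ℝ} (h : |ρ| ≤ 1) : ρ ^ 2 / 2 ≤ entropyDefect ρ := by
  rw [← entropyDefect_abs, ← sq_abs]
  have := nonneg_of_hasDerivAt_nonneg (f := fun x => entropyDefect x - x ^ 2 / 2)
    (f' := fun x => halfLogOdds x - x) (b := 1) ?_ ?_ ?_ ?_ (abs_nonneg ρ) h
  · simpa using this
  · exact (continuous_entropyDefect.sub (by fun_prop)).continuousOn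
  · intro x hx hx'
    refine ((hasDerivAt_entropyDefect (by linarith) hx').sub
      ((hasDerivAt_pow 2 x).div_const 2)).congr_deriv ?_
    simp
  · intro x hx hx'
    linarith [le_halfLogOdds hx.le hx']
  · simp

lemma entropyDefect_nonneg {ρ : ℝ} (h : |ρ| ≤ 1) : 0 ≤ entropyDefect ρ :=
  le_trans (by positivity) (half_sq_le_entropyDefect h)

lemma entropyDefect_monotoneOn : MonotoneOn entropyDefect (Icc 0 1) := by
  refine monotoneOn_of_hasDerivWithinAt_nonneg (f' := halfLogOdds) (convex_Icc _ _)
    continuous_entropyDefect.continuousOn ?_ ?_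
  · intro y hy
    rw [interior_Icc] at hy
    exact (hasDerivAt_entropyDefect (by linarith [hy.1]) hy.2).hasDerivWithinAt
  · intro y hy
    rw [interior_Icc] at hy
    exact halfLogOdds_nonneg hy.1.le hy.2

lemma entropyDefect_le_log_two {ρ : ℝ} (h : |ρ| ≤ 1) : entropyDefect ρ ≤ log 2 := by
  rw [← entropyDefect_abs, ← entropyDefect_one]
  exact entropyDefect_monotoneOn ⟨abs_nonneg ρ, h⟩ ⟨zero_le_one, le_rfl⟩ h

lemma halfLogOdds_le_add_cube {ρ : ℝ} (h0 : 0 ≤ ρ) (h1 : ρ ≤ 1 / 2) :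
    halfLogOdds ρ ≤ ρ + 2 * ρ ^ 3 := by
  have := nonneg_of_hasDerivAt_nonneg (f := fun x => x + 2 * x ^ 3 - halfLogOdds x)
    (f' := fun x => 1 + 2 * (3 * x ^ 2) - 1 / (1 - x ^ 2)) (b := 1 / 2) ?_ ?_ ?_ ?_ h0 h1
  · simpa using this
  · intro x hx
    have := (hasDerivAt_halfLogOdds (ρ := x) (by linarith [hx.1]) (by linarith [hx.2])).continuousAt
    exact ((by fun_prop : ContinuousAt (fun x : ℝ => x + 2 * x ^ 3) x).sub this).continuousWithinAt
  · intro x hx hx'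
    refine (((hasDerivAt_id x).add ((hasDerivAt_pow 3 x).const_mul 2)).sub
      (hasDerivAt_halfLogOdds (by linarith) (by linarith))).congr_deriv ?_
    simp
  · intro x hx hx'
    have : 0 < 1 - x ^ 2 := by nlinarith
    rw [sub_nonneg, div_le_iff₀ this]
    nlinarith [mul_pos (pow_pos hx 2) (show 0 < 5 - 6 * x ^ 2 by nlinarith)]
  · simp

lemma entropyDefect_le_of_abs_le_half {ρ : ℝ} (h : |ρ| ≤ 1 / 2) :
    entropyDefect ρ ≤ ρ ^ 2 / 2 * (1 + ρ ^ 2) := by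
  rw [← entropyDefect_abs, ← sq_abs]
  have := nonneg_of_hasDerivAt_nonneg
    (f := fun x => (x ^ 2 / 2 + x ^ 4 / 2) - entropyDefect x)
    (f' := fun x => x + 2 * x ^ 3 - halfLogOdds x) (b := 1 / 2) ?_ ?_ ?_ ?_ (abs_nonneg ρ) h
  · linarith
  · exact ((by fun_prop : Continuous fun x : ℝ => x ^ 2 / 2 + x ^ 4 / 2).sub
      continuous_entropyDefect).continuousOn
  · intro x hx hx'
    refine ((((hasDerivAt_pow 2 x).div_const 2).add ((hasDerivAt_pow 4 x).div_const 2)).sub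
      (hasDerivAt_entropyDefect (by linarith) (by linarith))).congr_deriv ?_
    norm_num
    ring
  · intro x hx hx'
    linarith [halfLogOdds_le_add_cube hx.le hx'.le]
  · simp

/-- The entropy bound for binomial coefficients, `n.choose k ≤ 2 ^ n * exp (-n * ι)` with the
entropy defect `ι` of the proportion `k / n`. -/
lemma choose_mul_exp_entropyDefect_le {n k : ℕ} (hn : 1 ≤ n) (hk : k ≤ n) :
    (n.choose k : ℝ) * exp (n * entropyDefect (1 - 2 * (k / n))) ≤ 2 ^ n := by
  have hn0 : (0 : ℝ) < n := by exact_mod_cast hn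
  have hkn : (k : ℝ) ≤ n := by exact_mod_cast hk
  set ρ : ℝ := 1 - 2 * (k / n) with hρ
  have hkn' : (k : ℝ) / n ≤ 1 := (div_le_one hn0).2 hkn
  have h0' : 0 ≤ (k : ℝ) / n := by positivity
  have hpow : ∀ (j : ℕ) (x : ℝ), 0 ≤ x → n * x = 2 * j → x ^ j = exp (n * (x * log x) / 2) := by
    intro j x hx hj
    rcases hx.eq_or_lt with h | h
    · rw [← h] at hj ⊢
      have : j = 0 := by
        have : (j : ℝ) = 0 := by linarith
        exact_mod_cast this
      simp [this]
    · rw [← mul_assoc, hj, show 2 * (j : ℝ) * log x / 2 = j * log x by ring, exp_nat_mul,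
        exp_log h]
  have e : exp (n * entropyDefect ρ) = (1 - ρ) ^ k * (1 + ρ) ^ (n - k) := by
    rw [hpow k (1 - ρ) (by rw [hρ]; linarith) (by rw [hρ]; field_simp; ring),
      hpow (n - k) (1 + ρ) (by rw [hρ]; linarith)
        (by rw [hρ, Nat.cast_sub hk]; field_simp; ring), ← exp_add]
    congr 1
    unfold entropyDefect
    ring
  rw [e]
  have hb := add_pow (1 - ρ) (1 + ρ) n
  rw [show 1 - ρ + (1 + ρ) = 2 by ring] at hb
  rw [hb]
  have := Finset.single_le_sum (f := fun j => (1 - ρ) ^ j * (1 + ρ) ^ (n - j) * (n.choose j : ℝ))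
    (s := Finset.range (n + 1)) (fun j _ => ?_) (Finset.mem_range.2 (Nat.lt_succ_of_le hk))
  · simpa [mul_comm] using this
  · have h1 : 0 ≤ 1 - ρ := by rw [hρ]; linarith
    have h2 : 0 ≤ 1 + ρ := by rw [hρ]; linarith
    positivity

/-! ### Binomial sums -/

/-- Linearizing the square in the exponent by a Gaussian integral turns the binomial sum into the
integral of a power of `cosh`. -/
lemma exists_sum_choose_mul_exp_sq_le {l : ℝ} (h0 : 0 ≤ l) (h1 : l < 1 / 2) :
    ∃ C : ℝ, 0 ≤ C ∧ ∀ n : ℕ, 1 ≤ n → ∑ k ∈ Finset.range (n + 1),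
      (n.choose k : ℝ) * exp (n * (l * (1 - 2 * (k / n : ℝ)) ^ 2)) ≤ C * 2 ^ n := by
  refine ⟨∫ x, exp (l * x ^ 2) ∂gaussianReal 0 1, integral_nonneg fun x => (exp_pos _).le, ?_⟩
  have hint : Integrable (fun x => exp (l * x ^ 2)) (gaussianReal 0 1) := by
    have hb : Integrable (fun x : ℝ => exp (-(1 / 2 - l) * x ^ 2)) :=
      integrable_exp_neg_mul_sq (by linarith)
    have h2 := hb.const_mul (√(2 * π))⁻¹
    rw [gaussianReal_of_var_ne_zero _ one_ne_zero, gaussianPDF_def,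
      integrable_withDensity_iff_integrable_smul₀' (by fun_prop)
        (Filter.Eventually.of_forall fun x => ENNReal.ofReal_lt_top)]
    refine h2.congr (Filter.Eventually.of_forall fun x => ?_)
    simp only [smul_eq_mul]
    rw [ENNReal.toReal_ofReal (gaussianPDFReal_nonneg _ _ _)]
    simp only [gaussianPDFReal, NNReal.coe_one, mul_one, sub_zero]
    rw [mul_assoc, ← exp_add]
    congr 2
    ring
  intro n hn
  have hn0 : (0 : ℝ) < n := by exact_mod_cast hn
  set b : ℝ := √(2 * l / n) with hb
  have hb2 : b ^ 2 = 2 * l / n := Real.sq_sqrt (by positivity)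
  have hmgf : ∀ t : ℝ, Integrable (fun x => exp (t * x)) (gaussianReal 0 1) ∧
      ∫ x, exp (t * x) ∂gaussianReal 0 1 = exp (t ^ 2 / 2) := by
    intro t
    refine ⟨integrable_exp_mul_gaussianReal t, ?_⟩
    have := congrFun (mgf_fun_id_gaussianReal (μ := 0) (v := 1)) t
    simpa [mgf] using this
  have e : ∀ k ∈ Finset.range (n + 1),
      (n.choose k : ℝ) * exp (n * (l * (1 - 2 * (k / n : ℝ)) ^ 2)) =
      ∫ x, (n.choose k : ℝ) * exp ((b * (n - 2 * k)) * x) ∂gaussianReal 0 1 := by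
    intro k _
    rw [integral_const_mul, (hmgf _).2]
    congr 2
    rw [mul_pow, hb2]
    field_simp
  rw [Finset.sum_congr rfl e, ← integral_finsetSum _ fun k _ => ((hmgf _).1.const_mul _),
    mul_comm, ← integral_const_mul]
  refine integral_mono (integrable_finsetSum _ fun k _ => ((hmgf _).1.const_mul _))
    (hint.const_mul _) fun x => ?_
  have hs : ∑ k ∈ Finset.range (n + 1), (n.choose k : ℝ) * exp ((b * (n - 2 * k)) * x) =
      (2 * cosh (b * x)) ^ n := by
    rw [cosh_eq, mul_div_cancel₀ _ two_ne_zero, add_comm (exp _), add_pow]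
    refine Finset.sum_congr rfl fun k hk => ?_
    have hk' : k ≤ n := Nat.lt_succ_iff.1 (Finset.mem_range.1 hk)
    rw [← exp_nat_mul, ← exp_nat_mul, ← exp_add, mul_comm, Nat.cast_sub hk']
    congr 2
    ring
  dsimp only
  rw [hs, mul_pow]
  gcongr
  calc cosh (b * x) ^ n ≤ exp ((b * x) ^ 2 / 2) ^ n := by
        gcongr
        exact cosh_le_exp_half_sq _
    _ = exp (l * x ^ 2) := by
        rw [← exp_nat_mul, mul_pow, hb2]
        congr 1
        field_simp

lemma exists_sum_exp_neg_sqrt_le {ν : ℝ} (hν : 0 < ν) :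
    ∃ C : ℝ, 0 ≤ C ∧ ∀ n : ℕ, ∑ k ∈ Finset.range n, exp (-(ν * √k)) ≤ C := by
  have hs : Summable fun k : ℕ => exp (-(ν * √k)) := by
    rw [← summable_nat_add_iff 1]
    have h2 : Summable fun k : ℕ => 24 / ν ^ 4 * (1 / ((k + 1 : ℕ) : ℝ) ^ 2) :=
      (((summable_nat_add_iff 1).2 (Real.summable_one_div_nat_pow.2 one_lt_two))).mul_left _
    refine h2.of_nonneg_of_le (fun k => (exp_pos _).le) fun k => ?_
    have hk : (0 : ℝ) < ((k + 1 : ℕ) : ℝ) := by positivity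
    have h3 := Real.pow_div_factorial_le_exp (ν * √((k + 1 : ℕ) : ℝ)) (by positivity) 4
    rw [mul_pow, show √((k + 1 : ℕ) : ℝ) ^ 4 = ((k + 1 : ℕ) : ℝ) ^ 2 by
      rw [show (4 : ℕ) = 2 * 2 by norm_num, pow_mul, Real.sq_sqrt hk.le]] at h3
    rw [exp_neg]
    calc _ ≤ (ν ^ 4 * ((k + 1 : ℕ) : ℝ) ^ 2 / (Nat.factorial 4 : ℕ))⁻¹ := by
          apply inv_anti₀ (by positivity) h3
      _ = _ := by
          rw [show Nat.factorial 4 = 24 from rfl]; push_cast; field_simp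
  exact ⟨∑' k : ℕ, exp (-(ν * √k)), tsum_nonneg fun k => (exp_pos _).le,
    fun n => hs.sum_le_tsum _ fun k _ => (exp_pos _).le⟩

/-- The binomial average of `exp (n (1 - η) ι)` is bounded: near the centre the entropy defect `ι`
is close to `ρ ^ 2 / 2`, and away from it the entropy bound leaves `exp (-n η ι)`. -/
lemma exists_sum_choose_mul_exp_entropyDefect_le {η : ℝ} (h0 : 0 < η) (h1 : η ≤ 1 / 2) :
    ∃ C : ℝ, 0 ≤ C ∧ ∀ n : ℕ, 1 ≤ n → ∑ k ∈ Finset.range (n + 1),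
      (n.choose k : ℝ) * exp (n * ((1 - η) * entropyDefect (1 - 2 * (k / n : ℝ)))) ≤
        C * 2 ^ n := by
  obtain ⟨C₁, hC₁, h⟩ := exists_sum_choose_mul_exp_sq_le (l := (1 - η / 2) / 2) (by linarith)
    (by linarith)
  set b : ℝ := η * (η / 4) with hb
  have hb0 : 0 < b := by positivity
  refine ⟨C₁ + (1 / b + 1), by positivity, fun n hn => ?_⟩
  have hn0 : (0 : ℝ) < n := by exact_mod_cast hn
  have key : ∀ k ∈ Finset.range (n + 1),
      (n.choose k : ℝ) * exp (n * ((1 - η) * entropyDefect (1 - 2 * (k / n : ℝ)))) ≤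
      (n.choose k : ℝ) * exp (n * ((1 - η / 2) / 2 * (1 - 2 * (k / n : ℝ)) ^ 2)) +
        exp (-(n * b)) * 2 ^ n := by
    intro k hk
    have hk' : k ≤ n := Nat.lt_succ_iff.1 (Finset.mem_range.1 hk)
    have hkn : (k : ℝ) / n ≤ 1 := (div_le_one hn0).2 (by exact_mod_cast hk')
    have h0' : 0 ≤ (k : ℝ) / n := by positivity
    have hc := choose_mul_exp_entropyDefect_le hn hk'
    set ρ : ℝ := 1 - 2 * (k / n : ℝ) with hρ
    have hρ1 : |ρ| ≤ 1 := abs_le.2 ⟨by linarith, by linarith⟩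
    by_cases hs : ρ ^ 2 ≤ η / 2
    · have h2 : |ρ| ≤ 1 / 2 := abs_le_of_sq_le_sq (by nlinarith) (by norm_num)
      have h3 := entropyDefect_le_of_abs_le_half h2
      have h4 : (1 - η) * entropyDefect ρ ≤ (1 - η / 2) / 2 * ρ ^ 2 := by
        calc _ ≤ (1 - η) * (ρ ^ 2 / 2 * (1 + η / 2)) := by
              have : 0 ≤ 1 - η := by linarith
              gcongr
              exact h3.trans (by gcongr)
          _ ≤ _ := by nlinarith [sq_nonneg ρ, mul_nonneg (sq_nonneg ρ) (sq_nonneg η)]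
      have : (0 : ℝ) ≤ exp (-(n * b)) * 2 ^ n := by positivity
      have : (n.choose k : ℝ) * exp (n * ((1 - η) * entropyDefect ρ)) ≤
          (n.choose k : ℝ) * exp (n * ((1 - η / 2) / 2 * ρ ^ 2)) := by gcongr
      linarith
    · push Not at hs
      have h2 := half_sq_le_entropyDefect hρ1
      have h3 : exp (n * ((1 - η) * entropyDefect ρ)) ≤
          exp (n * entropyDefect ρ) * exp (-(n * b)) := by
        rw [← exp_add]
        apply exp_le_exp.2
        have : b ≤ η * entropyDefect ρ := by rw [hb]; gcongr; linarith
        nlinarith [mul_le_mul_of_nonneg_left this hn0.le]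
      have : (0 : ℝ) ≤ (n.choose k : ℝ) * exp (n * ((1 - η / 2) / 2 * ρ ^ 2)) := by positivity
      calc _ ≤ (n.choose k : ℝ) * (exp (n * entropyDefect ρ) * exp (-(n * b))) := by gcongr
        _ = exp (-(n * b)) * ((n.choose k : ℝ) * exp (n * entropyDefect ρ)) := by ring
        _ ≤ exp (-(n * b)) * 2 ^ n := by gcongr
        _ ≤ _ := by linarith
  refine (Finset.sum_le_sum key).trans ?_
  rw [Finset.sum_add_distrib]
  have h5 : ∑ k ∈ Finset.range (n + 1), exp (-(n * b)) * (2 : ℝ) ^ n ≤ (1 / b + 1) * 2 ^ n := by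
    simp only [Finset.sum_const, Finset.card_range, nsmul_eq_mul, ← mul_assoc]
    gcongr
    push_cast
    have h6 := add_one_le_exp (n * b)
    have h7 : exp (n * b) * exp (-(n * b)) = 1 := by rw [← exp_add]; simp
    have h8 : exp (-(n * b)) ≤ 1 := exp_le_one_iff.2 (by have := mul_pos hn0 hb0; linarith)
    have h9 : n * b * exp (-(n * b)) ≤ 1 := by
      nlinarith [exp_pos (-(n * b))]
    have : n * exp (-(n * b)) ≤ 1 / b := by rw [le_div_iff₀ hb0]; linarith
    linarith
  linarith [h n hn]

/-! ### From a bound on the overlap probability to the theorem -/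

/-- The reciprocal of the critical density. -/
noncomputable def invDensity (K : ℝ) : ℝ := -log (pK K) / log 2

/-- A quantitative form of the assertion that, at the critical density, the exponential rate of the
pairs of solutions at overlap `cos (2 * α)` is largest for orthogonal pairs: the rate has a
quadratic gap `η` towards orthogonality, and a gap of order `sin α` towards coincidence. -/
def OverlapGap (η ν K : ℝ) : Prop :=
  ∃ α₀, 0 < α₀ ∧ α₀ < π / 4 ∧
    (∀ α, α₀ ≤ α → α ≤ π / 4 → log (overlapProb K α) - 2 * log (pK K) ≤
      (1 - η) * invDensity K * entropyDefect (cos (2 * α))) ∧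
    (∀ α, 0 ≤ α → α ≤ α₀ → ν * invDensity K * sin α / √(1 + invDensity K) ≤
      log (pK K) - log (overlapProb K α) -
        invDensity K * (log 2 - entropyDefect (cos (2 * α))))

lemma log_pK_neg {K : ℝ} (hK : 0 < K) : log (pK K) < 0 := log_neg (pK_pos hK) (pK_lt_one K)

lemma invDensity_pos {K : ℝ} (hK : 0 < K) : 0 < invDensity K :=
  div_pos (by linarith [log_pK_neg hK]) (log_pos one_lt_two)

lemma invDensity_mul_log_two (K : ℝ) : invDensity K * log 2 = -log (pK K) :=
  div_mul_cancel₀ _ (log_pos one_lt_two).ne'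

lemma criticalDensity_eq_inv (K : ℝ) : criticalDensity K = (invDensity K)⁻¹ := by
  rw [criticalDensity, invDensity, inv_div, div_neg, neg_div]

lemma sq_le_overlapProb {K : ℝ} (hK : 0 < K) {α : ℝ} (h0 : 0 ≤ α) (h1 : α ≤ π / 4) :
    pK K ^ 2 ≤ overlapProb K α := by
  rw [← overlapProb_pi_div_four hK]
  exact antitoneOn_overlapProb K ⟨h0, h1⟩ ⟨by positivity, le_rfl⟩ h1

lemma overlapProb_pos {K : ℝ} (hK : 0 < K) {α : ℝ} (h0 : 0 ≤ α) (h1 : α ≤ π / 4) :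
    0 < overlapProb K α :=
  (pow_pos (pK_pos hK) 2).trans_le (sq_le_overlapProb hK h0 h1)

lemma sin_overlapAngle {n k : ℕ} (hn : 1 ≤ n) (hk : k ≤ n) :
    sin (overlapAngle n k) = √(k / n : ℝ) := by
  have hn0 : (0 : ℝ) < n := by exact_mod_cast hn
  refine sin_arcsin ?_ ?_
  · linarith [Real.sqrt_nonneg (k / n : ℝ)]
  · refine Real.sqrt_le_one.2 ((div_le_one hn0).2 ?_); exact_mod_cast hk

lemma cos_two_mul_overlapAngle {n k : ℕ} (hn : 1 ≤ n) (hk : k ≤ n) :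
    cos (2 * overlapAngle n k) = 1 - 2 * (k / n : ℝ) := by
  rw [cos_two_mul, cos_sq', sin_overlapAngle hn hk, Real.sq_sqrt (by positivity)]
  ring

lemma overlapAngle_nonneg (n k : ℕ) : 0 ≤ overlapAngle n k :=
  arcsin_nonneg.2 (Real.sqrt_nonneg _)

lemma overlapAngle_le_pi_div_four {n k : ℕ} (hn : 1 ≤ n) (hk : 2 * k ≤ n) :
    overlapAngle n k ≤ π / 4 := by
  have hn0 : (0 : ℝ) < n := by exact_mod_cast hn
  have hk' : 2 * (k : ℝ) ≤ n := by exact_mod_cast hk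
  rw [overlapAngle, arcsin_le_iff_le_sin' ⟨by linarith [pi_pos], by linarith [pi_pos]⟩,
    sin_pi_div_four, Real.sqrt_le_left (by positivity), div_pow, Real.sq_sqrt zero_le_two,
    div_le_iff₀ hn0]
  linarith

lemma overlapAngle_sub {n k : ℕ} (hn : 1 ≤ n) (hk : k ≤ n) :
    overlapAngle n (n - k) = π / 2 - overlapAngle n k := by
  have hn0 : (0 : ℝ) < n := by exact_mod_cast hn
  have hkn : (k : ℝ) / n ≤ 1 := (div_le_one hn0).2 (by exact_mod_cast hk)
  rw [overlapAngle, overlapAngle, ← arccos_eq_pi_div_two_sub_arcsin, Nat.cast_sub hk, sub_div,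
    div_self hn0.ne', arccos_eq_arcsin (Real.sqrt_nonneg _), Real.sq_sqrt (by positivity)]

/-- The contribution of the pairs that differ in `k ≤ n / 2` coordinates. -/
lemma choose_mul_overlapProb_pow_le {η ν K : ℝ} (hν : 0 < ν) (hK : 0 < K)
    (h : OverlapGap η ν K) {n m k : ℕ} (hn : 1 ≤ n) (hk : 2 * k ≤ n)
    (hm : m * invDensity K ≤ n) (hbn : invDensity K ≤ n) :
    (n.choose k : ℝ) * overlapProb K (overlapAngle n k) ^ m ≤ pK K ^ (2 * m) *
      ((n.choose k : ℝ) * exp (n * ((1 - η) * entropyDefect (1 - 2 * (k / n : ℝ)))) +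
        2 ^ n * exp (-(ν / √2 * √k))) := by
  obtain ⟨α₀, h0, h1, hbody, htail⟩ := h
  have hn0 : (0 : ℝ) < n := by exact_mod_cast hn
  have hkn : k ≤ n := by omega
  have ha := invDensity_pos hK
  have hp := pK_pos hK
  set a := invDensity K with had
  set α := overlapAngle n k with hα
  have hα0 : 0 ≤ α := overlapAngle_nonneg n k
  have hα1 : α ≤ π / 4 := overlapAngle_le_pi_div_four hn hk
  have hcos : cos (2 * α) = 1 - 2 * (k / n : ℝ) := cos_two_mul_overlapAngle hn hkn
  have hsin : sin α = √(k / n : ℝ) := sin_overlapAngle hn hkn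
  set ρ : ℝ := 1 - 2 * (k / n : ℝ) with hρ
  have hq := overlapProb_pos hK hα0 hα1
  set q := overlapProb K α with hqd
  set l := log q - 2 * log (pK K) with hl
  have hl0 : 0 ≤ l := by
    have := log_le_log (by positivity) (sq_le_overlapProb hK hα0 hα1)
    rw [log_pow] at this
    push_cast at this
    linarith
  -- the number of rows is replaced by its largest possible value `n / a`
  have hqm : q ^ m ≤ pK K ^ (2 * m) * exp (n / a * l) := by
    have e : q ^ m = pK K ^ (2 * m) * exp (m * l) := by
      have e2 : (m : ℝ) * (2 * log (pK K)) = ((2 * m : ℕ) : ℝ) * log (pK K) := by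
        push_cast; ring
      rw [hl, mul_sub, exp_sub, exp_nat_mul, exp_log hq, e2, exp_nat_mul, exp_log hp]
      field_simp
    rw [e]
    have : (m : ℝ) ≤ n / a := by rw [le_div_iff₀ ha]; exact hm
    gcongr
  have hp2 : 0 ≤ pK K ^ (2 * m) := by positivity
  rcases le_total α₀ α with hc | hc
  · have hb := hbody α hc hα1
    rw [hcos] at hb
    have h2 : n / a * l ≤ n * ((1 - η) * entropyDefect ρ) := by
      calc n / a * l ≤ n / a * ((1 - η) * a * entropyDefect ρ) := by gcongr
        _ = _ := by field_simp
    calc (n.choose k : ℝ) * q ^ m ≤ (n.choose k : ℝ) * (pK K ^ (2 * m) *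
          exp (n * ((1 - η) * entropyDefect ρ))) := by
          gcongr
          exact hqm.trans (by gcongr)
      _ = pK K ^ (2 * m) * ((n.choose k : ℝ) * exp (n * ((1 - η) * entropyDefect ρ))) := by ring
      _ ≤ _ := by
          gcongr
          have : (0 : ℝ) ≤ 2 ^ n * exp (-(ν / √2 * √k)) := by positivity
          linarith
  · have hb := htail α hα0 hc
    rw [hcos, hsin] at hb
    have hl2 := invDensity_mul_log_two K
    have h2 : l ≤ a * entropyDefect ρ - ν * a * √(k / n : ℝ) / √(1 + a) := by
      rw [hl]; linarith
    have h3 : ν / √2 * √k ≤ n / a * (ν * a * √(k / n : ℝ) / √(1 + a)) := by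
      have e1 : n / a * (ν * a * √(k / n : ℝ) / √(1 + a)) = ν * √k * √(n / (1 + a)) := by
        have e2 : √(k / n : ℝ) = √k / √n := Real.sqrt_div (by positivity) _
        have e3 : √(n / (1 + a)) = √n / √(1 + a) := Real.sqrt_div hn0.le _
        have e4 : √(n : ℝ) * √n = n := Real.mul_self_sqrt hn0.le
        have : 0 < √(n : ℝ) := Real.sqrt_pos.2 hn0
        rw [e2, e3]
        field_simp
        rw [sq, e4, mul_comm]
      have e5 : 1 / √2 ≤ √(n / (1 + a)) := by
        have : 1 / √2 = √(1 / 2 : ℝ) := by simp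
        rw [this]
        apply Real.sqrt_le_sqrt
        rw [div_le_div_iff₀ two_pos (by linarith)]
        have : (1 : ℝ) ≤ n := by exact_mod_cast hn
        linarith
      rw [e1]
      calc ν / √2 * √k = ν * √k * (1 / √2) := by ring
        _ ≤ _ := by gcongr
    have h4 : n / a * l ≤ n * entropyDefect ρ - ν / √2 * √k := by
      calc n / a * l ≤ n / a * (a * entropyDefect ρ - ν * a * √(k / n : ℝ) / √(1 + a)) := by gcongr
        _ = n * entropyDefect ρ - n / a * (ν * a * √(k / n : ℝ) / √(1 + a)) := by
            rw [mul_sub]; congr 1; field_simp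
        _ ≤ _ := by linarith
    have h5 := choose_mul_exp_entropyDefect_le hn hkn
    calc (n.choose k : ℝ) * q ^ m ≤ (n.choose k : ℝ) * (pK K ^ (2 * m) *
          exp (n * entropyDefect ρ - ν / √2 * √k)) := by
          gcongr
          exact hqm.trans (by gcongr)
      _ = pK K ^ (2 * m) * (((n.choose k : ℝ) * exp (n * entropyDefect ρ)) *
            exp (-(ν / √2 * √k))) := by rw [sub_eq_add_neg, exp_add]; ring
      _ ≤ pK K ^ (2 * m) * (2 ^ n * exp (-(ν / √2 * √k))) := by gcongr
      _ ≤ _ := by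
          gcongr
          have : (0 : ℝ) ≤ (n.choose k : ℝ) * exp (n * ((1 - η) * entropyDefect ρ)) := by positivity
          linarith

/-- Under the overlap gap, the normalized second moment is bounded by a constant that depends only
on the size of the gap. -/
theorem exists_second_moment_sum_le {η ν : ℝ} (hη0 : 0 < η) (hη : η ≤ 1 / 2) (hν : 0 < ν) :
    ∃ C : ℝ, 1 ≤ C ∧ ∀ K : ℝ, 0 < K → OverlapGap η ν K → ∀ n m : ℕ, 1 ≤ n →
      m * invDensity K ≤ n → ∑ k ∈ Finset.range (n + 1),
        n.choose k * overlapProb K (overlapAngle n k) ^ m ≤ C * (2 ^ n * pK K ^ (2 * m)) := by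
  obtain ⟨C₁, hC₁, h₁⟩ := exists_sum_choose_mul_exp_entropyDefect_le hη0 hη
  obtain ⟨C₂, hC₂, h₂⟩ := exists_sum_exp_neg_sqrt_le (ν := ν / √2) (by positivity)
  refine ⟨1 + C₁ + 2 * C₂, by linarith, fun K hK h n m hn hm => ?_⟩
  have ha := invDensity_pos hK
  have hp := pK_pos hK
  by_cases hbn : invDensity K ≤ n
  · have key : ∀ k ∈ Finset.range (n + 1),
        (n.choose k : ℝ) * overlapProb K (overlapAngle n k) ^ m ≤ pK K ^ (2 * m) *
        ((n.choose k : ℝ) * exp (n * ((1 - η) * entropyDefect (1 - 2 * (k / n : ℝ)))) +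
          (2 ^ n * exp (-(ν / √2 * √k)) + 2 ^ n * exp (-(ν / √2 * √((n - k : ℕ) : ℝ))))) := by
      intro k hk
      have hkn : k ≤ n := Nat.lt_succ_iff.1 (Finset.mem_range.1 hk)
      rcases le_total (2 * k) n with h' | h'
      · refine (choose_mul_overlapProb_pow_le hν hK h hn h' hm hbn).trans ?_
        gcongr
        have : (0 : ℝ) ≤ 2 ^ n * exp (-(ν / √2 * √((n - k : ℕ) : ℝ))) := by positivity
        linarith
      · have := choose_mul_overlapProb_pow_le hν hK h hn
          (k := n - k) (by omega) hm hbn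
        rw [Nat.choose_symm hkn, overlapAngle_sub hn hkn, overlapProb_pi_div_two_sub] at this
        refine this.trans ?_
        have hn0 : (0 : ℝ) < n := by exact_mod_cast hn
        have e : (1 - 2 * (((n - k : ℕ) : ℝ) / n)) = -(1 - 2 * (k / n : ℝ)) := by
          rw [Nat.cast_sub hkn]; field_simp; ring
        rw [e, entropyDefect_neg]
        gcongr
        have : (0 : ℝ) ≤ 2 ^ n * exp (-(ν / √2 * √k)) := by positivity
        linarith
    refine (Finset.sum_le_sum key).trans ?_
    rw [← Finset.mul_sum, Finset.sum_add_distrib, Finset.sum_add_distrib, ← Finset.mul_sum,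
      ← Finset.mul_sum]
    have hr := Finset.sum_range_reflect (fun k : ℕ => exp (-(ν / √2 * √(k : ℝ)))) (n + 1)
    simp only [Nat.add_sub_cancel] at hr
    rw [hr]
    have h3 := h₁ n hn
    have h4 := h₂ (n + 1)
    calc _ ≤ pK K ^ (2 * m) * (C₁ * 2 ^ n + (2 ^ n * C₂ + 2 ^ n * C₂)) := by gcongr
      _ ≤ (1 + C₁ + 2 * C₂) * (2 ^ n * pK K ^ (2 * m)) := by
        have : (0 : ℝ) ≤ 2 ^ n * pK K ^ (2 * m) := by positivity
        nlinarith
  · -- fewer than one row is allowed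
    push Not at hbn
    have hm0 : m = 0 := by
      by_contra h0
      have : (1 : ℝ) ≤ m := by exact_mod_cast Nat.one_le_iff_ne_zero.2 h0
      nlinarith
    subst hm0
    have : ∑ k ∈ Finset.range (n + 1), (n.choose k : ℝ) = 2 ^ n := by
      exact_mod_cast Nat.sum_range_choose n
    simp only [pow_zero, mul_one, this, mul_zero]
    nlinarith [pow_pos (two_pos (α := ℝ)) n]

lemma second_moment_ratio_le {K C : ℝ} (hK : 0 < K) {n m : ℕ} (hn : 1 ≤ n)
    (h : ∑ k ∈ Finset.range (n + 1), n.choose k * overlapProb K (overlapAngle n k) ^ m ≤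
      C * (2 ^ n * pK K ^ (2 * m))) :
    (∫ A, ((solutions K A).card : ℝ) ^ 2 ∂(gaussianEnsemble m n)) /
      (∫ A, ((solutions K A).card : ℝ) ∂(gaussianEnsemble m n)) ^ 2 ≤ C := by
  have hp := pK_pos hK
  rw [integral_card_solutions_sq hK m hn, integral_card_solutions hK m hn,
    div_le_iff₀ (by positivity)]
  calc _ ≤ 2 ^ n * (C * (2 ^ n * pK K ^ (2 * m))) := by gcongr
    _ = _ := by rw [mul_pow, ← pow_mul, ← pow_mul]; ring

lemma solutions_nonempty_iff {m n : ℕ} (K : ℝ) (A : Fin m → Fin n → ℝ) :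
    (solutions K A).Nonempty ↔ disc A ≤ K := by
  constructor
  · rintro ⟨σ, hσ⟩
    have h2 : ‖mulSign A σ‖ ≤ K := by simpa [solutions] using hσ
    exact (ciInf_le (Finite.bddBelow_range _) σ).trans h2
  · intro h
    obtain ⟨σ, hσ⟩ := exists_eq_ciInf_of_finite (f := fun σ : Fin n → ℤˣ => ‖mulSign A σ‖)
    refine ⟨σ, ?_⟩
    have : ‖mulSign A σ‖ ≤ K := by rw [hσ]; exact h
    simpa [solutions] using this

lemma inv_le_measureReal_disc_le {K C : ℝ} (hK : 0 < K) (hC : 0 < C) {n m : ℕ} (hn : 1 ≤ n)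
    (h : ∑ k ∈ Finset.range (n + 1), n.choose k * overlapProb K (overlapAngle n k) ^ m ≤
      C * (2 ^ n * pK K ^ (2 * m))) :
    C⁻¹ ≤ (gaussianEnsemble m n).real {A | disc A ≤ K} := by
  have hp := pK_pos hK
  have hr := second_moment_ratio_le hK hn h
  have hset : {A : Fin m → Fin n → ℝ | disc A ≤ K} = ⋃ σ, {A | ‖mulSign A σ‖ ≤ K} := by
    ext A
    rw [mem_ofPred_eq, ← solutions_nonempty_iff]
    simp [solutions, Finset.Nonempty]
  have hS : MeasurableSet {A : Fin m → Fin n → ℝ | disc A ≤ K} := by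
    rw [hset]
    exact MeasurableSet.iUnion fun σ => measurableSet_norm_mulSign_le K σ
  have hi1 : ∀ σ : Fin n → ℤˣ, Integrable (indicator
      {A : Fin m → Fin n → ℝ | ‖mulSign A σ‖ ≤ K} (1 : (Fin m → Fin n → ℝ) → ℝ))
      (gaussianEnsemble m n) := fun σ =>
    (integrable_const (1 : ℝ)).indicator (measurableSet_norm_mulSign_le K σ)
  have hX : Integrable (fun A => ((solutions K A).card : ℝ)) (gaussianEnsemble m n) := by
    simp_rw [card_solutions_eq]
    exact integrable_finsetSum _ fun σ _ => hi1 σ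
  have hX2 : Integrable (fun A => ((solutions K A).card : ℝ) ^ 2) (gaussianEnsemble m n) := by
    simp_rw [card_solutions_sq_eq]
    refine integrable_finsetSum _ fun σ _ => integrable_finsetSum _ fun τ _ => ?_
    exact (integrable_const (1 : ℝ)).indicator
      ((measurableSet_norm_mulSign_le K σ).inter (measurableSet_norm_mulSign_le K τ))
  have hpos : 0 < ∫ A, ((solutions K A).card : ℝ) ∂(gaussianEnsemble m n) := by
    rw [integral_card_solutions hK m hn]; positivity
  have := sq_integral_div_le_measureReal_pos hX hX2 hS (fun A hA => by
    have : ¬ (solutions K A).Nonempty := fun h => hA ((solutions_nonempty_iff K A).1 h)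
    simp [Finset.not_nonempty_iff_eq_empty.1 this]) hpos
  refine le_trans ?_ this
  have hpos2 : 0 < ∫ A, ((solutions K A).card : ℝ) ^ 2 ∂(gaussianEnsemble m n) := by
    rw [integral_card_solutions_sq hK m hn]
    have h0 : 0 < ∑ k ∈ Finset.range (n + 1),
        (n.choose k : ℝ) * overlapProb K (overlapAngle n k) ^ m := by
      refine Finset.sum_pos (fun k hk => ?_) ⟨0, by simp⟩
      have hkn : k ≤ n := Nat.lt_succ_iff.1 (Finset.mem_range.1 hk)
      have h1 : (0 : ℝ) < n.choose k := by exact_mod_cast Nat.choose_pos hkn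
      have h2 : 0 < overlapProb K (overlapAngle n k) := by
        rcases le_total (2 * k) n with h' | h'
        · exact overlapProb_pos hK (overlapAngle_nonneg n k) (overlapAngle_le_pi_div_four hn h')
        · rw [← overlapProb_pi_div_two_sub, ← overlapAngle_sub hn hkn]
          exact overlapProb_pos hK (overlapAngle_nonneg n _)
            (overlapAngle_le_pi_div_four hn (by omega))
      positivity
    positivity
  rw [div_le_iff₀ (by positivity)] at hr
  rw [le_div_iff₀ hpos2, inv_mul_le_iff₀ hC]
  exact hr

/-- The reduction of the second moment method to the overlap gap. The gap is needed at all `K'`,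
since the probability bound concerns the threshold `criticalK (α n)`, which varies with `n`. -/
theorem second_moment_method {η ν : ℝ} (hη0 : 0 < η) (hη : η ≤ 1 / 2) (hν : 0 < ν)
    (hgap : ∀ K : ℝ, 0 < K → OverlapGap η ν K) (K : ℝ) (hK : 0 < K) :
    ∃ C : ℝ, 0 < C ∧ ∀ α : ℕ → ℝ,
      (∀ n, 0 < α n) → (∀ n, α n ≤ criticalDensity K) → ∀ n : ℕ, 1 ≤ n →
      (∫ A, ((solutions K A).card : ℝ) ^ 2 ∂(gaussianEnsemble ⌊α n * n⌋₊ n)) /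
        (∫ A, ((solutions K A).card : ℝ) ∂(gaussianEnsemble ⌊α n * n⌋₊ n)) ^ 2 < C ∧
      C⁻¹ < (gaussianEnsemble ⌊α n * n⌋₊ n).real {A | disc A ≤ criticalK (α n)} := by
  obtain ⟨C, hC, h⟩ := exists_second_moment_sum_le hη0 hη hν
  refine ⟨C + 1, by linarith, fun α hα0 hα n hn => ?_⟩
  have hrows : ∀ K' : ℝ, 0 < K' → α n ≤ criticalDensity K' →
      (⌊α n * n⌋₊ : ℝ) * invDensity K' ≤ n := by
    intro K' hK' hle
    have hn0 : (0 : ℝ) < n := by exact_mod_cast hn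
    have ha := invDensity_pos hK'
    rw [criticalDensity_eq_inv, ← one_div, le_div_iff₀ ha] at hle
    have := Nat.floor_le (mul_nonneg (hα0 n).le hn0.le)
    calc _ ≤ α n * n * invDensity K' := by gcongr
      _ = α n * invDensity K' * n := by ring
      _ ≤ 1 * n := by gcongr
      _ = n := one_mul _
  refine ⟨?_, ?_⟩
  · exact (second_moment_ratio_le hK hn (h K hK (hgap K hK) n _ hn (hrows K hK (hα n)))).trans_lt
      (lt_add_one C)
  · -- the second moment bound is applied at the threshold for which `α n` itself is critical
    obtain ⟨hK', hcr⟩ := criticalK_spec (hα0 n)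
    have h2 := inv_le_measureReal_disc_le hK' (by linarith) hn
      (h _ hK' (hgap _ hK') n _ hn (hrows _ hK' hcr.ge))
    exact (inv_strictAnti₀ (by linarith) (lt_add_one C)).trans_le h2

/-! ### Numerical values of logarithms -/

lemma sum_le_halfLogOdds {ρ : ℝ} (h0 : 0 ≤ ρ) (h1 : ρ < 1) :
    ρ * (1 + ρ ^ 2 / 3 + ρ ^ 4 / 5 + ρ ^ 6 / 7 + ρ ^ 8 / 9) ≤ halfLogOdds ρ := by
  have := nonneg_of_hasDerivAt_nonneg
    (f := fun x => halfLogOdds x - (x + x ^ 3 / 3 + x ^ 5 / 5 + x ^ 7 / 7 + x ^ 9 / 9))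
    (f' := fun x => 1 / (1 - x ^ 2) - (1 + x ^ 2 + x ^ 4 + x ^ 6 + x ^ 8)) (b := ρ)
    ?_ ?_ ?_ ?_ h0 le_rfl
  · linarith
  · intro x hx
    exact ((hasDerivAt_halfLogOdds (by linarith [hx.1]) (by linarith [hx.2])).continuousAt.sub
      (by fun_prop : ContinuousAt
        (fun x : ℝ => x + x ^ 3 / 3 + x ^ 5 / 5 + x ^ 7 / 7 + x ^ 9 / 9) x)).continuousWithinAt
  · intro x hx hx'
    refine ((hasDerivAt_halfLogOdds (by linarith) (by linarith)).sub
      (((((hasDerivAt_id x).add ((hasDerivAt_pow 3 x).div_const 3)).add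
        ((hasDerivAt_pow 5 x).div_const 5)).add ((hasDerivAt_pow 7 x).div_const 7)).add
        ((hasDerivAt_pow 9 x).div_const 9))).congr_deriv ?_
    norm_num
  · intro x hx hx'
    have : 0 < 1 - x ^ 2 := by nlinarith
    rw [sub_nonneg, le_div_iff₀ this]
    nlinarith [pow_pos hx 10]
  · simp

lemma halfLogOdds_le_sum {ρ : ℝ} (h0 : 0 ≤ ρ) (h1 : ρ < 1) :
    halfLogOdds ρ ≤
      ρ * (1 + ρ ^ 2 / 3 + ρ ^ 4 / 5 + ρ ^ 6 / 7 + ρ ^ 8 / 9 + ρ ^ 10 / (11 * (1 - ρ ^ 2))) := by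
  have h2 : 0 < 1 - ρ ^ 2 := by nlinarith
  have := nonneg_of_hasDerivAt_nonneg
    (f := fun x => (x + x ^ 3 / 3 + x ^ 5 / 5 + x ^ 7 / 7 + x ^ 9 / 9 +
      x ^ 11 / 11 * (1 / (1 - ρ ^ 2))) - halfLogOdds x)
    (f' := fun x => (1 + x ^ 2 + x ^ 4 + x ^ 6 + x ^ 8 + x ^ 10 * (1 / (1 - ρ ^ 2))) -
      1 / (1 - x ^ 2)) (b := ρ) ?_ ?_ ?_ ?_ h0 le_rfl
  · have e : ρ * (1 + ρ ^ 2 / 3 + ρ ^ 4 / 5 + ρ ^ 6 / 7 + ρ ^ 8 / 9 + ρ ^ 10 / (11 * (1 - ρ ^ 2))) =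
      ρ + ρ ^ 3 / 3 + ρ ^ 5 / 5 + ρ ^ 7 / 7 + ρ ^ 9 / 9 + ρ ^ 11 / 11 * (1 / (1 - ρ ^ 2)) := by
      field_simp
    rw [e]; linarith
  · intro x hx
    exact ((by fun_prop : ContinuousAt
      (fun x : ℝ => x + x ^ 3 / 3 + x ^ 5 / 5 + x ^ 7 / 7 + x ^ 9 / 9 +
        x ^ 11 / 11 * (1 / (1 - ρ ^ 2))) x).sub (hasDerivAt_halfLogOdds (by linarith [hx.1])
        (by linarith [hx.2])).continuousAt).continuousWithinAt
  · intro x hx hx'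
    refine ((((((hasDerivAt_id x).add ((hasDerivAt_pow 3 x).div_const 3)).add
        ((hasDerivAt_pow 5 x).div_const 5)).add ((hasDerivAt_pow 7 x).div_const 7)).add
        ((hasDerivAt_pow 9 x).div_const 9)).add
        (((hasDerivAt_pow 11 x).div_const 11).mul_const _)).sub
        (hasDerivAt_halfLogOdds (by linarith) (by linarith)) |>.congr_deriv ?_
    norm_num
  · intro x hx hx'
    have h3 : 0 < 1 - x ^ 2 := by nlinarith
    have h4 : 1 / (1 - x ^ 2) ≤ 1 / (1 - ρ ^ 2) := by
      apply one_div_le_one_div_of_le h2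
      nlinarith
    have h5 : 1 / (1 - x ^ 2) = 1 + x ^ 2 + x ^ 4 + x ^ 6 + x ^ 8 + x ^ 10 * (1 / (1 - x ^ 2)) := by
      field_simp
      ring
    have := mul_le_mul_of_nonneg_left h4 (pow_pos hx 10).le
    linarith
  · simp

lemma two_mul_halfLogOdds {ρ : ℝ} (h0 : -1 < ρ) (h1 : ρ < 1) :
    2 * halfLogOdds ρ = log ((1 + ρ) / (1 - ρ)) := by
  rw [log_div (by linarith) (by linarith), halfLogOdds]; ring

lemma log_three_bounds : 1.09861 < log 3 ∧ log 3 < 1.09862 := by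
  have h := two_mul_halfLogOdds (ρ := 1 / 5) (by norm_num) (by norm_num)
  have h1 := sum_le_halfLogOdds (ρ := 1 / 5) (by norm_num) (by norm_num)
  have h2 := halfLogOdds_le_sum (ρ := 1 / 5) (by norm_num) (by norm_num)
  rw [show (1 + 1 / 5 : ℝ) / (1 - 1 / 5) = 3 / 2 by norm_num, log_div (by norm_num) (by norm_num)]
    at h
  have := log_two_gt_d9
  have := log_two_lt_d9
  norm_num at h1 h2
  constructor <;> linarith

lemma log_five_bounds : 1.60943 < log 5 ∧ log 5 < 1.60944 := by
  have h := two_mul_halfLogOdds (ρ := 1 / 9) (by norm_num) (by norm_num)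
  have h1 := sum_le_halfLogOdds (ρ := 1 / 9) (by norm_num) (by norm_num)
  have h2 := halfLogOdds_le_sum (ρ := 1 / 9) (by norm_num) (by norm_num)
  rw [show (1 + 1 / 9 : ℝ) / (1 - 1 / 9) = 5 / 2 ^ 2 by norm_num,
    log_div (by norm_num) (by norm_num), log_pow] at h
  have := log_two_gt_d9
  have := log_two_lt_d9
  norm_num at h h1 h2
  constructor <;> linarith

lemma log_seventeen_bounds : 2.83321 < log 17 ∧ log 17 < 2.83322 := by
  have h := two_mul_halfLogOdds (ρ := 1 / 33) (by norm_num) (by norm_num)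
  have h1 := sum_le_halfLogOdds (ρ := 1 / 33) (by norm_num) (by norm_num)
  have h2 := halfLogOdds_le_sum (ρ := 1 / 33) (by norm_num) (by norm_num)
  rw [show (1 + 1 / 33 : ℝ) / (1 - 1 / 33) = 17 / 2 ^ 4 by norm_num,
    log_div (by norm_num) (by norm_num), log_pow] at h
  have := log_two_gt_d9
  have := log_two_lt_d9
  norm_num at h h1 h2
  constructor <;> linarith

lemma halfLogOdds_four_fifths : halfLogOdds (4 / 5) = log 3 := by
  have h := two_mul_halfLogOdds (ρ := 4 / 5) (by norm_num) (by norm_num)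
  rw [show (1 + 4 / 5 : ℝ) / (1 - 4 / 5) = 3 ^ 2 by norm_num, log_pow] at h
  push_cast at h
  linarith

lemma entropyDefect_four_fifths : entropyDefect (4 / 5) = 9 / 5 * log 3 - log 5 := by
  rw [entropyDefect, show (1 + 4 / 5 : ℝ) = 3 ^ 2 / 5 by norm_num,
    show (1 - 4 / 5 : ℝ) = 1 / 5 by norm_num, log_div (by norm_num) (by norm_num),
    log_div (by norm_num) (by norm_num), log_pow, log_one]
  push_cast; ring

lemma halfLogOdds_seven_tenths : halfLogOdds (7 / 10) = (log 17 - log 3) / 2 := by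
  have h := two_mul_halfLogOdds (ρ := 7 / 10) (by norm_num) (by norm_num)
  rw [show (1 + 7 / 10 : ℝ) / (1 - 7 / 10) = 17 / 3 by norm_num,
    log_div (by norm_num) (by norm_num)] at h
  linarith

lemma entropyDefect_seven_tenths :
    entropyDefect (7 / 10) = 17 / 20 * log 17 + 3 / 20 * log 3 - log 2 - log 5 := by
  rw [entropyDefect, show (1 + 7 / 10 : ℝ) = 17 / (2 * 5) by norm_num,
    show (1 - 7 / 10 : ℝ) = 3 / (2 * 5) by norm_num, log_div (by norm_num) (by norm_num),
    log_div (by norm_num) (by norm_num), log_mul (by norm_num) (by norm_num)]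
  ring

/-! ### Small angles -/

lemma three_mul_sin_le {θ : ℝ} (h0 : 0 ≤ θ) (h1 : θ ≤ π / 2) :
    3 * sin θ ≤ θ * (2 + cos θ) := by
  have := nonneg_of_hasDerivAt_nonneg (f := fun x => x * (2 + cos x) - 3 * sin x)
    (f' := fun x => 4 * sin (x / 2) * (sin (x / 2) - x / 2 * cos (x / 2))) (b := π / 2)
    ?_ ?_ ?_ ?_ h0 h1
  · linarith
  · exact (by fun_prop : Continuous fun x : ℝ => x * (2 + cos x) - 3 * sin x).continuousOn
  · intro x _ _
    refine (((hasDerivAt_id x).mul ((hasDerivAt_cos x).const_add 2)).sub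
      ((hasDerivAt_sin x).const_mul 3)).congr_deriv ?_
    have e1 : cos x = 1 - 2 * sin (x / 2) ^ 2 := by
      have h2 := cos_two_mul (x / 2)
      rw [mul_div_cancel₀ x two_ne_zero] at h2
      linarith [cos_sq_add_sin_sq (x / 2)]
    have e2 : sin x = 2 * sin (x / 2) * cos (x / 2) := by
      rw [← sin_two_mul]; congr 1; ring
    simp only [id]
    rw [e1, e2]
    ring
  · intro x hx hx'
    have hs : 0 ≤ sin (x / 2) := sin_nonneg_of_nonneg_of_le_pi (by linarith) (by linarith [pi_pos])
    have hc : 0 < cos (x / 2) := cos_pos_of_mem_Ioo ⟨by linarith [pi_pos], by linarith [pi_pos]⟩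
    have ht := le_tan (x := x / 2) (by linarith) (by linarith [pi_pos])
    rw [tan_eq_sin_div_cos, le_div_iff₀ hc] at ht
    have : 0 ≤ sin (x / 2) - x / 2 * cos (x / 2) := by linarith
    positivity
  · simp

/-- A lower bound for the logarithmic derivative of the entropy `log 2 - ι` near `ρ = 1`. The
difference of the two sides is concave on `[ρ₁, 1]` and vanishes at `1`. -/
lemma mul_entropy_le {R ρ₁ : ℝ} (hρ₁ : 7 / 10 ≤ ρ₁) (hR : R ≤ 17 / 10) (h1 : ρ₁ < 1)
    (h : R * (log 2 - entropyDefect ρ₁) ≤ 3 * halfLogOdds ρ₁ * (1 - ρ₁ ^ 2) / (2 + ρ₁))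
    {ρ : ℝ} (hρ : ρ₁ ≤ ρ) (hρ' : ρ ≤ 1) :
    R * (log 2 - entropyDefect ρ) ≤ 3 * halfLogOdds ρ * (1 - ρ ^ 2) / (2 + ρ) := by
  set V : ℝ → ℝ := fun x => 3 * halfLogOdds x * (1 - x ^ 2) / (2 + x) -
    R * (log 2 - entropyDefect x) with hV
  have hd : ∀ x ∈ Ioo ρ₁ 1, HasDerivAt V
      (3 / (2 + x) - halfLogOdds x * (3 - R - 9 / (2 + x) ^ 2)) x := by
    intro x hx
    have hx1 : -1 < x := by linarith [hx.1]
    have hx2 : 0 < 2 + x := by linarith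
    have hx3 : 0 < 1 - x ^ 2 := by nlinarith [hx.1, hx.2]
    have hd1 := (((hasDerivAt_halfLogOdds hx1 hx.2).const_mul 3).mul
      ((hasDerivAt_pow 2 x).const_sub 1)).div ((hasDerivAt_id x).const_add 2) hx2.ne'
    refine (hd1.sub (((hasDerivAt_entropyDefect hx1 hx.2).const_sub (log 2)).const_mul
      R)).congr_deriv ?_
    simp only [id, Pi.mul_apply]
    field_simp
    ring
  have hc : ContinuousOn V (Icc ρ₁ 1) := by
    have e : V = fun x => 3 / 2 * ((1 - x ^ 2) * log (1 + x) -
        (1 + x) * ((1 - x) * log (1 - x))) / (2 + x) - R * (log 2 - entropyDefect x) := by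
      ext x; simp only [hV, halfLogOdds]; ring
    rw [e]
    have h1 : ContinuousOn (fun x : ℝ => log (1 + x)) (Icc ρ₁ 1) :=
      ContinuousOn.log (by fun_prop) fun x hx => by linarith [hx.1]
    have h2 : Continuous fun x : ℝ => (1 - x) * log (1 - x) :=
      Real.continuous_mul_log.comp (continuous_const.sub continuous_id)
    have h3 := continuous_entropyDefect
    have h4 : ∀ x ∈ Icc ρ₁ 1, 2 + x ≠ 0 := fun x hx => by linarith [hx.1]
    have h5 : ContinuousOn (fun x : ℝ => 3 / 2 * ((1 - x ^ 2) * log (1 + x) -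
        (1 + x) * ((1 - x) * log (1 - x)))) (Icc ρ₁ 1) :=
      continuousOn_const.mul (((by fun_prop : Continuous fun x : ℝ => 1 - x ^ 2).continuousOn.mul
        h1).sub ((by fun_prop : Continuous fun x : ℝ => 1 + x).continuousOn.mul h2.continuousOn))
    exact (h5.div (by fun_prop) h4).sub (by fun_prop)
  have hconc : ConcaveOn ℝ (Icc ρ₁ 1) V := by
    refine AntitoneOn.concaveOn_of_deriv (convex_Icc _ _) hc ?_ ?_
    · intro x hx
      rw [interior_Icc] at hx
      exact (hd x hx).differentiableAt.differentiableWithinAt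
    · rw [interior_Icc]
      intro x hx z hz hxz
      rw [(hd x hx).deriv, (hd z hz).deriv]
      have hx2 : 0 < 2 + x := by linarith [hx.1]
      have hy0 : 0 ≤ halfLogOdds x := halfLogOdds_nonneg (by linarith [hx.1]) hx.2
      have hyz : halfLogOdds x ≤ halfLogOdds z := by
        have : 0 < 1 + x := by linarith [hx.1]
        have : 0 < 1 - z := by linarith [hz.2]
        unfold halfLogOdds
        gcongr
      have hbx : 0 ≤ 3 - R - 9 / (2 + x) ^ 2 := by
        have : 9 / (2 + x) ^ 2 ≤ 13 / 10 := by
          rw [div_le_iff₀ (by positivity)]; nlinarith [hx.1]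
        linarith
      have h6 : 3 - R - 9 / (2 + x) ^ 2 ≤ 3 - R - 9 / (2 + z) ^ 2 := by gcongr
      have h7 := mul_le_mul hyz h6 hbx (hy0.trans hyz)
      have h8 : 3 / (2 + z) ≤ 3 / (2 + x) := by gcongr
      linarith
  have hV1 : V 1 = 0 := by simp [hV]
  have hV2 : 0 ≤ V ρ₁ := by simp only [hV]; linarith
  have := hconc.min_le_of_mem_Icc (x := ρ₁) (y := 1) (z := ρ) ⟨le_rfl, h1.le⟩ ⟨h1.le, le_rfl⟩
    ⟨hρ, hρ'⟩
  rw [hV1, min_eq_right hV2] at this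
  simp only [hV] at this
  linarith

lemma mul_entropy_le_of_four_fifths_le {ρ : ℝ} (hρ : 4 / 5 ≤ ρ) (hρ' : ρ ≤ 1) :
    1.28 * (log 2 - entropyDefect ρ) ≤ 3 * halfLogOdds ρ * (1 - ρ ^ 2) / (2 + ρ) := by
  refine mul_entropy_le (ρ₁ := 4 / 5) (by norm_num) (by norm_num) (by norm_num) ?_ hρ hρ'
  rw [halfLogOdds_four_fifths, entropyDefect_four_fifths]
  have := log_three_bounds
  have := log_five_bounds
  have := log_two_lt_d9
  norm_num at *
  linarith

lemma mul_entropy_le_of_seven_tenths_le {ρ : ℝ} (hρ : 7 / 10 ≤ ρ) (hρ' : ρ ≤ 1) :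
    1.16 * (log 2 - entropyDefect ρ) ≤ 3 * halfLogOdds ρ * (1 - ρ ^ 2) / (2 + ρ) := by
  refine mul_entropy_le (ρ₁ := 7 / 10) (by norm_num) (by norm_num) (by norm_num) ?_ hρ hρ'
  rw [halfLogOdds_seven_tenths, entropyDefect_seven_tenths]
  have := log_three_bounds
  have := log_five_bounds
  have := log_seventeen_bounds
  have := log_two_lt_d9
  norm_num at *
  linarith

lemma mul_log_two_le_entropy {ρ : ℝ} (h0 : 0 ≤ ρ) (h1 : ρ < 1) :
    (1 - ρ) / 2 * log 2 ≤ log 2 - entropyDefect ρ := by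
  have e1 : log (1 - ρ) = log 2 + log ((1 - ρ) / 2) := by
    rw [← log_mul two_ne_zero (by linarith)]; congr 1; ring
  have e2 : log (1 + ρ) = log 2 + log ((1 + ρ) / 2) := by
    rw [← log_mul two_ne_zero (by linarith)]; congr 1; ring
  have h2 : log ((1 + ρ) / 2) ≤ 0 := log_nonpos (by linarith) (by linarith)
  have h3 : log ((1 - ρ) / 2) ≤ -log 2 := by
    rw [← log_inv]; exact log_le_log (by linarith) (by linarith)
  rw [entropyDefect, e1, e2]
  nlinarith

lemma exp_sub_one_le_of_le {t₀ R : ℝ} (ht : 0 < t₀) (h : exp t₀ ≤ 1 + R * t₀) {t : ℝ}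
    (h0 : 0 ≤ t) (h1 : t ≤ t₀) : exp t - 1 ≤ R * t := by
  have := convexOn_exp.2 (mem_univ (0 : ℝ)) (mem_univ t₀)
    (show 0 ≤ 1 - t / t₀ from sub_nonneg.2 ((div_le_one ht).2 h1))
    (show 0 ≤ t / t₀ by positivity) (by ring)
  simp only [smul_eq_mul, mul_zero, zero_add, exp_zero, mul_one,
    div_mul_cancel₀ _ ht.ne'] at this
  have h2 : t / t₀ * exp t₀ ≤ t / t₀ * (1 + R * t₀) := by gcongr
  have e : t / t₀ * (1 + R * t₀) = t / t₀ + R * t := by field_simp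
  linarith

/-- For the entropy `H` as a function of the angle, `(1 - exp (-a H)) / α` is increasing as long as
`a H` is small. -/
lemma one_sub_exp_neg_entropy_mul_le {a R t₀ ρ₁ α₁ : ℝ} (ha : 0 < a) (ht : 0 < t₀)
    (hR : exp t₀ ≤ 1 + R * t₀) (hρ₁ : 7 / 10 ≤ ρ₁)
    (hV : ∀ ρ, ρ₁ ≤ ρ → ρ ≤ 1 →
      R * (log 2 - entropyDefect ρ) ≤ 3 * halfLogOdds ρ * (1 - ρ ^ 2) / (2 + ρ))
    (hα0 : 0 < α₁) (hα1 : α₁ < π / 4) (hcos : ρ₁ ≤ cos (2 * α₁))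
    (hH : a * (log 2 - entropyDefect (cos (2 * α₁))) ≤ t₀)
    {α : ℝ} (h00 : 0 < α) (h1 : α ≤ α₁) :
    (1 - exp (-(a * (log 2 - entropyDefect (cos (2 * α)))))) * α₁ ≤
      (1 - exp (-(a * (log 2 - entropyDefect (cos (2 * α₁)))))) * α := by
  set f : ℝ → ℝ := fun x => a * (log 2 - entropyDefect (cos (2 * x))) with hf
  have hfc : Continuous f := by
    have := continuous_entropyDefect
    simp only [hf]; fun_prop
  have hfnn : ∀ x, 0 ≤ f x := fun x =>
    mul_nonneg ha.le (sub_nonneg.2 (entropyDefect_le_log_two (abs_cos_le_one _)))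
  -- along the segment the entropy term stays below `t₀`
  have hcosle : ∀ x, 0 ≤ x → x ≤ α₁ → cos (2 * α₁) ≤ cos (2 * x) := fun x hx hx' =>
    cos_le_cos_of_nonneg_of_le_pi (by linarith) (by linarith [pi_pos]) (by linarith)
  have hft : ∀ x, 0 ≤ x → x ≤ α₁ → f x ≤ t₀ := by
    intro x hx hx'
    refine le_trans ?_ hH
    have := entropyDefect_monotoneOn ⟨by linarith, cos_le_one (2 * α₁)⟩
      ⟨by linarith [hcosle x hx hx'], cos_le_one (2 * x)⟩ (hcosle x hx hx')
    simp only [hf]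
    gcongr
  have hfd : ∀ x, 0 < x → x < α₁ → HasDerivAt f
      (a * (2 * halfLogOdds (cos (2 * x)) * sin (2 * x))) x := by
    intro x hx hx'
    have hs : 0 < sin (2 * x) := sin_pos_of_pos_of_lt_pi (by linarith) (by linarith [pi_pos])
    have hc1 : cos (2 * x) < 1 := by
      nlinarith [cos_sq_add_sin_sq (2 * x), cos_le_one (2 * x), neg_one_le_cos (2 * x)]
    have hc0 : -1 < cos (2 * x) := by linarith [hcosle x hx.le hx'.le]
    have hd2 : HasDerivAt (fun z : ℝ => cos (2 * z)) (-sin (2 * x) * 2) x := by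
      refine ((hasDerivAt_id x).const_mul 2).cos.congr_deriv ?_
      simp
    have := (((hasDerivAt_entropyDefect hc0 hc1).comp x hd2).const_sub (log 2)).const_mul a
    exact this.congr_deriv (by ring)
  -- the function `(1 - exp (-f)) / x` is monotone
  have hstar : ∀ x, 0 < x → x < α₁ →
      exp (f x) - 1 ≤ x * (a * (2 * halfLogOdds (cos (2 * x)) * sin (2 * x))) := by
    intro x hx hx'
    have hs : 0 < sin (2 * x) := sin_pos_of_pos_of_lt_pi (by linarith) (by linarith [pi_pos])
    have hcx := hcosle x hx.le hx'.le
    have hc1 : cos (2 * x) < 1 := by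
      nlinarith [cos_sq_add_sin_sq (2 * x), cos_le_one (2 * x), neg_one_le_cos (2 * x)]
    have h2 := exp_sub_one_le_of_le ht hR (hfnn x) (hft x hx.le hx'.le)
    have h3 := hV (cos (2 * x)) (hcos.trans hcx) (cos_le_one _)
    have h4 := three_mul_sin_le (θ := 2 * x) (by linarith) (by linarith)
    have hy : 0 ≤ halfLogOdds (cos (2 * x)) := halfLogOdds_nonneg (by linarith) hc1
    have h5 : 0 < 2 + cos (2 * x) := by linarith
    have h6 : 3 * halfLogOdds (cos (2 * x)) * (1 - cos (2 * x) ^ 2) / (2 + cos (2 * x)) ≤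
        2 * x * (halfLogOdds (cos (2 * x)) * sin (2 * x)) := by
      rw [div_le_iff₀ h5, ← sin_sq]
      have := mul_le_mul_of_nonneg_left h4 (mul_nonneg hy hs.le)
      nlinarith
    calc exp (f x) - 1 ≤ R * f x := h2
      _ = a * (R * (log 2 - entropyDefect (cos (2 * x)))) := by simp only [hf]; ring
      _ ≤ a * (2 * x * (halfLogOdds (cos (2 * x)) * sin (2 * x))) := by
          exact mul_le_mul_of_nonneg_left (h3.trans h6) ha.le
      _ = _ := by ring
  have hmono : (1 - exp (-f α)) / α ≤ (1 - exp (-f α₁)) / α₁ := by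
    have : MonotoneOn (fun x => (1 - exp (-f x)) / x) (Icc α α₁) := by
      refine monotoneOn_of_hasDerivWithinAt_nonneg
        (f' := fun x => (exp (-f x) * (a * (2 * halfLogOdds (cos (2 * x)) * sin (2 * x))) * x -
          (1 - exp (-f x))) / x ^ 2) (convex_Icc _ _) ?_ ?_ ?_
      · exact ContinuousOn.div (by fun_prop) continuousOn_id fun x hx => by
          have := hx.1; exact (h00.trans_le this).ne'
      · intro x hx
        rw [interior_Icc] at hx
        have hx0 : 0 < x := h00.trans hx.1
        refine HasDerivAt.hasDerivWithinAt ?_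
        refine (((hfd x hx0 hx.2).neg.exp.const_sub 1).div (hasDerivAt_id x) hx0.ne').congr_deriv ?_
        simp only [id, Pi.neg_apply]
        ring
      · intro x hx
        rw [interior_Icc] at hx
        have hx0 : 0 < x := h00.trans hx.1
        have h2 := hstar x hx0 hx.2
        have h3 : exp (-f x) * exp (f x) = 1 := by rw [← exp_add]; simp
        refine div_nonneg ?_ (by positivity)
        have := mul_le_mul_of_nonneg_left h2 (exp_pos (-f x)).le
        rw [mul_sub, h3, mul_one] at this
        linarith
    exact this ⟨le_rfl, h1⟩ ⟨h1, le_rfl⟩ h1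
  rw [div_le_div_iff₀ h00 hα0] at hmono
  exact hmono

lemma sq_mul_one_add_le_four {a α₁ : ℝ} (ha : 0 < a) (hα0 : 0 < α₁) (hα1 : α₁ < π / 4)
    (hcos : 0 ≤ cos (2 * α₁))
    (hH : a * (log 2 - entropyDefect (cos (2 * α₁))) ≤ 47 / 100) : α₁ ^ 2 * (1 + a) ≤ 4 := by
  have hα1' : α₁ ≤ 1 := by linarith [pi_lt_four]
  have hs := mul_le_sin hα0.le (by linarith [pi_pos] : α₁ ≤ π / 2)
  have hs0 : 0 < sin α₁ := sin_pos_of_pos_of_lt_pi hα0 (by linarith [pi_pos])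
  have h2 : α₁ ≤ 8 / 5 * sin α₁ := by
    have hpi := pi_pos
    have : α₁ ≤ π / 2 * sin α₁ := by
      calc α₁ = π / 2 * (2 / π * α₁) := by field_simp
        _ ≤ _ := by gcongr
    nlinarith [pi_lt_d2]
  have h3 : sin α₁ ^ 2 = (1 - cos (2 * α₁)) / 2 := by rw [cos_two_mul, cos_sq']; ring
  have hc1 : cos (2 * α₁) < 1 := by nlinarith
  have h4 := mul_log_two_le_entropy hcos hc1
  rw [← h3] at h4
  have h5 : a * (sin α₁ ^ 2 * log 2) ≤ 47 / 100 :=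
    (mul_le_mul_of_nonneg_left h4 ha.le).trans hH
  have h6 : α₁ ^ 2 ≤ 64 / 25 * sin α₁ ^ 2 := by nlinarith
  have h7 : a * α₁ ^ 2 ≤ 64 / 25 * (a * sin α₁ ^ 2) := by nlinarith
  have h8 : a * sin α₁ ^ 2 ≤ 7 / 10 := by
    nlinarith [log_two_gt_d9, mul_nonneg ha.le (sq_nonneg (sin α₁))]
  nlinarith

/-- Below an angle at which the rate has a gap, concavity takes over: the relative decrease of the
overlap probability is concave in the angle, while `1 - exp (-a H)`, with the entropy `H`, is
star-shaped there. -/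
lemma tail_gap {K η R t₀ ρ₁ α₁ : ℝ} (hK : 0 < K) (hη0 : 0 < η) (hη1 : η ≤ 1) (ht : 0 < t₀)
    (ht' : t₀ ≤ 47 / 100) (hR : exp t₀ ≤ 1 + R * t₀) (hρ₁ : 7 / 10 ≤ ρ₁)
    (hV : ∀ ρ, ρ₁ ≤ ρ → ρ ≤ 1 →
      R * (log 2 - entropyDefect ρ) ≤ 3 * halfLogOdds ρ * (1 - ρ ^ 2) / (2 + ρ))
    (hα0 : 0 < α₁) (hα1 : α₁ < π / 4) (hcos : ρ₁ ≤ cos (2 * α₁))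
    (hH : invDensity K * (log 2 - entropyDefect (cos (2 * α₁))) ≤ t₀)
    (hbody : log (overlapProb K α₁) - 2 * log (pK K) ≤
      (1 - η) * invDensity K * entropyDefect (cos (2 * α₁)))
    {α : ℝ} (h0 : 0 ≤ α) (h1 : α ≤ α₁) :
    η / 20 * invDensity K * sin α / √(1 + invDensity K) ≤
      log (pK K) - log (overlapProb K α) -
        invDensity K * (log 2 - entropyDefect (cos (2 * α))) := by
  have ha := invDensity_pos hK
  have hp := pK_pos hK
  have hal := invDensity_mul_log_two K
  set a := invDensity K with had
  set p := pK K with hpd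
  set f : ℝ → ℝ := fun x => a * (log 2 - entropyDefect (cos (2 * x))) with hf
  have hfnn : ∀ x, 0 ≤ f x := fun x =>
    mul_nonneg ha.le (sub_nonneg.2 (entropyDefect_le_log_two (abs_cos_le_one _)))
  have hft : f α₁ ≤ t₀ := hH
  rcases h0.eq_or_lt with h00 | h00
  · rw [← h00, overlapProb_zero hK]
    simp [hpd]
  have hmono : (1 - exp (-f α)) * α₁ ≤ (1 - exp (-f α₁)) * α :=
    one_sub_exp_neg_entropy_mul_le ha ht hR hρ₁ hV hα0 hα1 hcos hH h00 h1
  -- convexity of the overlap probability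
  have hconv := (convexOn_overlapProb K).2 (show (0 : ℝ) ∈ Icc 0 (π / 4) from ⟨le_rfl, by positivity⟩)
    (show α₁ ∈ Icc 0 (π / 4) from ⟨hα0.le, hα1.le⟩)
    (show 0 ≤ 1 - α / α₁ from sub_nonneg.2 ((div_le_one hα0).2 h1))
    (show 0 ≤ α / α₁ by positivity) (by ring)
  simp only [smul_eq_mul, mul_zero, zero_add, div_mul_cancel₀ _ hα0.ne', overlapProb_zero hK]
    at hconv
  have hq := overlapProb_pos hK h0 (h1.trans hα1.le)
  have hq1 := overlapProb_pos hK hα0.le hα1.le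
  set q := overlapProb K α with hqd
  set q₁ := overlapProb K α₁ with hq1d
  set ι := entropyDefect (cos (2 * α₁)) with hι
  have hι2 : 1 / 5 ≤ ι := by
    have := half_sq_le_entropyDefect (abs_cos_le_one (2 * α₁))
    nlinarith
  have hι1 : ι ≤ 1 := (entropyDefect_le_log_two (abs_cos_le_one (2 * α₁))).trans
    (by linarith [log_two_lt_d9])
  set u := η * a * ι with hu
  have hu0 : 0 < u := by positivity
  -- the gap at `α₁`
  have hq1le : q₁ ≤ p * (exp (-f α₁) * exp (-u)) := by
    have h2 : log q₁ ≤ log p + (-f α₁ + -u) := by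
      simp only [hf]
      rw [← hι, hu]
      linarith
    calc q₁ = exp (log q₁) := (exp_log hq1).symm
      _ ≤ exp (log p + (-f α₁ + -u)) := exp_le_exp.2 h2
      _ = _ := by rw [exp_add, exp_log hp, exp_add]
  have hexpu : exp (-u) ≤ 1 / (1 + u) := by
    rw [exp_neg, ← one_div]
    exact one_div_le_one_div_of_le (by linarith) (by linarith [add_one_le_exp u])
  have hef : 53 / 100 ≤ exp (-f α₁) := by
    have := add_one_le_exp (-f α₁)
    linarith
  have hgap : α / α₁ * (53 / 100 * (u / (1 + u))) ≤ exp (-f α) - q / p := by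
    have h2 : q / p ≤ 1 - α / α₁ + α / α₁ * (exp (-f α₁) * (1 / (1 + u))) := by
      rw [div_le_iff₀ hp]
      refine hconv.trans ?_
      have : q₁ ≤ p * (exp (-f α₁) * (1 / (1 + u))) := hq1le.trans (by gcongr)
      have := mul_le_mul_of_nonneg_left this (show 0 ≤ α / α₁ by positivity)
      linarith
    have h3 : 1 - exp (-f α) ≤ α / α₁ * (1 - exp (-f α₁)) := by
      rw [div_mul_eq_mul_div, le_div_iff₀ hα0]
      linarith
    have h4 : α / α₁ * (53 / 100 * (u / (1 + u))) ≤ α / α₁ * (exp (-f α₁) * (u / (1 + u))) := by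
      gcongr
    have h5 : u / (1 + u) = 1 - 1 / (1 + u) := by field_simp; ring
    have h6 : α / α₁ * (exp (-f α₁) * (u / (1 + u))) =
        α / α₁ * exp (-f α₁) - α / α₁ * (exp (-f α₁) * (1 / (1 + u))) := by rw [h5]; ring
    linarith
  -- passing to logarithms
  have hlog : exp (-f α) - q / p ≤ log p - log q - f α := by
    have h2 := add_one_le_exp (-(log p - log q - f α))
    have h3 : exp (-(log p - log q - f α)) = q / p * exp (f α) := by
      rw [show -(log p - log q - f α) = log q - log p + f α by ring, exp_add, exp_sub,
        exp_log hq, exp_log hp]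
    have h4 : exp (-f α) * exp (f α) = 1 := by rw [← exp_add]; simp
    have h5 : 1 ≤ exp (f α) := one_le_exp (hfnn α)
    have h6 : 0 ≤ exp (-f α) - q / p := le_trans (by positivity) hgap
    have h7 := mul_le_mul_of_nonneg_left h5 h6
    have h8 : (exp (-f α) - q / p) * exp (f α) = 1 - q / p * exp (f α) := by
      rw [sub_mul, h4]
    linarith
  refine le_trans ?_ (hgap.trans hlog)
  -- `α₁ ^ 2 * (1 + a)` is bounded because the entropy at `α₁` is
  have hsq : α₁ ^ 2 * (1 + a) ≤ 4 :=
    sq_mul_one_add_le_four ha hα0 hα1 (by linarith) (hH.trans ht')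
  have hsq' : α₁ * √(1 + a) ≤ 2 := by
    have h2 : (α₁ * √(1 + a)) ^ 2 ≤ 2 ^ 2 := by
      rw [mul_pow, Real.sq_sqrt (by linarith)]; linarith
    exact (sq_le_sq₀ (by positivity) zero_le_two).1 h2
  have hsα : sin α ≤ α := sin_le h0
  have hu1 : η * a / 5 / (1 + a) ≤ u / (1 + u) := by
    rw [div_le_div_iff₀ (by linarith) (by linarith)]
    have h2 : η * a / 5 ≤ u := by
      rw [hu]
      have := mul_le_mul_of_nonneg_left hι2 (mul_pos hη0 ha).le
      linarith
    have h3 : u ≤ a := by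
      rw [hu]
      calc η * a * ι ≤ 1 * a * 1 := by gcongr
        _ = a := by ring
    have h4 : η * a / 5 * u ≤ u * a := by
      rw [mul_comm u a]
      gcongr
      have : η * a ≤ 1 * a := by gcongr
      linarith
    linarith
  have hs1 : 0 < √(1 + a) := Real.sqrt_pos.2 (by linarith)
  have hs2 : √(1 + a) ^ 2 = 1 + a := Real.sq_sqrt (by linarith)
  calc η / 20 * a * sin α / √(1 + a) ≤ η / 20 * a * α / √(1 + a) := by gcongr
    _ ≤ α / α₁ * (53 / 100 * (η * a / 5 / (1 + a))) := by
      have e : α / α₁ * (53 / 100 * (η * a / 5 / (1 + a))) =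
          η * a * α / √(1 + a) * (53 / 500 * (1 / (α₁ * √(1 + a)))) := by
        rw [← hs2, Real.sqrt_sq hs1.le]; field_simp; norm_num
      rw [e, show η / 20 * a * α / √(1 + a) = η * a * α / √(1 + a) * (1 / 20) by ring]
      gcongr
      have : 1 / 2 ≤ 1 / (α₁ * √(1 + a)) := one_div_le_one_div_of_le (by positivity) hsq'
      linarith
    _ ≤ _ := by gcongr

/-! ### Comparison with the orthogonal pair -/

/-- The ratio of `P(|Z| ≤ √c)` to `2 √c φ(√c)`, where `φ` is the standard normal density. -/
noncomputable def massRatio (c : ℝ) : ℝ := pK √c / (√(2 * c / π) * exp (-c / 2))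

lemma massRatio_pos {c : ℝ} (hc : 0 < c) : 0 < massRatio c := by
  have := pK_pos (Real.sqrt_pos.2 hc)
  have := pi_pos
  have : 0 < √(2 * c / π) := Real.sqrt_pos.2 (by positivity)
  unfold massRatio; positivity

lemma pK_sqrt_eq {c : ℝ} (hc : 0 < c) :
    pK √c = √(2 * c / π) * exp (-c / 2) * massRatio c := by
  have := pi_pos
  have : 0 < √(2 * c / π) := Real.sqrt_pos.2 (by positivity)
  unfold massRatio; field_simp

lemma pK_sqrt_sq_eq {c : ℝ} (hc : 0 < c) :
    pK √c ^ 2 = 2 * c / π * exp (-c) * massRatio c ^ 2 := by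
  have := pi_pos
  rw [pK_sqrt_eq hc, mul_pow, mul_pow, Real.sq_sqrt (by positivity), ← exp_nat_mul]
  congr 3
  push_cast; ring

lemma cos_two_mul_pos {α : ℝ} (h0 : 0 < α) (h1 : α < π / 4) : 0 < cos (2 * α) :=
  cos_pos_of_mem_Ioo ⟨by linarith [pi_pos], by linarith⟩

lemma sin_two_mul_pos {α : ℝ} (h0 : 0 < α) (h1 : α < π / 4) : 0 < sin (2 * α) :=
  sin_pos_of_pos_of_lt_pi (by linarith) (by linarith [pi_pos])

lemma cos_two_mul_lt_one {α : ℝ} (h0 : 0 < α) (h1 : α < π / 4) : cos (2 * α) < 1 := by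
  have := sin_two_mul_pos h0 h1
  nlinarith [cos_sq_add_sin_sq (2 * α), cos_le_one (2 * α), neg_one_le_cos (2 * α)]

lemma overlapRate_sqrt {c : ℝ} (hc : 0 < c) {α : ℝ} (h0 : 0 < α) (h1 : α < π / 4) :
    overlapRate √c α = 4 / π * exp (-c) *
      (exp (-(c * cos (2 * α) ^ 2 / (1 - cos (2 * α) ^ 2))) *
        sinh (c * cos (2 * α) / (1 - cos (2 * α) ^ 2))) := by
  have hr0 := cos_two_mul_pos h0 h1
  have hr1 := cos_two_mul_lt_one h0 h1
  have e1 : cos α ^ 2 = (1 + cos (2 * α)) / 2 := by rw [cos_two_mul]; ring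
  have e2 : sin α ^ 2 = (1 - cos (2 * α)) / 2 := by rw [cos_two_mul, cos_sq']; ring
  set ρ := cos (2 * α) with hρ
  have h3 : 0 < 1 - ρ ^ 2 := by nlinarith
  have h4 : 1 + ρ ≠ 0 := by linarith
  have h5 : 1 - ρ ≠ 0 := by linarith
  rw [overlapRate, e1, e2, Real.sq_sqrt hc.le, sinh_eq]
  have e3 : -c / (2 * ((1 + ρ) / 2)) = -c + (-(c * ρ ^ 2 / (1 - ρ ^ 2)) + c * ρ / (1 - ρ ^ 2)) := by
    rw [show 1 - ρ ^ 2 = (1 - ρ) * (1 + ρ) by ring]; field_simp; ring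
  have e4 : -c / (2 * ((1 - ρ) / 2)) = -c + (-(c * ρ ^ 2 / (1 - ρ ^ 2)) + -(c * ρ / (1 - ρ ^ 2))) := by
    rw [show 1 - ρ ^ 2 = (1 - ρ) * (1 + ρ) by ring]; field_simp; ring
  rw [e3, e4, exp_add (-c), exp_add (-c), exp_add, exp_add]
  ring

lemma hasDerivAt_cos_two_mul (α : ℝ) :
    HasDerivAt (fun x => cos (2 * x)) (-(2 * sin (2 * α))) α := by
  refine ((hasDerivAt_id α).const_mul 2).cos.congr_deriv ?_
  simp; ring

/-- A function that agrees with the overlap probability at the orthogonal angle and decreases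
faster bounds it from above. -/
lemma overlapProb_le_of_rate_le {K α₀ : ℝ} (hK : 0 < K) (h0 : 0 < α₀) {G g : ℝ → ℝ}
    (hG : ContinuousOn G (Icc α₀ (π / 4))) (hG1 : G (π / 4) = pK K ^ 2)
    (hd : ∀ α, α₀ < α → α < π / 4 → HasDerivAt G (-g α) α)
    (hg : ∀ α, α₀ < α → α < π / 4 → overlapRate K α ≤ g α) {α : ℝ} (hα : α₀ ≤ α)
    (hα' : α ≤ π / 4) : overlapProb K α ≤ G α := by
  have : AntitoneOn (fun x => G x - overlapProb K x) (Icc α₀ (π / 4)) := by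
    refine antitoneOn_of_hasDerivWithinAt_nonpos (f' := fun x => -g x - -overlapRate K x)
      (convex_Icc _ _) (hG.sub (continuous_overlapProb K).continuousOn) ?_ ?_
    · intro x hx
      rw [interior_Icc] at hx
      exact ((hd x hx.1 hx.2).sub (hasDerivAt_overlapProb K (h0.trans hx.1)
        (by linarith [hx.2, pi_pos]))).hasDerivWithinAt
    · intro x hx
      rw [interior_Icc] at hx
      linarith [hg x hx.1 hx.2]
  have h2 := this ⟨hα, hα'⟩ ⟨hα.trans hα', le_rfl⟩ hα'
  simp only [hG1, overlapProb_pi_div_four hK] at h2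
  linarith

/-- The differential inequality that gives the body of the overlap gap. -/
lemma overlapProb_le_of_sinh_le {c κ ρ₀ α₀ : ℝ} (hc : 0 < c) (h0 : 0 < α₀)
    (hρ₀ : cos (2 * α₀) = ρ₀)
    (h : ∀ ρ, 0 < ρ → ρ < ρ₀ →
      exp (-(c * ρ ^ 2 / (1 - ρ ^ 2))) * sinh (c * ρ / (1 - ρ ^ 2)) ≤
        κ * c * massRatio c ^ 2 * invDensity √c * √(1 - ρ ^ 2) * halfLogOdds ρ *
          exp (invDensity √c * entropyDefect ρ)) {α : ℝ} (hα : α₀ ≤ α) (hα' : α ≤ π / 4) :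
    overlapProb √c α ≤ pK √c ^ 2 *
      (1 + κ * (exp (invDensity √c * entropyDefect (cos (2 * α))) - 1)) := by
  set a := invDensity √c with ha
  have hK := Real.sqrt_pos.2 hc
  refine overlapProb_le_of_rate_le (α₀ := α₀) hK h0
    (G := fun x => pK √c ^ 2 * (1 + κ * (exp (a * entropyDefect (cos (2 * x))) - 1)))
    (g := fun x => pK √c ^ 2 * (κ * (exp (a * entropyDefect (cos (2 * x))) *
      (a * (halfLogOdds (cos (2 * x)) * (2 * sin (2 * x)))))))
    ?_ ?_ ?_ ?_ hα hα'
  · have := continuous_entropyDefect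
    exact (by fun_prop : Continuous fun x => pK √c ^ 2 *
      (1 + κ * (exp (a * entropyDefect (cos (2 * x))) - 1))).continuousOn
  · rw [show 2 * (π / 4) = π / 2 by ring]; simp
  · intro x hx hx'
    have hx0 := h0.trans hx
    have hr0 := cos_two_mul_pos hx0 hx'
    have hr1 := cos_two_mul_lt_one hx0 hx'
    have hd := (((((hasDerivAt_entropyDefect (by linarith) hr1).comp x
      (hasDerivAt_cos_two_mul x)).const_mul a).exp.sub_const 1).const_mul κ).const_add 1
    refine (hd.const_mul (pK √c ^ 2)).congr_deriv ?_
    simp only [Function.comp]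
    ring
  · intro x hx hx'
    have hx0 := h0.trans hx
    have hr0 := cos_two_mul_pos hx0 hx'
    have hs0 := sin_two_mul_pos hx0 hx'
    have hlt : cos (2 * x) < ρ₀ := by
      rw [← hρ₀]
      exact cos_lt_cos_of_nonneg_of_le_pi (by linarith) (by linarith [pi_pos]) (by linarith)
    have h2 := h _ hr0 hlt
    have h3 : √(1 - cos (2 * x) ^ 2) = sin (2 * x) := by
      rw [← sin_sq, Real.sqrt_sq hs0.le]
    rw [h3] at h2
    rw [overlapRate_sqrt hc hx0 hx', pK_sqrt_sq_eq hc]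
    have hp := pi_pos
    calc _ ≤ 4 / π * exp (-c) * (κ * c * massRatio c ^ 2 * a * sin (2 * x) *
          halfLogOdds (cos (2 * x)) * exp (a * entropyDefect (cos (2 * x)))) := by gcongr
      _ = _ := by ring

/-- The room `κ < 1` left in the differential inequality becomes a gap in the exponent. -/
lemma log_one_add_mul_exp_sub_one_le {u : ℝ} (h0 : 0 ≤ u) (h1 : u ≤ 1) :
    log (1 + 998 / 1000 * (exp u - 1)) ≤ (1 - 1 / 1000) * u := by
  have h2 := nonneg_of_hasDerivAt_nonneg
    (f := fun x => exp ((1 - 1 / 1000) * x) - (1 + 998 / 1000 * (exp x - 1)))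
    (f' := fun x => exp ((1 - 1 / 1000) * x) * (1 - 1 / 1000) - 998 / 1000 * exp x) (b := 1)
    (by fun_prop) ?_ ?_ (by simp) h0 h1
  · have h3 : 1 ≤ exp u := one_le_exp h0
    rw [log_le_iff_le_exp (by linarith)]
    linarith
  · intro x _ _
    refine HasDerivAt.sub ?_ ?_
    · simpa using ((hasDerivAt_id x).const_mul (1 - 1 / 1000 : ℝ)).exp
    · simpa using (((hasDerivAt_exp x).sub_const 1).const_mul (998 / 1000 : ℝ)).const_add 1
  · intro x hx hx'
    have e : exp ((1 - 1 / 1000) * x) = exp x * exp (-(x / 1000)) := by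
      rw [← exp_add]; congr 1; ring
    have h3 := add_one_le_exp (-(x / 1000))
    have h4 := exp_pos x
    rw [e]
    have : 998 / 1000 ≤ exp (-(x / 1000)) * (1 - 1 / 1000) := by linarith
    nlinarith

lemma exists_cos_two_mul_eq {ρ : ℝ} (h0 : 0 < ρ) (h1 : ρ < 1) :
    ∃ α, 0 < α ∧ α < π / 4 ∧ cos (2 * α) = ρ := by
  refine ⟨arccos ρ / 2, ?_, ?_, ?_⟩
  · have := arccos_pos.2 h1; linarith
  · have := arccos_lt_pi_div_two.2 h0; linarith
  · rw [mul_div_cancel₀ _ two_ne_zero, cos_arccos (by linarith) h1.le]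

lemma cos_two_mul_mem_Icc {α₀ α : ℝ} (h0 : 0 < α₀) (hα : α₀ ≤ α) (hα' : α ≤ π / 4) :
    cos (2 * α) ∈ Icc 0 (cos (2 * α₀)) :=
  ⟨cos_nonneg_of_neg_pi_div_two_le_of_le (by linarith [pi_pos]) (by linarith),
    cos_le_cos_of_nonneg_of_le_pi (by linarith) (by linarith [pi_pos]) (by linarith)⟩

/-- The overlap gap follows from the differential inequality up to an overlap `ρ₀` beyond which
the entropy is small. -/
theorem overlapGap_of_sinh_le {c R t₀ ρ₀ : ℝ} (hc : 0 < c) (ht : 0 < t₀) (ht' : t₀ ≤ 47 / 100)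
    (hR : exp t₀ ≤ 1 + R * t₀) (hρ₀ : 7 / 10 ≤ ρ₀) (hρ₁ : ρ₀ < 1)
    (hV : ∀ ρ, ρ₀ ≤ ρ → ρ ≤ 1 →
      R * (log 2 - entropyDefect ρ) ≤ 3 * halfLogOdds ρ * (1 - ρ ^ 2) / (2 + ρ))
    (hH : invDensity √c * (log 2 - entropyDefect ρ₀) ≤ t₀)
    (hι : invDensity √c * entropyDefect ρ₀ ≤ 1)
    (h : ∀ ρ, 0 < ρ → ρ < ρ₀ →
      exp (-(c * ρ ^ 2 / (1 - ρ ^ 2))) * sinh (c * ρ / (1 - ρ ^ 2)) ≤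
        998 / 1000 * c * massRatio c ^ 2 * invDensity √c * √(1 - ρ ^ 2) * halfLogOdds ρ *
          exp (invDensity √c * entropyDefect ρ)) :
    OverlapGap (1 / 1000) (1 / 1000 / 20) √c := by
  obtain ⟨α₀, h0, h1, hcos⟩ := exists_cos_two_mul_eq (by linarith : 0 < ρ₀) hρ₁
  have hK := Real.sqrt_pos.2 hc
  have ha := invDensity_pos hK
  have hbody : ∀ α, α₀ ≤ α → α ≤ π / 4 → log (overlapProb √c α) - 2 * log (pK √c) ≤
      (1 - 1 / 1000) * invDensity √c * entropyDefect (cos (2 * α)) := by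
    intro α hα hα'
    have h2 := overlapProb_le_of_sinh_le hc h0 hcos h hα hα'
    have hmem := cos_two_mul_mem_Icc h0 hα hα'
    rw [hcos] at hmem
    have hle := entropyDefect_monotoneOn ⟨hmem.1, hmem.2.trans hρ₁.le⟩
      ⟨by linarith, hρ₁.le⟩ hmem.2
    have hnn : 0 ≤ entropyDefect (cos (2 * α)) := entropyDefect_nonneg (abs_cos_le_one _)
    have h3 := log_one_add_mul_exp_sub_one_le (mul_nonneg ha.le hnn)
      ((mul_le_mul_of_nonneg_left hle ha.le).trans hι)
    have hp := pK_pos hK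
    have hq := overlapProb_pos hK (h0.le.trans hα) hα'
    have h5 : 1 ≤ exp (invDensity √c * entropyDefect (cos (2 * α))) :=
      one_le_exp (mul_nonneg ha.le hnn)
    have h4 := log_le_log hq h2
    rw [log_mul (by positivity) (by nlinarith), log_pow] at h4
    push_cast at h4
    linarith
  exact ⟨α₀, h0, h1, hbody, fun α hα hα' => tail_gap hK (by norm_num) (by norm_num) ht ht' hR hρ₀ hV
    h0 h1 hcos.ge (by rw [hcos]; exact hH) (hbody α₀ le_rfl h1.le) hα hα'⟩

/-! ### The Gaussian mass of an interval -/

lemma hasDerivAt_pK {K : ℝ} (hK : 0 < K) :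
    HasDerivAt pK (√(2 / π) * exp (-K ^ 2 / 2)) K := by
  have hcont : Continuous (gaussianPDFReal 0 1) := by unfold gaussianPDFReal; fun_prop
  have hi : ∀ a b, IntervalIntegrable (gaussianPDFReal 0 1) volume a b := fun a b =>
    hcont.intervalIntegrable a b
  have h0 : ∀ x : ℝ, HasDerivAt (fun x => ∫ t in (0 : ℝ)..x, gaussianPDFReal 0 1 t)
      (gaussianPDFReal 0 1 x) x := fun x => intervalIntegral.integral_hasDerivAt_right (hi _ _)
    (hcont.stronglyMeasurableAtFilter _ _) hcont.continuousAt
  have h1 := (h0 K).sub ((h0 (-K)).comp K (hasDerivAt_neg K))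
  have h2 : pK =ᶠ[nhds K] (fun x => ∫ t in (0 : ℝ)..x, gaussianPDFReal 0 1 t) -
      (fun x => ∫ t in (0 : ℝ)..x, gaussianPDFReal 0 1 t) ∘ Neg.neg := by
    filter_upwards [lt_mem_nhds hK] with x hx
    rw [pK_eq_integral hx.le]
    simp only [Pi.sub_apply, Function.comp]
    rw [intervalIntegral.integral_interval_sub_left (hi _ _) (hi _ _)]
  refine (h1.congr_of_eventuallyEq h2).congr_deriv ?_
  simp only [gaussianPDFReal, NNReal.coe_one, mul_one, sub_zero, neg_sq]
  have e : √(2 / π) = 2 * (√(2 * π))⁻¹ := by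
    have hp := pi_pos
    rw [← Real.sqrt_inv, show (2 : ℝ) / π = 2 ^ 2 * (2 * π)⁻¹ by field_simp,
      Real.sqrt_mul (by positivity), Real.sqrt_sq zero_le_two]
  rw [e]; ring

lemma pK_sqrt_eq' {c : ℝ} (hc : 0 < c) :
    pK √c = √(2 / π) * (√c * exp (-√c ^ 2 / 2) * massRatio c) := by
  have hp := pi_pos
  rw [pK_sqrt_eq hc, Real.sq_sqrt hc.le, show 2 * c / π = 2 / π * c by ring,
    Real.sqrt_mul (by positivity)]
  ring

lemma continuousOn_pK_sub {f : ℝ → ℝ} (hf : Continuous f) (b : ℝ) :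
    ContinuousOn (fun x => pK x - √(2 / π) * f x) (Icc 0 b) :=
  (continuousOn_pK.mono fun _ hx => hx.1).sub (by fun_prop)

/-- A partial sum of the expansion `massRatio c = ∑ c ^ n / (2 n + 1)‼`. -/
lemma sum_le_massRatio {c : ℝ} (hc : 0 < c) :
    1 + c / 3 + c ^ 2 / 15 + c ^ 3 / 105 + c ^ 4 / 945 + c ^ 5 / 10395 + c ^ 6 / 135135 +
      c ^ 7 / 2027025 ≤ massRatio c := by
  have hK := Real.sqrt_pos.2 hc
  have h := nonneg_of_hasDerivAt_nonneg (f := fun x => pK x - √(2 / π) * (x * exp (-x ^ 2 / 2) *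
      (1 + x ^ 2 / 3 + x ^ 4 / 15 + x ^ 6 / 105 + x ^ 8 / 945 + x ^ 10 / 10395 +
        x ^ 12 / 135135 + x ^ 14 / 2027025)))
    (f' := fun x => √(2 / π) * exp (-x ^ 2 / 2) * (x ^ 16 / 2027025)) (b := √c)
    (continuousOn_pK_sub (by fun_prop) _) ?_ ?_ (by simp [pK_zero]) hK.le le_rfl
  · rw [pK_sqrt_eq' hc] at h
    have h2 : 0 < √(2 / π) * (√c * exp (-√c ^ 2 / 2)) := by have := pi_pos; positivity
    have e : ∀ n : ℕ, √c ^ (2 * n) = c ^ n := fun n => by rw [pow_mul, Real.sq_sqrt hc.le]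
    have e1 := e 1; have e2 := e 2; have e3 := e 3; have e4 := e 4; have e5 := e 5
    have e6 := e 6; have e7 := e 7
    norm_num at e1 e2 e3 e4 e5 e6 e7
    rw [e2, e3, e4, e5, e6, e7] at h
    rw [← mul_sub] at h
    have h3 := nonneg_of_mul_nonneg_right h (by have := pi_pos; positivity)
    rw [← mul_sub] at h3
    have h4 := nonneg_of_mul_nonneg_right h3 (by positivity)
    rw [Real.sq_sqrt hc.le] at h4
    linarith
  · intro x hx _
    have he : HasDerivAt (fun x : ℝ => exp (-x ^ 2 / 2)) (exp (-x ^ 2 / 2) * (-x)) x := by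
      refine (((hasDerivAt_pow 2 x).neg.div_const 2).exp).congr_deriv ?_
      simp; ring
    have hp : HasDerivAt (fun x : ℝ => 1 + x ^ 2 / 3 + x ^ 4 / 15 + x ^ 6 / 105 + x ^ 8 / 945 +
        x ^ 10 / 10395 + x ^ 12 / 135135 + x ^ 14 / 2027025)
        (2 * x / 3 + 4 * x ^ 3 / 15 + 6 * x ^ 5 / 105 + 8 * x ^ 7 / 945 + 10 * x ^ 9 / 10395 +
          12 * x ^ 11 / 135135 + 14 * x ^ 13 / 2027025) x := by
      refine (((((((((hasDerivAt_pow 2 x).div_const 3).const_add 1).add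
        ((hasDerivAt_pow 4 x).div_const 15)).add ((hasDerivAt_pow 6 x).div_const 105)).add
        ((hasDerivAt_pow 8 x).div_const 945)).add ((hasDerivAt_pow 10 x).div_const 10395)).add
        ((hasDerivAt_pow 12 x).div_const 135135)).add
        ((hasDerivAt_pow 14 x).div_const 2027025)).congr_deriv ?_
      norm_num
    refine ((hasDerivAt_pK hx).sub ((((hasDerivAt_id x).mul he).mul hp).const_mul
      √(2 / π))).congr_deriv ?_
    simp only [id, Pi.mul_apply]
    ring
  · intro x _ _; positivity

/-- The coefficient of `c ^ 8` is larger than `1 / 17‼` by a factor that accounts for the rest of the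
series when `c ≤ 3`. -/
lemma massRatio_le_sum {c : ℝ} (hc : 0 < c) (hc3 : c ≤ 3) :
    massRatio c ≤ 1 + c / 3 + c ^ 2 / 15 + c ^ 3 / 105 + c ^ 4 / 945 + c ^ 5 / 10395 +
      c ^ 6 / 135135 + c ^ 7 / 2027025 + c ^ 8 / 28378350 := by
  have hK := Real.sqrt_pos.2 hc
  have h := nonneg_of_hasDerivAt_nonneg (f := fun x => -(pK x - √(2 / π) * (x * exp (-x ^ 2 / 2) *
      (1 + x ^ 2 / 3 + x ^ 4 / 15 + x ^ 6 / 105 + x ^ 8 / 945 + x ^ 10 / 10395 +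
        x ^ 12 / 135135 + x ^ 14 / 2027025 + x ^ 16 / 28378350))))
    (f' := fun x => √(2 / π) * exp (-x ^ 2 / 2) * (x ^ 16 * (3 - x ^ 2) / 28378350)) (b := √c)
    (continuousOn_pK_sub (by fun_prop) _).neg ?_ ?_ (by simp [pK_zero]) hK.le le_rfl
  · rw [pK_sqrt_eq' hc] at h
    have e : ∀ n : ℕ, √c ^ (2 * n) = c ^ n := fun n => by rw [pow_mul, Real.sq_sqrt hc.le]
    have e1 := e 1; have e2 := e 2; have e3 := e 3; have e4 := e 4; have e5 := e 5
    have e6 := e 6; have e7 := e 7; have e8 := e 8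
    norm_num at e1 e2 e3 e4 e5 e6 e7 e8
    rw [e2, e3, e4, e5, e6, e7, e8] at h
    rw [← mul_sub, neg_mul_eq_mul_neg, neg_sub] at h
    have h3 := nonneg_of_mul_nonneg_right h (by have := pi_pos; positivity)
    rw [← mul_sub] at h3
    have h4 := nonneg_of_mul_nonneg_right h3 (by positivity)
    rw [Real.sq_sqrt hc.le] at h4
    linarith
  · intro x hx _
    have he : HasDerivAt (fun x : ℝ => exp (-x ^ 2 / 2)) (exp (-x ^ 2 / 2) * (-x)) x := by
      refine (((hasDerivAt_pow 2 x).neg.div_const 2).exp).congr_deriv ?_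
      simp; ring
    have hp : HasDerivAt (fun x : ℝ => 1 + x ^ 2 / 3 + x ^ 4 / 15 + x ^ 6 / 105 + x ^ 8 / 945 +
        x ^ 10 / 10395 + x ^ 12 / 135135 + x ^ 14 / 2027025 + x ^ 16 / 28378350)
        (2 * x / 3 + 4 * x ^ 3 / 15 + 6 * x ^ 5 / 105 + 8 * x ^ 7 / 945 + 10 * x ^ 9 / 10395 +
          12 * x ^ 11 / 135135 + 14 * x ^ 13 / 2027025 + 16 * x ^ 15 / 28378350) x := by
      refine ((((((((((hasDerivAt_pow 2 x).div_const 3).const_add 1).add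
        ((hasDerivAt_pow 4 x).div_const 15)).add ((hasDerivAt_pow 6 x).div_const 105)).add
        ((hasDerivAt_pow 8 x).div_const 945)).add ((hasDerivAt_pow 10 x).div_const 10395)).add
        ((hasDerivAt_pow 12 x).div_const 135135)).add
        ((hasDerivAt_pow 14 x).div_const 2027025)).add
        ((hasDerivAt_pow 16 x).div_const 28378350)).congr_deriv ?_
      norm_num
    refine ((hasDerivAt_pK hx).sub ((((hasDerivAt_id x).mul he).mul hp).const_mul
      √(2 / π))).neg.congr_deriv ?_
    simp only [id, Pi.mul_apply]
    ring
  · intro x hx hx'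
    have : x ^ 2 ≤ 3 := by
      calc x ^ 2 ≤ √c ^ 2 := by gcongr
        _ = c := Real.sq_sqrt hc.le
        _ ≤ 3 := hc3
    have : 0 ≤ 3 - x ^ 2 := by linarith
    positivity

lemma hasDerivAt_pK_sqrt {c : ℝ} (hc : 0 < c) :
    HasDerivAt (fun c => pK √c) (pK √c / (2 * c * massRatio c)) c := by
  have hK := Real.sqrt_pos.2 hc
  have hr := massRatio_pos hc
  refine ((hasDerivAt_pK hK).comp c (Real.hasDerivAt_sqrt hc.ne')).congr_deriv ?_
  rw [pK_sqrt_eq' hc]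
  have e : c = √c ^ 2 := (Real.sq_sqrt hc.le).symm
  have : 2 * c * massRatio c = 2 * √c ^ 2 * massRatio c := by rw [← e]
  rw [this]
  field_simp

lemma hasDerivAt_massRatio {c : ℝ} (hc : 0 < c) :
    HasDerivAt massRatio ((1 - massRatio c) / (2 * c) + massRatio c / 2) c := by
  have hp := pi_pos
  have hs : 0 < √(2 * c / π) := Real.sqrt_pos.2 (by positivity)
  have hd1 : HasDerivAt (fun c : ℝ => √(2 * c / π)) (√(2 * c / π) / (2 * c)) c := by
    have := (((hasDerivAt_id c).const_mul 2).div_const π).sqrt (by simp; positivity)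
    refine this.congr_deriv ?_
    simp only [id]
    rw [div_eq_div_iff (by positivity) (by positivity)]
    have e : √(2 * c / π) * (2 * √(2 * c / π)) = 2 * (2 * c / π) := by
      rw [mul_left_comm, Real.mul_self_sqrt (by positivity)]
    rw [e]; ring
  have hd2 : HasDerivAt (fun c : ℝ => exp (-c / 2)) (exp (-c / 2) * (-1 / 2)) c := by
    simpa using ((hasDerivAt_id c).neg.div_const 2).exp
  refine ((hasDerivAt_pK_sqrt hc).div (hd1.mul hd2) (by simp; positivity)).congr_deriv ?_
  have hr := massRatio_pos hc
  rw [pK_sqrt_eq hc]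
  simp only [Pi.mul_apply]
  field_simp
  ring

lemma add_sq_mul_pK_sub_pK_nonneg {K : ℝ} (hK : 0 ≤ K) :
    0 ≤ √(2 / π) * (K * exp (-K ^ 2 / 2)) + K ^ 2 * pK K - pK K := by
  refine nonneg_of_hasDerivAt_nonneg (b := K)
    (f := fun K => √(2 / π) * (K * exp (-K ^ 2 / 2)) + K ^ 2 * pK K - pK K)
    (f' := fun K => 2 * K * pK K) ?_ ?_ ?_ (by simp [pK_zero]) hK le_rfl
  · have h : ContinuousOn pK (Icc 0 K) := continuousOn_pK.mono fun _ hx => hx.1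
    fun_prop
  · intro x hx _
    have he : HasDerivAt (fun x : ℝ => exp (-x ^ 2 / 2)) (exp (-x ^ 2 / 2) * (-x)) x := by
      refine (((hasDerivAt_pow 2 x).neg.div_const 2).exp).congr_deriv ?_
      simp; ring
    refine (((((hasDerivAt_id x).mul he).const_mul √(2 / π)).add
      ((hasDerivAt_pow 2 x).mul (hasDerivAt_pK hx))).sub (hasDerivAt_pK hx)).congr_deriv ?_
    simp only [id]
    ring
  · intro x hx _
    have := pK_pos hx
    positivity

lemma massRatio_monotoneOn : MonotoneOn massRatio (Ioi 0) := by
  refine monotoneOn_of_hasDerivWithinAt_nonneg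
    (f' := fun c => (1 - massRatio c) / (2 * c) + massRatio c / 2) (convex_Ioi _) ?_ ?_ ?_
  · exact fun c hc => (hasDerivAt_massRatio hc).continuousAt.continuousWithinAt
  · intro c hc
    rw [interior_Ioi] at hc
    exact (hasDerivAt_massRatio hc).hasDerivWithinAt
  · intro c hc
    rw [interior_Ioi] at hc
    have hc : 0 < c := hc
    have h := add_sq_mul_pK_sub_pK_nonneg (Real.sqrt_nonneg c)
    have h2 : 0 < √(2 / π) * (√c * exp (-√c ^ 2 / 2)) := by
      have := pi_pos; have := Real.sqrt_pos.2 hc; positivity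
    rw [pK_sqrt_eq' hc, Real.sq_sqrt hc.le] at h
    rw [Real.sq_sqrt hc.le] at h2
    have h3 : 0 ≤ √(2 / π) * (√c * exp (-c / 2)) * (1 + c * massRatio c - massRatio c) := by
      linarith
    have h4 := nonneg_of_mul_nonneg_right h3 h2
    have e : (1 - massRatio c) / (2 * c) + massRatio c / 2 =
        (1 + c * massRatio c - massRatio c) / (2 * c) := by field_simp; ring
    rw [e]
    positivity

lemma one_le_massRatio {c : ℝ} (hc : 0 < c) : 1 ≤ massRatio c :=
  le_trans (by have : 0 ≤ c / 3 + c ^ 2 / 15 + c ^ 3 / 105 + c ^ 4 / 945 + c ^ 5 / 10395 +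
                c ^ 6 / 135135 + c ^ 7 / 2027025 := by positivity
               linarith) (sum_le_massRatio hc)

/-- The function `-log p` is convex in `log c`, with derivative `-1 / (2 r)` for the mass ratio
`r`; this is the bound by its tangent at `c₀`. -/
lemma neg_log_pK_sqrt_ge {c c₀ : ℝ} (hc : 0 < c) (hc₀ : 0 < c₀) :
    -log (pK √c₀) - 1 / (2 * massRatio c₀) * log (c / c₀) ≤ -log (pK √c) := by
  set f : ℝ → ℝ := fun c => -log (pK √c) + 1 / (2 * massRatio c₀) * log c with hf
  have hd : ∀ x, 0 < x → HasDerivAt f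
      (1 / (2 * x) * (1 / massRatio c₀ - 1 / massRatio x)) x := by
    intro x hx
    have hp := pK_pos (Real.sqrt_pos.2 hx)
    have hr := massRatio_pos hx
    refine ((((hasDerivAt_pK_sqrt hx).log hp.ne').neg).add
      ((hasDerivAt_log hx.ne').const_mul _)).congr_deriv ?_
    have hr₀ := massRatio_pos hc₀
    field_simp
    ring
  have key : f c₀ ≤ f c := by
    rcases le_total c c₀ with h | h
    · have : AntitoneOn f (Icc c c₀) := by
        refine antitoneOn_of_hasDerivWithinAt_nonpos (convex_Icc _ _)
          (fun x hx => (hd x (hc.trans_le hx.1)).continuousAt.continuousWithinAt)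
          (f' := fun x => 1 / (2 * x) * (1 / massRatio c₀ - 1 / massRatio x)) ?_ ?_
        · intro x hx
          rw [interior_Icc] at hx
          exact (hd x (hc.trans hx.1)).hasDerivWithinAt
        · intro x hx
          rw [interior_Icc] at hx
          have hx0 := hc.trans hx.1
          have h2 := one_div_le_one_div_of_le (massRatio_pos hx0)
            (massRatio_monotoneOn hx0 hc₀ hx.2.le)
          exact mul_nonpos_of_nonneg_of_nonpos (by positivity) (by linarith)
      exact this ⟨le_rfl, h⟩ ⟨h, le_rfl⟩ h
    · have : MonotoneOn f (Icc c₀ c) := by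
        refine monotoneOn_of_hasDerivWithinAt_nonneg (convex_Icc _ _)
          (fun x hx => (hd x (hc₀.trans_le hx.1)).continuousAt.continuousWithinAt)
          (f' := fun x => 1 / (2 * x) * (1 / massRatio c₀ - 1 / massRatio x)) ?_ ?_
        · intro x hx
          rw [interior_Icc] at hx
          exact (hd x (hc₀.trans hx.1)).hasDerivWithinAt
        · intro x hx
          rw [interior_Icc] at hx
          have hx0 := hc₀.trans hx.1
          have h2 := one_div_le_one_div_of_le (massRatio_pos hc₀)
            (massRatio_monotoneOn hc₀ hx0 hx.1.le)
          exact mul_nonneg (by positivity) (by linarith)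
      exact this ⟨le_rfl, h⟩ ⟨h, le_rfl⟩ h
  simp only [hf] at key
  rw [log_div hc.ne' hc₀.ne']
  linarith

lemma log_le_pade {z : ℝ} (hz : 0 < z) : log z ≤ (z - 1) * (z + 5) / (4 * z + 2) := by
  set f : ℝ → ℝ := fun z => (z - 1) * (z + 5) / (4 * z + 2) - log z with hf
  have hd : ∀ x, 0 < x → HasDerivAt f ((x - 1) ^ 3 / (x * (2 * x + 1) ^ 2)) x := by
    intro x hx
    have h1 : 4 * x + 2 ≠ 0 := by positivity
    refine (((((hasDerivAt_id x).sub_const 1).mul ((hasDerivAt_id x).add_const 5)).div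
      (((hasDerivAt_id x).const_mul 4).add_const 2) h1).sub (hasDerivAt_log hx.ne')).congr_deriv ?_
    have h2 : 2 * x + 1 ≠ 0 := by positivity
    simp only [id, Pi.mul_apply]
    rw [show 4 * x + 2 = 2 * (2 * x + 1) by ring]
    field_simp
    ring
  have h1 : f 1 = 0 := by simp [hf]
  have key : f 1 ≤ f z := by
    rcases le_total z 1 with h | h
    · have : AntitoneOn f (Icc z 1) := by
        refine antitoneOn_of_hasDerivWithinAt_nonpos (convex_Icc _ _)
          (fun x hx => (hd x (hz.trans_le hx.1)).continuousAt.continuousWithinAt)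
          (f' := fun x => (x - 1) ^ 3 / (x * (2 * x + 1) ^ 2)) ?_ ?_
        · intro x hx
          rw [interior_Icc] at hx
          exact (hd x (hz.trans hx.1)).hasDerivWithinAt
        · intro x hx
          rw [interior_Icc] at hx
          have hx0 := hz.trans hx.1
          exact div_nonpos_of_nonpos_of_nonneg
            (Odd.pow_nonpos (by decide) (by linarith [hx.2])) (by positivity)
      exact this ⟨le_rfl, h⟩ ⟨h, le_rfl⟩ h
    · have : MonotoneOn f (Icc 1 z) := by
        refine monotoneOn_of_hasDerivWithinAt_nonneg (convex_Icc _ _)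
          (fun x hx => (hd x (by linarith [hx.1])).continuousAt.continuousWithinAt)
          (f' := fun x => (x - 1) ^ 3 / (x * (2 * x + 1) ^ 2)) ?_ ?_
        · intro x hx
          rw [interior_Icc] at hx
          exact (hd x (by linarith [hx.1])).hasDerivWithinAt
        · intro x hx
          rw [interior_Icc] at hx
          have hx0 : 0 < x := by linarith [hx.1]
          have : 0 ≤ x - 1 := by linarith [hx.1]
          positivity
      exact this ⟨le_rfl, h⟩ ⟨h, le_rfl⟩ h
  rw [h1] at key
  simp only [hf] at key
  linarith

lemma exp_two_mul_log_pK_sqrt {c : ℝ} (hc : 0 < c) :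
    exp (2 * log (pK √c)) = 2 * c / π * exp (-c) * massRatio c ^ 2 := by
  have hp := pK_pos (Real.sqrt_pos.2 hc)
  rw [← pK_sqrt_sq_eq hc, ← exp_log (pow_pos hp 2), log_pow]
  push_cast; rfl

/-- A numerical criterion for `pK √c ≤ exp (-v)`, in its squared form
`2 c r ^ 2 exp (2 v - c) ≤ π`. -/
lemma le_neg_log_pK_sqrt {c r v E : ℝ} (hc : 0 < c) (hr : massRatio c ≤ r)
    (hE : exp (2 * v - c) ≤ E) (h : 2 * c * r ^ 2 * E ≤ 3.141592) : v ≤ -log (pK √c) := by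
  have h1 : exp (2 * log (pK √c)) ≤ exp (-(2 * v)) := by
    rw [exp_two_mul_log_pK_sqrt hc]
    have hp := pi_pos
    have e : exp (-(2 * v)) * exp (2 * v - c) = exp (-c) := by rw [← exp_add]; congr 1; ring
    have hr0 := massRatio_pos hc
    have h2 : 2 * c / π * massRatio c ^ 2 * exp (2 * v - c) ≤ 1 := by
      rw [div_mul_eq_mul_div, div_mul_eq_mul_div, div_le_one hp]
      calc 2 * c * massRatio c ^ 2 * exp (2 * v - c) ≤ 2 * c * r ^ 2 * E := by gcongr
        _ ≤ π := h.trans pi_gt_d6.le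
    calc 2 * c / π * exp (-c) * massRatio c ^ 2 =
          exp (-(2 * v)) * (2 * c / π * massRatio c ^ 2 * exp (2 * v - c)) := by rw [← e]; ring
      _ ≤ exp (-(2 * v)) * 1 := by gcongr
      _ = _ := mul_one _
  have := exp_le_exp.1 h1
  linarith

lemma neg_log_pK_sqrt_le {c r v E : ℝ} (hc : 0 < c) (hr0 : 0 ≤ r) (hr : r ≤ massRatio c)
    (hE0 : 0 ≤ E) (hE : E ≤ exp (2 * v - c)) (h : 3.141593 ≤ 2 * c * r ^ 2 * E) :
    -log (pK √c) ≤ v := by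
  have h1 : exp (-(2 * v)) ≤ exp (2 * log (pK √c)) := by
    rw [exp_two_mul_log_pK_sqrt hc]
    have hp := pi_pos
    have e : exp (-(2 * v)) * exp (2 * v - c) = exp (-c) := by rw [← exp_add]; congr 1; ring
    have h2 : 1 ≤ 2 * c / π * massRatio c ^ 2 * exp (2 * v - c) := by
      rw [div_mul_eq_mul_div, div_mul_eq_mul_div, one_le_div hp]
      calc π ≤ 2 * c * r ^ 2 * E := pi_lt_d6.le.trans h
        _ ≤ 2 * c * massRatio c ^ 2 * exp (2 * v - c) := by gcongr
    calc exp (-(2 * v)) = exp (-(2 * v)) * 1 := (mul_one _).symm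
      _ ≤ exp (-(2 * v)) * (2 * c / π * massRatio c ^ 2 * exp (2 * v - c)) := by gcongr
      _ = 2 * c / π * exp (-c) * massRatio c ^ 2 := by rw [← e]; ring
  have := exp_le_exp.1 h1
  linarith

/-- The tangent bound for `-log p`, with rational data in place of the value at `c₀` and of the
slope, and with a rational function in place of the logarithm. -/
lemma neg_log_pK_sqrt_ge_pade {c₀ lo hi g L₀ : ℝ} (hc₀ : 0 < c₀) (hlo0 : 0 < lo)
    (hlo : lo ≤ massRatio c₀) (hhi : massRatio c₀ ≤ hi) (hg0 : 0 ≤ g)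
    (hg1 : 1 / (2 * lo) ≤ g + 1 / 10 ^ 5) (hg2 : g - 1 / 10 ^ 5 ≤ 1 / (2 * hi))
    (hL : L₀ + 1 / 10 ^ 5 ≤ -log (pK √c₀)) {c : ℝ} (h1 : c₀ ≤ 2 * c) (h2 : c ≤ 2 * c₀) :
    L₀ - g * ((c - c₀) * (c + 5 * c₀) / (c₀ * (4 * c + 2 * c₀))) ≤ -log (pK √c) := by
  have hc : 0 < c := by linarith
  have h := neg_log_pK_sqrt_ge hc hc₀
  have hr := massRatio_pos hc₀
  set m := 1 / (2 * massRatio c₀) with hm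
  have h3 : m ≤ g + 1 / 10 ^ 5 := by
    refine le_trans ?_ hg1
    rw [hm]; gcongr
  have h4 : g - 1 / 10 ^ 5 ≤ m := by
    refine hg2.trans ?_
    rw [hm]; gcongr
  have hz : 0 < c / c₀ := by positivity
  have h5 : log (c / c₀) ≤ 1 := by
    have h2' : c / c₀ ≤ 2 := by rw [div_le_iff₀ hc₀]; exact h2
    have := log_le_log hz h2'
    linarith [log_two_lt_d9]
  have h6 : -1 ≤ log (c / c₀) := by
    have h2' : 2⁻¹ ≤ c / c₀ := by rw [le_div_iff₀ hc₀]; linarith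
    have := log_le_log (by norm_num) h2'
    rw [log_inv] at this
    linarith [log_two_lt_d9]
  have h7 := mul_le_mul_of_nonneg_left (log_le_pade hz) hg0
  have e : (c / c₀ - 1) * (c / c₀ + 5) / (4 * (c / c₀) + 2) =
      (c - c₀) * (c + 5 * c₀) / (c₀ * (4 * c + 2 * c₀)) := by
    have : 4 * c + 2 * c₀ ≠ 0 := by positivity
    field_simp
  rw [e] at h7
  have h8 : m * log (c / c₀) ≤ g * log (c / c₀) + 1 / 10 ^ 5 := by
    rcases le_total 0 (log (c / c₀)) with h' | h'
    · nlinarith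
    · nlinarith
  linarith

lemma exp_neg_le_inv_sum {z : ℝ} (hz : 0 ≤ z) :
    exp (-z) ≤ (∑ i ∈ Finset.range 15, z ^ i / (i.factorial : ℝ))⁻¹ := by
  rw [exp_neg]
  apply inv_anti₀ _ (Real.sum_le_exp_of_nonneg hz 15)
  exact Finset.sum_pos' (fun i _ => by positivity) ⟨0, by simp, by simp⟩

/-! ### Tangent bounds at rational points -/

/-- The tangent bound at `c₀ = 0.3`: here `0.8767` is the value of `-log p` at `c₀`, rounded down,
and `0.45197` is the slope `1 / (2 r)` there. The other points are treated in the same way. -/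
lemma neg_log_pK_sqrt_ge_near_three_tenths {c : ℝ} (h1 : 0.3 ≤ 2 * c) (h2 : c ≤ 2 * 0.3) :
    0.8767 - 0.45197 * ((c - 0.3) * (c + 5 * 0.3) / (0.3 * (4 * c + 2 * 0.3))) ≤
      -log (pK √c) := by
  have hlo := sum_le_massRatio (c := 0.3) (by norm_num)
  have hhi := massRatio_le_sum (c := 0.3) (by norm_num) (by norm_num)
  have hE : exp (2 * (0.8767 + 1 / 10 ^ 5) - 0.3) ≤ 4.278 := by
    have h2 : exp 0.45342 ≤ 1.57369 := by
      refine (Real.exp_bound' (by norm_num) (by norm_num) (n := 6) (by norm_num)).trans ?_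
      norm_num [Finset.sum_range_succ, Nat.factorial]
    rw [show (2 * (0.8767 + 1 / 10 ^ 5) - 0.3 : ℝ) = 1 + 0.45342 by norm_num, exp_add]
    calc exp 1 * exp 0.45342 ≤ 2.7182818286 * 1.57369 := by
          gcongr
          exact exp_one_lt_d9.le
      _ ≤ 4.278 := by norm_num
  exact neg_log_pK_sqrt_ge_pade (lo := 1.106265) (hi := 1.106266) (by norm_num) (by norm_num)
    (le_trans (by norm_num) hlo) (hhi.trans (by norm_num)) (by norm_num) (by norm_num) (by norm_num)
    (le_neg_log_pK_sqrt (by norm_num) (hhi.trans (by norm_num : _ ≤ (1.106266 : ℝ))) hE (by norm_num))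
    h1 h2

lemma neg_log_pK_sqrt_ge_near_seven_tenths {c : ℝ} (h1 : 0.7 ≤ 2 * c) (h2 : c ≤ 2 * 0.7) :
    0.5154 - 0.39384 * ((c - 0.7) * (c + 5 * 0.7) / (0.7 * (4 * c + 2 * 0.7))) ≤
      -log (pK √c) := by
  have hlo := sum_le_massRatio (c := 0.7) (by norm_num)
  have hhi := massRatio_le_sum (c := 0.7) (by norm_num) (by norm_num)
  have hE : exp (2 * (0.5154 + 1 / 10 ^ 5) - 0.7) ≤ 1.392111 := by
    refine (Real.exp_bound' (by norm_num) (by norm_num) (n := 6) (by norm_num)).trans ?_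
    norm_num [Finset.sum_range_succ, Nat.factorial]
  exact neg_log_pK_sqrt_ge_pade (lo := 1.269537) (hi := 1.269538) (by norm_num) (by norm_num)
    (le_trans (by norm_num) hlo) (hhi.trans (by norm_num)) (by norm_num) (by norm_num) (by norm_num)
    (le_neg_log_pK_sqrt (by norm_num) (hhi.trans (by norm_num : _ ≤ (1.269538 : ℝ))) hE (by norm_num)) h1 h2

lemma neg_log_pK_sqrt_ge_near_six_fifths {c : ℝ} (h1 : 1.2 ≤ 2 * c) (h2 : c ≤ 2 * 1.2) :
    0.3192 - 0.33005 * ((c - 1.2) * (c + 5 * 1.2) / (1.2 * (4 * c + 2 * 1.2))) ≤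
      -log (pK √c) := by
  have hlo := sum_le_massRatio (c := 1.2) (by norm_num)
  have hhi := massRatio_le_sum (c := 1.2) (by norm_num) (by norm_num)
  have hE : exp (2 * (0.3192 + 1 / 10 ^ 5) - 1.2) ≤ 0.570309 := by
    rw [show (2 * (0.3192 + 1 / 10 ^ 5) - 1.2 : ℝ) = -0.56158 by norm_num]
    refine (exp_neg_le_inv_sum (by norm_num)).trans ?_
    norm_num [Finset.sum_range_succ, Nat.factorial]
  exact neg_log_pK_sqrt_ge_pade (lo := 1.514914) (hi := 1.514915) (by norm_num) (by norm_num)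
    (le_trans (by norm_num) hlo) (hhi.trans (by norm_num)) (by norm_num) (by norm_num) (by norm_num)
    (le_neg_log_pK_sqrt (by norm_num) (hhi.trans (by norm_num : _ ≤ (1.514915 : ℝ))) hE (by norm_num)) h1 h2

lemma neg_log_pK_sqrt_ge_near_eight_fifths {c : ℝ} (h1 : 1.6 ≤ 2 * c) (h2 : c ≤ 2 * 1.6) :
    0.2305 - 0.28554 * ((c - 1.6) * (c + 5 * 1.6) / (1.6 * (4 * c + 2 * 1.6))) ≤
      -log (pK √c) := by
  have hlo := sum_le_massRatio (c := 1.6) (by norm_num)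
  have hhi := massRatio_le_sum (c := 1.6) (by norm_num) (by norm_num)
  have hE : exp (2 * (0.2305 + 1 / 10 ^ 5) - 1.6) ≤ 0.320147 := by
    rw [show (2 * (0.2305 + 1 / 10 ^ 5) - 1.6 : ℝ) = -1.13898 by norm_num]
    refine (exp_neg_le_inv_sum (by norm_num)).trans ?_
    norm_num [Finset.sum_range_succ, Nat.factorial]
  exact neg_log_pK_sqrt_ge_pade (lo := 1.75109) (hi := 1.751093) (by norm_num) (by norm_num)
    (le_trans (by norm_num) hlo) (hhi.trans (by norm_num)) (by norm_num) (by norm_num) (by norm_num)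
    (le_neg_log_pK_sqrt (by norm_num) (hhi.trans (by norm_num : _ ≤ (1.751093 : ℝ))) hE (by norm_num)) h1 h2

lemma neg_log_pK_sqrt_ge_near_two {c : ℝ} (h1 : 2 ≤ 2 * c) (h2 : c ≤ 2 * 2) :
    0.1711 - 0.2463 * ((c - 2) * (c + 5 * 2) / (2 * (4 * c + 2 * 2))) ≤
      -log (pK √c) := by
  have hlo := sum_le_massRatio (c := 2) (by norm_num)
  have hhi := massRatio_le_sum (c := 2) (by norm_num) (by norm_num)
  have hE : exp (2 * (0.1711 + 1 / 10 ^ 5) - 2) ≤ 0.190563 := by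
    rw [show (2 * (0.1711 + 1 / 10 ^ 5) - 2 : ℝ) = -1.65778 by norm_num]
    refine (exp_neg_le_inv_sum (by norm_num)).trans ?_
    norm_num [Finset.sum_range_succ, Nat.factorial]
  exact neg_log_pK_sqrt_ge_pade (lo := 2.03007) (hi := 2.03008) (by norm_num) (by norm_num)
    (le_trans (by norm_num) hlo) (hhi.trans (by norm_num)) (by norm_num) (by norm_num) (by norm_num)
    (le_neg_log_pK_sqrt (by norm_num) (hhi.trans (by norm_num : _ ≤ (2.03008 : ℝ))) hE (by norm_num)) h1 h2

lemma neg_log_pK_sqrt_ge_near_twelve_fifths {c : ℝ} (h1 : 2.4 ≤ 2 * c) (h2 : c ≤ 2 * 2.4) :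
    0.1293 - 0.21186 * ((c - 2.4) * (c + 5 * 2.4) / (2.4 * (4 * c + 2 * 2.4))) ≤
      -log (pK √c) := by
  have hlo := sum_le_massRatio (c := 2.4) (by norm_num)
  have hhi := massRatio_le_sum (c := 2.4) (by norm_num) (by norm_num)
  have hE : exp (2 * (0.1293 + 1 / 10 ^ 5) - 2.4) ≤ 0.117494 := by
    rw [show (2 * (0.1293 + 1 / 10 ^ 5) - 2.4 : ℝ) = -2.14138 by norm_num]
    refine (exp_neg_le_inv_sum (by norm_num)).trans ?_
    norm_num [Finset.sum_range_succ, Nat.factorial]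
  exact neg_log_pK_sqrt_ge_pade (lo := 2.360066) (hi := 2.360105) (by norm_num) (by norm_num)
    (le_trans (by norm_num) hlo) (hhi.trans (by norm_num)) (by norm_num) (by norm_num) (by norm_num)
    (le_neg_log_pK_sqrt (by norm_num) (hhi.trans (by norm_num : _ ≤ (2.360105 : ℝ))) hE (by norm_num)) h1 h2

lemma neg_log_pK_sqrt_ge_near_twenty_nine_tenths {c : ℝ} (h1 : 2.9 ≤ 2 * c) (h2 : c ≤ 2 * 2.9) :
    0.0927 - 0.17485 * ((c - 2.9) * (c + 5 * 2.9) / (2.9 * (4 * c + 2 * 2.9))) ≤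
      -log (pK √c) := by
  have hlo := sum_le_massRatio (c := 2.9) (by norm_num)
  have hhi := massRatio_le_sum (c := 2.9) (by norm_num) (by norm_num)
  have hE : exp (2 * (0.0927 + 1 / 10 ^ 5) - 2.9) ≤ 0.066234 := by
    rw [show (2 * (0.0927 + 1 / 10 ^ 5) - 2.9 : ℝ) = -2.71458 by norm_num]
    refine (exp_neg_le_inv_sum (by norm_num)).trans ?_
    norm_num [Finset.sum_range_succ, Nat.factorial]
  exact neg_log_pK_sqrt_ge_pade (lo := 2.859438) (hi := 2.859615) (by norm_num) (by norm_num)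
    (le_trans (by norm_num) hlo) (hhi.trans (by norm_num)) (by norm_num) (by norm_num) (by norm_num)
    (le_neg_log_pK_sqrt (by norm_num) (hhi.trans (by norm_num : _ ≤ (2.859615 : ℝ))) hE (by norm_num)) h1 h2

/-! ### Rational bounds on intervals of `c` -/

/-- The parametrization of `[lo, hi)` by `u ∈ [0, ∞)`. A polynomial in `c` whose Bernstein
coefficients on `[lo, hi]` are positive has positive coefficients as a rational function of `u`. -/
lemma exists_nonneg_eq_div {lo hi c : ℝ} (h1 : lo ≤ c) (h2 : c < hi) :
    ∃ u : ℝ, 0 ≤ u ∧ c = (lo + hi * u) / (1 + u) := by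
  have : 0 < hi - c := by linarith
  refine ⟨(c - lo) / (hi - c), div_nonneg (by linarith) this.le, ?_⟩
  have e : 1 + (c - lo) / (hi - c) = (hi - lo) / (hi - c) := by field_simp; ring
  have : 0 < hi - lo := by linarith
  rw [e]
  field_simp
  ring

lemma exp_le_cubic {z : ℝ} (h0 : 0 ≤ z) (h1 : z ≤ 1) :
    exp z ≤ 1 + z + z ^ 2 / 2 + 9 / 40 * z ^ 3 := by
  have h := Real.exp_bound' h0 h1 (n := 4) (by norm_num)
  norm_num [Finset.sum_range_succ, Nat.factorial] at h
  nlinarith [pow_nonneg h0 3, mul_nonneg (pow_nonneg h0 3) (sub_nonneg.2 h1)]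

lemma div_le_invDensity_sqrt {c Lh : ℝ} (hc : 0 < c) (hL : Lh ≤ -log (pK √c)) :
    Lh / 0.69315 ≤ invDensity √c := by
  have h2 := log_pK_neg (Real.sqrt_pos.2 hc)
  have h3 := log_pos one_lt_two
  have h4 := log_two_lt_d9
  rw [invDensity, div_le_div_iff₀ (by norm_num) h3]
  rcases le_total Lh 0 with h | h
  · nlinarith
  · calc Lh * log 2 ≤ -log (pK √c) * 0.69315 := by
          gcongr
          · linarith
          · linarith
      _ = _ := rfl

lemma le_sq_massRatio_mul_invDensity {c S Lh B : ℝ} (hc : 0 < c) (hS0 : 0 ≤ S)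
    (hS : S ≤ massRatio c) (hL : Lh ≤ -log (pK √c)) (h1 : B ≤ S ^ 2 * (Lh / 0.69315)) :
    B ≤ massRatio c ^ 2 * invDensity √c := by
  have ha := invDensity_pos (Real.sqrt_pos.2 hc)
  calc B ≤ S ^ 2 * (Lh / 0.69315) := h1
    _ ≤ S ^ 2 * invDensity √c := by gcongr; exact div_le_invDensity_sqrt hc hL
    _ ≤ _ := by gcongr

/-- The comparison of exponentials in the differential inequality, reduced to inequalities between
rational functions: `S` bounds the mass ratio and `Lh / 0.69315` bounds `invDensity √c`. -/
lemma exp_mul_le_of_rational_bounds {c S Lh w ι₀ : ℝ} (hc : 0 < c) (hS0 : 0 ≤ S)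
    (hS : S ≤ massRatio c) (hL : Lh ≤ -log (pK √c))
    (h1 : 1 ≤ 0.998 * S ^ 2 * (Lh / 0.69315)) (hz : (w - Lh / 0.69315) * ι₀ ≤ 1)
    (hE : 1 + (w - Lh / 0.69315) * ι₀ + ((w - Lh / 0.69315) * ι₀) ^ 2 / 2 +
      9 / 40 * ((w - Lh / 0.69315) * ι₀) ^ 3 ≤ 0.998 * S ^ 2 * (Lh / 0.69315))
    {ι : ℝ} (hι0 : 0 ≤ ι) (hι : ι ≤ ι₀) :
    exp (w * ι) ≤ 0.998 * (massRatio c ^ 2 * invDensity √c) * exp (invDensity √c * ι) := by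
  have hA := div_le_invDensity_sqrt hc hL
  have hM := le_sq_massRatio_mul_invDensity hc hS0 hS hL le_rfl
  set a := invDensity √c with ha
  set A := Lh / 0.69315 with hA'
  have key : exp ((w - a) * ι) ≤ 0.998 * (massRatio c ^ 2 * a) := by
    rcases le_total w a with h | h
    · have : exp ((w - a) * ι) ≤ 1 := exp_le_one_iff.2 (mul_nonpos_of_nonpos_of_nonneg
        (by linarith) hι0)
      linarith
    · have h2 : (w - a) * ι ≤ (w - A) * ι₀ := by
        have : 0 ≤ w - a := by linarith
        have : 0 ≤ w - A := by linarith
        gcongr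
      have h3 : 0 ≤ (w - A) * ι₀ := mul_nonneg (by linarith) (hι0.trans hι)
      have h4 := exp_le_exp.2 h2
      have h5 := exp_le_cubic h3 hz
      linarith
  calc exp (w * ι) = exp ((w - a) * ι) * exp (a * ι) := by rw [← exp_add]; congr 1; ring
    _ ≤ _ := by gcongr

lemma partial_sum_two_le_massRatio {c : ℝ} (hc : 0 < c) :
    1 + c / 3 + c ^ 2 / 15 ≤ massRatio c := by
  refine le_trans ?_ (sum_le_massRatio hc)
  have : 0 ≤ c ^ 3 / 105 + c ^ 4 / 945 + c ^ 5 / 10395 + c ^ 6 / 135135 + c ^ 7 / 2027025 := by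
    positivity
  linarith

lemma partial_sum_three_le_massRatio {c : ℝ} (hc : 0 < c) :
    1 + c / 3 + c ^ 2 / 15 + c ^ 3 / 105 ≤ massRatio c := by
  refine le_trans ?_ (sum_le_massRatio hc)
  have : 0 ≤ c ^ 4 / 945 + c ^ 5 / 10395 + c ^ 6 / 135135 + c ^ 7 / 2027025 := by
    positivity
  linarith

lemma partial_sum_four_le_massRatio {c : ℝ} (hc : 0 < c) :
    1 + c / 3 + c ^ 2 / 15 + c ^ 3 / 105 + c ^ 4 / 945 ≤ massRatio c := by
  refine le_trans ?_ (sum_le_massRatio hc)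
  have : 0 ≤ c ^ 5 / 10395 + c ^ 6 / 135135 + c ^ 7 / 2027025 := by positivity
  linarith

lemma partial_sum_five_le_massRatio {c : ℝ} (hc : 0 < c) :
    1 + c / 3 + c ^ 2 / 15 + c ^ 3 / 105 + c ^ 4 / 945 + c ^ 5 / 10395 ≤ massRatio c := by
  refine le_trans ?_ (sum_le_massRatio hc)
  have : 0 ≤ c ^ 6 / 135135 + c ^ 7 / 2027025 := by positivity
  linarith

lemma partial_sum_six_le_massRatio {c : ℝ} (hc : 0 < c) :
    1 + c / 3 + c ^ 2 / 15 + c ^ 3 / 105 + c ^ 4 / 945 + c ^ 5 / 10395 + c ^ 6 / 135135 ≤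
      massRatio c := by
  refine le_trans ?_ (sum_le_massRatio hc)
  have : 0 ≤ c ^ 7 / 2027025 := by positivity
  linarith

/-- The exponent interpolates linearly between `2.81` at `c = 0.23` and `1.83` at `c = 0.4`, the
values for which `SlopeBound` is established. The other intervals follow the same pattern. -/
lemma exp_chord_le_of_lt_two_fifths {c ι : ℝ} (h1 : 0.23 ≤ c) (h2 : c < 0.4) (hι0 : 0 ≤ ι)
    (hι : ι ≤ 0.3681) : exp ((2.81 + (1.83 - 2.81) * ((c - 0.23) / (0.4 - 0.23))) * ι) ≤
      0.998 * (massRatio c ^ 2 * invDensity √c) * exp (invDensity √c * ι) := by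
  have hc : 0 < c := by linarith
  have hS := partial_sum_two_le_massRatio hc
  refine exp_mul_le_of_rational_bounds hc (by positivity) hS
    (neg_log_pK_sqrt_ge_near_three_tenths (by linarith) (by linarith)) ?_ ?_ ?_ hι0 hι
  all_goals
    obtain ⟨u, hu, e⟩ := exists_nonneg_eq_div h1 h2
    clear hS hc h1 h2
    subst e
    rw [← sub_nonneg]
    field_simp
    ring_nf
    positivity

lemma exp_chord_le_of_lt_four_fifths {c ι : ℝ} (h1 : 0.4 ≤ c) (h2 : c < 0.8) (hι0 : 0 ≤ ι)
    (hι : ι ≤ 0.3681) : exp ((1.83 + (0.97 - 1.83) * ((c - 0.4) / (0.8 - 0.4))) * ι) ≤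
      0.998 * (massRatio c ^ 2 * invDensity √c) * exp (invDensity √c * ι) := by
  have hc : 0 < c := by linarith
  have hS := partial_sum_three_le_massRatio hc
  refine exp_mul_le_of_rational_bounds hc (by positivity) hS
    (neg_log_pK_sqrt_ge_near_seven_tenths (by linarith) (by linarith)) ?_ ?_ ?_ hι0 hι
  all_goals
    obtain ⟨u, hu, e⟩ := exists_nonneg_eq_div h1 h2
    clear hS hc h1 h2
    subst e
    rw [← sub_nonneg]
    field_simp
    ring_nf
    positivity

lemma exp_chord_le_of_lt_one {c ι : ℝ} (h1 : 0.8 ≤ c) (h2 : c < 1) (hι0 : 0 ≤ ι)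
    (hι : ι ≤ 0.3681) : exp ((0.97 + (0.69 - 0.97) * ((c - 0.8) / (1 - 0.8))) * ι) ≤
      0.998 * (massRatio c ^ 2 * invDensity √c) * exp (invDensity √c * ι) := by
  have hc : 0 < c := by linarith
  have hS := partial_sum_three_le_massRatio hc
  refine exp_mul_le_of_rational_bounds hc (by positivity) hS
    (neg_log_pK_sqrt_ge_near_seven_tenths (by linarith) (by linarith)) ?_ ?_ ?_ hι0 hι
  all_goals
    obtain ⟨u, hu, e⟩ := exists_nonneg_eq_div h1 h2
    clear hS hc h1 h2
    subst e
    rw [← sub_nonneg]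
    field_simp
    ring_nf
    positivity

lemma exp_chord_le_of_lt_seven_fifths {c ι : ℝ} (h1 : 1 ≤ c) (h2 : c < 1.4) (hι0 : 0 ≤ ι)
    (hι : ι ≤ 0.2705) : exp ((0.69 + (0 - 0.69) * ((c - 1) / (1.8 - 1))) * ι) ≤
      0.998 * (massRatio c ^ 2 * invDensity √c) * exp (invDensity √c * ι) := by
  have hc : 0 < c := by linarith
  have hS := partial_sum_four_le_massRatio hc
  refine exp_mul_le_of_rational_bounds hc (by positivity) hS
    (neg_log_pK_sqrt_ge_near_six_fifths (by linarith) (by linarith)) ?_ ?_ ?_ hι0 hι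
  all_goals
    obtain ⟨u, hu, e⟩ := exists_nonneg_eq_div h1 h2
    clear hS hc h1 h2
    subst e
    rw [← sub_nonneg]
    field_simp
    ring_nf
    positivity

lemma exp_chord_le_of_lt_nine_fifths {c ι : ℝ} (h1 : 1.4 ≤ c) (h2 : c < 1.8) (hι0 : 0 ≤ ι)
    (hι : ι ≤ 0.2705) : exp ((0.69 + (0 - 0.69) * ((c - 1) / (1.8 - 1))) * ι) ≤
      0.998 * (massRatio c ^ 2 * invDensity √c) * exp (invDensity √c * ι) := by
  have hc : 0 < c := by linarith
  have hS := partial_sum_five_le_massRatio hc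
  refine exp_mul_le_of_rational_bounds hc (by positivity) hS
    (neg_log_pK_sqrt_ge_near_eight_fifths (by linarith) (by linarith)) ?_ ?_ ?_ hι0 hι
  all_goals
    obtain ⟨u, hu, e⟩ := exists_nonneg_eq_div h1 h2
    clear hS hc h1 h2
    subst e
    rw [← sub_nonneg]
    field_simp
    ring_nf
    positivity

lemma exp_chord_le_of_lt_twentyone_tenths {c ι : ℝ} (h1 : 1.8 ≤ c) (h2 : c < 2.1) (hι0 : 0 ≤ ι)
    (hι : ι ≤ 0.2705) : exp ((0 + (0.3 - 0) * ((c - 1.8) / (2.65 - 1.8))) * ι) ≤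
      0.998 * (massRatio c ^ 2 * invDensity √c) * exp (invDensity √c * ι) := by
  have hc : 0 < c := by linarith
  have hS := partial_sum_five_le_massRatio hc
  refine exp_mul_le_of_rational_bounds hc (by positivity) hS
    (neg_log_pK_sqrt_ge_near_two (by linarith) (by linarith)) ?_ ?_ ?_ hι0 hι
  all_goals
    obtain ⟨u, hu, e⟩ := exists_nonneg_eq_div h1 h2
    clear hS hc h1 h2
    subst e
    rw [← sub_nonneg]
    field_simp
    ring_nf
    positivity

lemma exp_chord_le_of_lt_fiftythree_twentieths {c ι : ℝ} (h1 : 2.1 ≤ c) (h2 : c < 2.65)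
    (hι0 : 0 ≤ ι) (hι : ι ≤ 0.2705) :
    exp ((0 + (0.3 - 0) * ((c - 1.8) / (2.65 - 1.8))) * ι) ≤
      0.998 * (massRatio c ^ 2 * invDensity √c) * exp (invDensity √c * ι) := by
  have hc : 0 < c := by linarith
  have hS := partial_sum_five_le_massRatio hc
  refine exp_mul_le_of_rational_bounds hc (by positivity) hS
    (neg_log_pK_sqrt_ge_near_twelve_fifths (by linarith) (by linarith)) ?_ ?_ ?_ hι0 hι
  all_goals
    obtain ⟨u, hu, e⟩ := exists_nonneg_eq_div h1 h2
    clear hS hc h1 h2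
    subst e
    rw [← sub_nonneg]
    field_simp
    ring_nf
    positivity

lemma sq_massRatio_mul_invDensity_ge_of_lt {c : ℝ} (h1 : 2.65 ≤ c) (h2 : c < 3.2) :
    1.05 ≤ massRatio c ^ 2 * invDensity √c := by
  have hc : 0 < c := by linarith
  have hS := partial_sum_six_le_massRatio hc
  refine le_sq_massRatio_mul_invDensity hc (by positivity) hS
    (neg_log_pK_sqrt_ge_near_twenty_nine_tenths (by linarith) (by linarith)) ?_
  obtain ⟨u, hu, e⟩ := exists_nonneg_eq_div h1 h2
  clear hS hc h1 h2
  subst e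
  rw [← sub_nonneg]
  field_simp
  ring_nf
  positivity

/-! ### Hyperbolic functions -/

lemma sinh_le_mul_exp {x : ℝ} (hx : 0 ≤ x) : sinh x ≤ x * exp (x ^ 2 / 6) := by
  have h1 := Real.hasSum_sinh x
  have h2 : HasSum (fun n : ℕ => x * ((x ^ 2 / 6) ^ n / (n.factorial : ℝ))) (x * exp (x ^ 2 / 6)) := by
    have := NormedSpace.expSeries_div_hasSum_exp (x ^ 2 / 6)
    rw [← Real.exp_eq_exp_ℝ] at this
    exact this.mul_left x
  refine hasSum_le (fun n => ?_) h1 h2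
  have h3 : (6 : ℝ) ^ n * n.factorial ≤ (2 * n + 1).factorial := by
    induction n with
    | zero => simp
    | succ k ih =>
      have e : ((2 * (k + 1) + 1).factorial : ℝ) =
          (2 * k + 3) * (2 * k + 2) * (2 * k + 1).factorial := by
        rw [show 2 * (k + 1) + 1 = (2 * k + 1) + 1 + 1 by ring, Nat.factorial_succ,
          Nat.factorial_succ]
        push_cast; ring
      rw [e, pow_succ, Nat.factorial_succ]
      push_cast
      calc (6 : ℝ) ^ k * 6 * ((k + 1) * k.factorial) = 6 * (k + 1) * (6 ^ k * k.factorial) := by ring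
        _ ≤ (2 * k + 3) * (2 * k + 2) * (2 * k + 1).factorial := by
          have h6 : (6 : ℝ) * (k + 1) ≤ (2 * k + 3) * (2 * k + 2) := by
            nlinarith [(Nat.cast_nonneg k : (0 : ℝ) ≤ k)]
          exact mul_le_mul h6 ih (by positivity) (by positivity)
  have h4 : x * ((x ^ 2 / 6) ^ n / (n.factorial : ℝ)) = x ^ (2 * n + 1) / (6 ^ n * n.factorial) := by
    rw [div_pow, ← pow_mul, pow_succ]; field_simp
  rw [h4]
  gcongr

/-- An upper bound for `x * coth x`, a convergent of Lambert's continued fraction. -/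
noncomputable def lambertBound (x : ℝ) : ℝ := (105 + 45 * x ^ 2 + x ^ 4) / (105 + 10 * x ^ 2)

lemma sinh_le_mul_cosh {x : ℝ} (hx : 0 ≤ x) : sinh x ≤ x * cosh x := by
  have := nonneg_of_hasDerivAt_nonneg (f := fun x => x * cosh x - sinh x)
    (f' := fun x => x * sinh x) (b := x) (by fun_prop) (fun z _ _ => by
      refine (((hasDerivAt_id z).mul (hasDerivAt_cosh z)).sub (hasDerivAt_sinh z)).congr_deriv ?_
      simp) (fun z hz _ => mul_nonneg hz.le (sinh_nonneg_iff.2 hz.le)) (by simp) hx le_rfl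
  linarith

lemma mul_cosh_le_sq_mul_sinh {x : ℝ} (hx : 0 ≤ x) : 3 * x * cosh x ≤ (3 + x ^ 2) * sinh x := by
  have := nonneg_of_hasDerivAt_nonneg (f := fun x => (3 + x ^ 2) * sinh x - 3 * x * cosh x)
    (f' := fun x => x * (x * cosh x - sinh x)) (b := x) (by fun_prop) (fun z _ _ => by
      refine ((((hasDerivAt_pow 2 z).const_add 3).mul (hasDerivAt_sinh z)).sub
        (((hasDerivAt_id z).const_mul 3).mul (hasDerivAt_cosh z))).congr_deriv ?_
      simp only [id]; ring) (fun z hz _ => mul_nonneg hz.le (by linarith [sinh_le_mul_cosh hz.le]))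
      (by simp) hx le_rfl
  linarith

lemma mul_sinh_le_mul_cosh {x : ℝ} (hx : 0 ≤ x) :
    (15 + 6 * x ^ 2) * sinh x ≤ (15 * x + x ^ 3) * cosh x := by
  have := nonneg_of_hasDerivAt_nonneg
    (f := fun x => (15 * x + x ^ 3) * cosh x - (15 + 6 * x ^ 2) * sinh x)
    (f' := fun x => x * ((3 + x ^ 2) * sinh x - 3 * x * cosh x)) (b := x) (by fun_prop)
    (fun z _ _ => by
      refine ((((hasDerivAt_id z).const_mul 15).add (hasDerivAt_pow 3 z)).mul
        (hasDerivAt_cosh z) |>.sub ((((hasDerivAt_pow 2 z).const_mul 6).const_add 15).mul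
        (hasDerivAt_sinh z))).congr_deriv ?_
      simp only [id, Pi.add_apply]; ring)
      (fun z hz _ => mul_nonneg hz.le (by linarith [mul_cosh_le_sq_mul_sinh hz.le]))
      (by simp) hx le_rfl
  linarith

lemma mul_cosh_le_lambertBound_mul_sinh {x : ℝ} (hx : 0 ≤ x) :
    x * cosh x ≤ lambertBound x * sinh x := by
  have := nonneg_of_hasDerivAt_nonneg
    (f := fun x => (105 + 45 * x ^ 2 + x ^ 4) * sinh x - (105 * x + 10 * x ^ 3) * cosh x)
    (f' := fun x => x * ((15 * x + x ^ 3) * cosh x - (15 + 6 * x ^ 2) * sinh x)) (b := x)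
    (by fun_prop)
    (fun z _ _ => by
      refine (((((hasDerivAt_pow 2 z).const_mul 45).const_add 105).add (hasDerivAt_pow 4 z)).mul
        (hasDerivAt_sinh z) |>.sub ((((hasDerivAt_id z).const_mul 105).add
        ((hasDerivAt_pow 3 z).const_mul 10)).mul (hasDerivAt_cosh z))).congr_deriv ?_
      simp only [id, Pi.add_apply]; ring)
      (fun z hz _ => mul_nonneg hz.le (by linarith [mul_sinh_le_mul_cosh hz.le]))
      (by simp) hx le_rfl
  rw [lambertBound, div_mul_eq_mul_div, le_div_iff₀ (by positivity)]
  linarith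

lemma convexOn_lambertBound : ConvexOn ℝ univ lambertBound := by
  have e : lambertBound = fun x => x ^ 2 / 10 + 69 / 20 - 1029 / 40 / (x ^ 2 + 21 / 2) := by
    ext x
    have h1 : 105 + 10 * x ^ 2 ≠ 0 := by positivity
    have h2 : x ^ 2 + 21 / 2 ≠ 0 := by positivity
    rw [lambertBound]
    field_simp
    ring
  have hd1 : ∀ x, HasDerivAt lambertBound (x / 5 + 1029 / 20 * (x / (x ^ 2 + 21 / 2) ^ 2)) x := by
    intro x
    rw [e]
    have h2 : x ^ 2 + 21 / 2 ≠ 0 := by positivity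
    refine ((((hasDerivAt_pow 2 x).div_const 10).add_const (69 / 20)).sub
      ((hasDerivAt_const x (1029 / 40 : ℝ)).div ((hasDerivAt_pow 2 x).add_const (21 / 2)) h2)).congr_deriv ?_
    field_simp
    ring
  have hd2 : ∀ x : ℝ, HasDerivAt (fun x : ℝ => x / 5 + 1029 / 20 * (x / (x ^ 2 + 21 / 2) ^ 2))
      (1 / 5 + 1029 / 20 * ((21 / 2 - 3 * x ^ 2) / (x ^ 2 + 21 / 2) ^ 3)) x := by
    intro x
    have h2 : x ^ 2 + 21 / 2 ≠ 0 := by positivity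
    refine (((hasDerivAt_id x).div_const 5).add (((hasDerivAt_id x).div
      (((hasDerivAt_pow 2 x).add_const (21 / 2)).pow 2) (pow_ne_zero 2 h2)).const_mul
      (1029 / 20))).congr_deriv ?_
    simp only [id, Pi.pow_apply]
    field_simp
    ring
  have hderiv : deriv lambertBound =
      fun x : ℝ => x / 5 + 1029 / 20 * (x / (x ^ 2 + 21 / 2) ^ 2) := by
    ext x; exact (hd1 x).deriv
  refine convexOn_univ_of_deriv2_nonneg (fun x => (hd1 x).differentiableAt) ?_ ?_
  · rw [hderiv]; exact fun x => (hd2 x).differentiableAt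
  · intro x
    rw [Function.iterate_succ, Function.iterate_one, Function.comp, hderiv, (hd2 x).deriv]
    have h3 : -(1 / 300) ≤ (21 / 2 - 3 * x ^ 2) / (x ^ 2 + 21 / 2) ^ 3 := by
      rw [le_div_iff₀ (by positivity)]
      have := sq_nonneg x
      nlinarith [mul_nonneg this (sq_nonneg (x ^ 2 - 21)), sq_nonneg (x ^ 2 - 21),
        pow_nonneg this 3]
    linarith

/-! ### Polynomial bounds for the inverse hyperbolic tangent -/

/-- The Taylor polynomial of `ρ / artanh ρ`, with a last coefficient that makes it an upper bound for
`ρ ≤ 4 / 5`. -/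
lemma halfLogOdds_mul_le {ρ : ℝ} (h0 : 0 ≤ ρ) (h1 : ρ ≤ 4 / 5) :
    halfLogOdds ρ * (1 - ρ ^ 2 / 3 - 4 / 45 * ρ ^ 4 - 0.095 * ρ ^ 6) ≤ ρ := by
  have ht : ρ ^ 2 ≤ 16 / 25 := by nlinarith
  have h2 : 0 < 1 - ρ ^ 2 := by linarith
  have hs := halfLogOdds_le_sum h0 (by linarith)
  have hpos : 0 ≤ 1 - ρ ^ 2 / 3 - 4 / 45 * ρ ^ 4 - 0.095 * ρ ^ 6 := by
    nlinarith [pow_nonneg h0 4, pow_nonneg h0 6, mul_nonneg (sq_nonneg ρ) (sub_nonneg.2 ht),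
      mul_nonneg (pow_nonneg h0 4) (sub_nonneg.2 ht)]
  refine (mul_le_mul_of_nonneg_right hs hpos).trans ?_
  rw [mul_assoc]
  refine mul_le_of_le_one_right h0 ?_
  have hu : 0 ≤ ρ ^ 2 := sq_nonneg ρ
  rw [show ρ ^ 4 = (ρ ^ 2) ^ 2 by ring, show ρ ^ 6 = (ρ ^ 2) ^ 3 by ring,
    show ρ ^ 8 = (ρ ^ 2) ^ 4 by ring, show ρ ^ 10 = (ρ ^ 2) ^ 5 by ring]
  generalize ρ ^ 2 = t at *
  obtain ⟨u, hu', rfl⟩ := exists_nonneg_eq_div hu (show t < 0.6401 by norm_num; linarith)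
  rw [← sub_nonneg]
  have h5 : 0 < 1 + u - 0.6401 * u := by norm_num; linarith
  have : 1 - (0 + 0.6401 * u) / (1 + u) = (1 + u - 0.6401 * u) / (1 + u) := by field_simp; ring
  rw [this]
  field_simp
  ring_nf
  positivity

/-- The Taylor polynomial of `(1 - ρ ^ 2) artanh ρ`, with a last coefficient that makes it a lower
bound for `ρ ≤ 4 / 5`. -/
lemma le_halfLogOdds_mul {ρ : ℝ} (h0 : 0 ≤ ρ) (h1 : ρ ≤ 4 / 5) :
    ρ * (1 - 2 / 3 * ρ ^ 2 - 2 / 15 * ρ ^ 4 - 0.106 * ρ ^ 6) ≤ halfLogOdds ρ * (1 - ρ ^ 2) := by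
  have ht : ρ ^ 2 ≤ 16 / 25 := by nlinarith
  have h2 : 0 < 1 - ρ ^ 2 := by linarith
  rw [← div_le_iff₀ h2]
  have := nonneg_of_hasDerivAt_nonneg (b := 4 / 5)
    (f := fun ρ => halfLogOdds ρ -
      ρ * (1 - 2 / 3 * ρ ^ 2 - 2 / 15 * ρ ^ 4 - 0.106 * ρ ^ 6) / (1 - ρ ^ 2))
    (f' := fun ρ => ρ ^ 6 * (0.342 - 0.53 * ρ ^ 2) / (1 - ρ ^ 2) ^ 2) ?_ ?_ ?_ (by simp) h0 h1
  · linarith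
  · intro x hx
    have hx2 : 1 - x ^ 2 ≠ 0 := by nlinarith [hx.1, hx.2]
    have hc : ContinuousAt (fun ρ : ℝ =>
        ρ * (1 - 2 / 3 * ρ ^ 2 - 2 / 15 * ρ ^ 4 - 0.106 * ρ ^ 6) / (1 - ρ ^ 2)) x :=
      ContinuousAt.div (by fun_prop) (by fun_prop) hx2
    exact ((hasDerivAt_halfLogOdds (ρ := x) (by linarith [hx.1])
      (by linarith [hx.2])).continuousAt.sub hc).continuousWithinAt
  · intro x hx hx'
    have hx2 : 1 - x ^ 2 ≠ 0 := by nlinarith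
    refine ((hasDerivAt_halfLogOdds (by linarith) (by linarith)).sub
      (((hasDerivAt_id x).mul (((((hasDerivAt_pow 2 x).const_mul (2 / 3)).const_sub 1).sub
        ((hasDerivAt_pow 4 x).const_mul (2 / 15))).sub ((hasDerivAt_pow 6 x).const_mul 0.106))).div
        ((hasDerivAt_pow 2 x).const_sub 1) hx2)).congr_deriv ?_
    simp only [id, Pi.mul_apply, Pi.sub_apply]
    field_simp
    ring
  · intro x hx hx'
    have : 0 ≤ 0.342 - 0.53 * x ^ 2 := by norm_num; nlinarith
    have := pow_pos hx 6
    positivity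

/-! ### The differential inequality in the middle range -/

/-- A rational inequality in `ρ` which says that the derivative of
`log (exp (-c ρ² / (1 - ρ²)) sinh (c ρ / (1 - ρ²)) / (c √(1 - ρ²) artanh ρ))` with respect to the
entropy defect is at most `w`; `x coth x` and `artanh ρ` are replaced by their rational bounds. -/
def SlopeBound (c w ρ : ℝ) : Prop :=
  ρ ^ 2 - (1 - ρ ^ 2 / 3 - 4 / 45 * ρ ^ 4 - 0.095 * ρ ^ 6) - 2 * c * ρ ^ 2 / (1 - ρ ^ 2) +
    (1 + ρ ^ 2) * lambertBound (c * (ρ / (1 - ρ ^ 2))) ≤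
  w * (ρ ^ 2 * (1 - 2 / 3 * ρ ^ 2 - 2 / 15 * ρ ^ 4 - 0.106 * ρ ^ 6))

/-- By convexity in `c`, the slope bound passes to chords. -/
lemma SlopeBound.chord {c₁ c₂ w₁ w₂ ρ : ℝ} (h1 : SlopeBound c₁ w₁ ρ) (h2 : SlopeBound c₂ w₂ ρ)
    {c : ℝ} (hc1 : c₁ ≤ c) (hc2 : c ≤ c₂) (h : c₁ < c₂) :
    SlopeBound c (w₁ + (w₂ - w₁) * ((c - c₁) / (c₂ - c₁))) ρ := by
  have h12 : 0 < c₂ - c₁ := by linarith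
  set θ := (c - c₁) / (c₂ - c₁) with hθ
  have hθ0 : 0 ≤ θ := div_nonneg (by linarith) h12.le
  have hθ1 : 0 ≤ 1 - θ := by rw [hθ, sub_nonneg, div_le_one h12]; linarith
  have hc : c = (1 - θ) * c₁ + θ * c₂ := by rw [hθ]; field_simp; ring
  unfold SlopeBound at *
  set k := ρ / (1 - ρ ^ 2) with hk
  have hl := convexOn_lambertBound.2 (mem_univ (c₁ * k)) (mem_univ (c₂ * k)) hθ1 hθ0 (by ring)
  simp only [smul_eq_mul] at hl
  have e : (1 - θ) * (c₁ * k) + θ * (c₂ * k) = c * k := by rw [hc]; ring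
  rw [e] at hl
  have h3 := mul_le_mul_of_nonneg_left hl (show 0 ≤ 1 + ρ ^ 2 by positivity)
  have h4 := mul_le_mul_of_nonneg_left h1 hθ1
  have h5 := mul_le_mul_of_nonneg_left h2 hθ0
  have e2 : 2 * c * ρ ^ 2 / (1 - ρ ^ 2) = (1 - θ) * (2 * c₁ * ρ ^ 2 / (1 - ρ ^ 2)) +
      θ * (2 * c₂ * ρ ^ 2 / (1 - ρ ^ 2)) := by rw [hc]; ring
  rw [e2]
  linarith

lemma lambertBound_mul_div {c ρ : ℝ} :
    lambertBound (c * (ρ / (1 - ρ ^ 2))) =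
      (105 + 45 * (c ^ 2 * ρ ^ 2 / (1 - ρ ^ 2) ^ 2) + (c ^ 2 * ρ ^ 2 / (1 - ρ ^ 2) ^ 2) ^ 2) /
        (105 + 10 * (c ^ 2 * ρ ^ 2 / (1 - ρ ^ 2) ^ 2)) := by
  rw [lambertBound]
  have : c ^ 2 * ρ ^ 2 / (1 - ρ ^ 2) ^ 2 = (c * (ρ / (1 - ρ ^ 2))) ^ 2 := by
    rw [← mul_div_assoc, div_pow, mul_pow]
  rw [this, ← pow_mul]

/-- The substitution `ρ ^ 2 = T u / (1 + u)`. -/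
lemma exists_sq_eq_div {T ρ : ℝ} (h1 : ρ ^ 2 < T) :
    ∃ u : ℝ, 0 ≤ u ∧ ρ ^ 2 = T * u / (1 + u) := by
  obtain ⟨u, hu, h⟩ := exists_nonneg_eq_div (sq_nonneg ρ) h1
  exact ⟨u, hu, by rw [h, zero_add]⟩

lemma slopeBound_of_lt_four_fifths {ρ : ℝ} (h0 : 0 ≤ ρ) (h1 : ρ < 4 / 5) :
    SlopeBound 0.23 2.81 ρ ∧ SlopeBound 0.4 1.83 ρ ∧ SlopeBound 0.8 0.97 ρ ∧
      SlopeBound 1 0.69 ρ := by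
  obtain ⟨u, hu, h⟩ := exists_sq_eq_div (show ρ ^ 2 < 16 / 25 by nlinarith)
  have hd : 1 - 16 / 25 * u / (1 + u) = (1 + 9 / 25 * u) / (1 + u) := by field_simp; ring
  refine ⟨?_, ?_, ?_, ?_⟩
  all_goals
    rw [SlopeBound, lambertBound_mul_div, show ρ ^ 4 = (ρ ^ 2) ^ 2 by ring,
      show ρ ^ 6 = (ρ ^ 2) ^ 3 by ring, h, hd, ← sub_nonneg]
    field_simp
    ring_nf
    positivity

lemma slopeBound_of_lt_seven_tenths {ρ : ℝ} (h0 : 0 ≤ ρ) (h1 : ρ < 7 / 10) :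
    SlopeBound 1.8 0 ρ ∧ SlopeBound 2.65 0.3 ρ := by
  obtain ⟨u, hu, h⟩ := exists_sq_eq_div (show ρ ^ 2 < 49 / 100 by nlinarith)
  have hd : 1 - 49 / 100 * u / (1 + u) = (1 + 51 / 100 * u) / (1 + u) := by field_simp; ring
  refine ⟨?_, ?_⟩
  all_goals
    rw [SlopeBound, lambertBound_mul_div, show ρ ^ 4 = (ρ ^ 2) ^ 2 by ring,
      show ρ ^ 6 = (ρ ^ 2) ^ 3 by ring, h, hd, ← sub_nonneg]
    field_simp
    ring_nf
    positivity

/-- The slope bound, integrated from `ρ = 0`. -/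
lemma sinh_le_of_slopeBound {c w ρ₀ : ℝ} (hc : 0 < c) (hw : 0 ≤ w) (hρ₀ : ρ₀ ≤ 4 / 5)
    (h : ∀ ρ, 0 < ρ → ρ < ρ₀ → SlopeBound c w ρ) {ρ : ℝ} (h0 : 0 < ρ) (h1 : ρ < ρ₀) :
    exp (-(c * ρ ^ 2 / (1 - ρ ^ 2))) * sinh (c * ρ / (1 - ρ ^ 2)) ≤
      c * √(1 - ρ ^ 2) * halfLogOdds ρ * exp (w * entropyDefect ρ) := by
  set Φ : ℝ → ℝ := fun z => -(c * z ^ 2 / (1 - z ^ 2)) + log (sinh (c * z / (1 - z ^ 2))) - log c -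
    log (1 - z ^ 2) / 2 - log (halfLogOdds z) - w * entropyDefect z with hΦ
  have hpos : ∀ z, 0 < z → z < ρ₀ → 0 < 1 - z ^ 2 ∧ 0 < c * z / (1 - z ^ 2) ∧
      0 < sinh (c * z / (1 - z ^ 2)) ∧ 0 < halfLogOdds z := by
    intro z hz hz'
    have h2 : 0 < 1 - z ^ 2 := by nlinarith
    have h3 : 0 < c * z / (1 - z ^ 2) := by positivity
    exact ⟨h2, h3, sinh_pos_iff.2 h3, hz.trans_le (le_halfLogOdds hz.le (by linarith))⟩
  have hd : ∀ z, 0 < z → z < ρ₀ → HasDerivAt Φ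
      (-(2 * c * z / (1 - z ^ 2) ^ 2) + c * (1 + z ^ 2) / (1 - z ^ 2) ^ 2 *
        (cosh (c * z / (1 - z ^ 2)) / sinh (c * z / (1 - z ^ 2))) + z / (1 - z ^ 2) -
        1 / ((1 - z ^ 2) * halfLogOdds z) - w * halfLogOdds z) z := by
    intro z hz hz'
    obtain ⟨h2, h3, h4, h5⟩ := hpos z hz hz'
    have d1 : HasDerivAt (fun z : ℝ => 1 - z ^ 2) (-(2 * z)) z := by
      simpa using (hasDerivAt_pow 2 z).const_sub 1
    have d2 : HasDerivAt (fun z : ℝ => c * z ^ 2 / (1 - z ^ 2)) (2 * c * z / (1 - z ^ 2) ^ 2) z := by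
      refine (((hasDerivAt_pow 2 z).const_mul c).div d1 h2.ne').congr_deriv ?_
      field_simp; ring
    have d3 : HasDerivAt (fun z : ℝ => c * z / (1 - z ^ 2))
        (c * (1 + z ^ 2) / (1 - z ^ 2) ^ 2) z := by
      refine (((hasDerivAt_id z).const_mul c).div d1 h2.ne').congr_deriv ?_
      simp only [id]; field_simp; ring
    have d4 := hasDerivAt_halfLogOdds (ρ := z) (by linarith) (by linarith)
    refine (((((d2.neg.add (d3.sinh.log h4.ne')).sub_const (log c)).sub
      ((d1.log h2.ne').div_const 2)).sub (d4.log h5.ne')).sub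
      ((hasDerivAt_entropyDefect (ρ := z) (by linarith) (by linarith)).const_mul w)).congr_deriv ?_
    field_simp
    ring
  have hanti : AntitoneOn Φ (Ioo 0 ρ₀) := by
    refine antitoneOn_of_hasDerivWithinAt_nonpos (convex_Ioo _ _)
      (fun z hz => (hd z hz.1 hz.2).continuousAt.continuousWithinAt)
      (f' := fun z => -(2 * c * z / (1 - z ^ 2) ^ 2) + c * (1 + z ^ 2) / (1 - z ^ 2) ^ 2 *
        (cosh (c * z / (1 - z ^ 2)) / sinh (c * z / (1 - z ^ 2))) + z / (1 - z ^ 2) -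
        1 / ((1 - z ^ 2) * halfLogOdds z) - w * halfLogOdds z) ?_ ?_
    · intro z hz
      rw [interior_Ioo] at hz
      exact (hd z hz.1 hz.2).hasDerivWithinAt
    · intro z hz
      rw [interior_Ioo] at hz
      obtain ⟨h2, h3, h4, h5⟩ := hpos z hz.1 hz.2
      have hs := h z hz.1 hz.2
      have hz0 := hz.1
      rw [SlopeBound, ← mul_div_assoc c z] at hs
      have hz1 : z ≤ 4 / 5 := hz.2.le.trans hρ₀
      have b1 := halfLogOdds_mul_le hz0.le hz1
      have b2 := le_halfLogOdds_mul hz0.le hz1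
      have b3 := mul_cosh_le_lambertBound_mul_sinh h3.le
      set x := c * z / (1 - z ^ 2) with hx
      set y := halfLogOdds z with hy
      have b4 : x * (cosh x / sinh x) ≤ lambertBound x := by
        rw [← mul_div_assoc, div_le_iff₀ h4]; exact b3
      have b5 : 1 - z ^ 2 / 3 - 4 / 45 * z ^ 4 - 0.095 * z ^ 6 ≤ z / y := by
        rw [le_div_iff₀ h5, mul_comm]; exact b1
      have b6 := mul_le_mul_of_nonneg_left b2 (mul_nonneg hw hz0.le)
      have b7 := mul_le_mul_of_nonneg_left b4 (show 0 ≤ 1 + z ^ 2 by positivity)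
      -- multiplying the derivative by `z (1 - z ^ 2)` gives the two sides of the slope bound
      have e : -(2 * c * z / (1 - z ^ 2) ^ 2) + c * (1 + z ^ 2) / (1 - z ^ 2) ^ 2 *
          (cosh x / sinh x) + z / (1 - z ^ 2) - 1 / ((1 - z ^ 2) * y) - w * y =
          (z ^ 2 - z / y - 2 * c * z ^ 2 / (1 - z ^ 2) + (1 + z ^ 2) * (x * (cosh x / sinh x)) -
            w * z * (y * (1 - z ^ 2))) / (z * (1 - z ^ 2)) := by
        generalize cosh x / sinh x = q
        rw [hx]
        field_simp
        ring
      rw [e]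
      refine div_nonpos_of_nonpos_of_nonneg ?_ (by positivity)
      linarith
  -- near the origin the function is bounded by one that tends to zero
  have hU : ∀ z, 0 < z → z < ρ₀ →
      Φ z ≤ (c * z / (1 - z ^ 2)) ^ 2 / 6 - 3 / 2 * log (1 - z ^ 2) := by
    intro z hz hz'
    obtain ⟨h2, h3, h4, h5⟩ := hpos z hz hz'
    have u1 : log (sinh (c * z / (1 - z ^ 2))) ≤
        log c + log z - log (1 - z ^ 2) + (c * z / (1 - z ^ 2)) ^ 2 / 6 := by
      refine (log_le_log h4 (sinh_le_mul_exp h3.le)).trans ?_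
      rw [log_mul h3.ne' (exp_pos _).ne', log_exp, log_div (by positivity) h2.ne',
        log_mul hc.ne' hz.ne']
    have u2 := log_le_log hz (le_halfLogOdds hz.le (by linarith))
    have u3 : 0 ≤ c * z ^ 2 / (1 - z ^ 2) := by positivity
    have u4 := mul_nonneg hw (entropyDefect_nonneg (ρ := z)
      (abs_le.2 ⟨by linarith, by linarith⟩))
    simp only [hΦ]
    linarith
  have hle : Φ ρ ≤ 0 := by
    have hlim : Filter.Tendsto (fun z : ℝ => (c * z / (1 - z ^ 2)) ^ 2 / 6 -
        3 / 2 * log (1 - z ^ 2)) (nhdsWithin 0 (Ioi 0)) (nhds 0) := by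
      have : ContinuousAt (fun z : ℝ => (c * z / (1 - z ^ 2)) ^ 2 / 6 -
          3 / 2 * log (1 - z ^ 2)) 0 := by
        refine ContinuousAt.sub (ContinuousAt.div_const (ContinuousAt.pow (ContinuousAt.div
          (by fun_prop) (by fun_prop) (by norm_num)) 2) 6) ?_
        exact continuousAt_const.mul (ContinuousAt.log (by fun_prop) (by norm_num))
      have h2 := this.tendsto
      simp only [mul_zero, ne_eq, OfNat.ofNat_ne_zero, not_false_eq_true, zero_pow, sub_zero,
        div_one, zero_div, log_one] at h2
      exact h2.mono_left nhdsWithin_le_nhds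
    refine ge_of_tendsto hlim ?_
    filter_upwards [Ioo_mem_nhdsGT h0] with z hz
    exact (hanti ⟨hz.1, hz.2.trans h1⟩ ⟨h0, h1⟩ hz.2.le).trans (hU z hz.1 (hz.2.trans h1))
  obtain ⟨h2, h3, h4, h5⟩ := hpos ρ h0 h1
  have e : exp (Φ ρ) * (c * √(1 - ρ ^ 2) * halfLogOdds ρ * exp (w * entropyDefect ρ)) =
      exp (-(c * ρ ^ 2 / (1 - ρ ^ 2))) * sinh (c * ρ / (1 - ρ ^ 2)) := by
    have hs : √(1 - ρ ^ 2) = exp (log (1 - ρ ^ 2) / 2) := by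
      rw [Real.sqrt_eq_rpow, rpow_def_of_pos h2]; congr 1; ring
    simp only [hΦ]
    rw [exp_sub, exp_sub, exp_sub, exp_sub, exp_add, exp_log hc, exp_log h4, exp_log h5, hs]
    field_simp
  rw [← e]
  exact mul_le_of_le_one_left (by positivity) (exp_le_one_iff.2 hle)

/-! ### The overlap gap in the middle range -/

lemma invDensity_antitone {K K' : ℝ} (hK : 0 < K) (h : K ≤ K') :
    invDensity K' ≤ invDensity K := by
  have h2 : pK K ≤ pK K' := by
    rcases h.eq_or_lt with h' | h'
    · rw [h']
    · exact (pK_lt hK.le h').le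
  have h3 := log_le_log (pK_pos hK) h2
  have := log_pos one_lt_two
  unfold invDensity
  gcongr

lemma exp_forty_seven_le : exp 0.47 ≤ 1 + 1.28 * 0.47 := by
  refine (Real.exp_bound' (by norm_num) (by norm_num) (n := 6) (by norm_num)).trans ?_
  norm_num [Finset.sum_range_succ, Nat.factorial]

lemma exp_twenty_three_and_half_le : exp 0.235 ≤ 1 + 1.16 * 0.235 := by
  refine (Real.exp_bound' (by norm_num) (by norm_num) (n := 4) (by norm_num)).trans ?_
  norm_num [Finset.sum_range_succ, Nat.factorial]

lemma entropyDefect_four_fifths_bounds :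
    0.368 < entropyDefect (4 / 5) ∧ entropyDefect (4 / 5) < 0.3681 := by
  rw [entropyDefect_four_fifths]
  have := log_three_bounds
  have := log_five_bounds
  norm_num at *
  constructor <;> linarith

lemma entropyDefect_seven_tenths_bounds :
    0.2704 < entropyDefect (7 / 10) ∧ entropyDefect (7 / 10) < 0.2705 := by
  rw [entropyDefect_seven_tenths]
  have := log_three_bounds
  have := log_five_bounds
  have := log_seventeen_bounds
  have := log_two_gt_d9
  have := log_two_lt_d9
  norm_num at *
  constructor <;> linarith

lemma invDensity_le_of_ge {c : ℝ} (h : 0.23 ≤ c) : invDensity √c ≤ 1.445 := by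
  refine (invDensity_antitone (Real.sqrt_pos.2 (by norm_num)) (Real.sqrt_le_sqrt h)).trans ?_
  have hE : (5.888 : ℝ) ≤ exp (2 * 1.0015 - 0.23) := by
    refine le_trans ?_ (Real.sum_le_exp_of_nonneg (by norm_num) 12)
    norm_num [Finset.sum_range_succ, Nat.factorial]
  have h2 := neg_log_pK_sqrt_le (c := 0.23) (r := 1.0803) (by norm_num) (by norm_num)
    (le_trans (by norm_num) (sum_le_massRatio (by norm_num))) (by norm_num) hE (by norm_num)
  rw [invDensity, div_le_iff₀ (log_pos one_lt_two)]
  have := log_two_gt_d9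
  norm_num at *
  linarith

lemma invDensity_le_of_one_le {c : ℝ} (h : 1 ≤ c) : invDensity √c ≤ 0.555 := by
  refine (invDensity_antitone (Real.sqrt_pos.2 (by norm_num)) (Real.sqrt_le_sqrt h)).trans ?_
  have hE : (0.79 : ℝ) ≤ exp (2 * 0.384 - 1) := by
    rw [show (2 * 0.384 - 1 : ℝ) = (8 : ℕ) * (-0.029) by norm_num, exp_nat_mul]
    have := add_one_le_exp (-0.029 : ℝ)
    refine le_trans ?_ (pow_le_pow_left₀ (by norm_num) this 8)
    norm_num
  have h2 := neg_log_pK_sqrt_le (c := 1) (r := 1.4106) (by norm_num) (by norm_num)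
    (le_trans (by norm_num) (sum_le_massRatio (by norm_num))) (by norm_num) hE (by norm_num)
  rw [invDensity, div_le_iff₀ (log_pos one_lt_two)]
  have := log_two_gt_d9
  norm_num at *
  linarith

/-- The slope bound and the comparison of exponentials together give the differential inequality. -/
lemma sinh_le_of_slopeBound_of_exp_le {c w ρ₀ : ℝ} (hc : 0 < c) (hw : 0 ≤ w) (hρ₀ : ρ₀ ≤ 4 / 5)
    (h : ∀ ρ, 0 < ρ → ρ < ρ₀ → SlopeBound c w ρ)
    (he : ∀ ι, 0 ≤ ι → ι ≤ entropyDefect ρ₀ → exp (w * ι) ≤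
      0.998 * (massRatio c ^ 2 * invDensity √c) * exp (invDensity √c * ι))
    {ρ : ℝ} (h0 : 0 < ρ) (h1 : ρ < ρ₀) :
    exp (-(c * ρ ^ 2 / (1 - ρ ^ 2))) * sinh (c * ρ / (1 - ρ ^ 2)) ≤
      998 / 1000 * c * massRatio c ^ 2 * invDensity √c * √(1 - ρ ^ 2) * halfLogOdds ρ *
        exp (invDensity √c * entropyDefect ρ) := by
  refine (sinh_le_of_slopeBound hc hw hρ₀ h h0 h1).trans ?_
  have hι := entropyDefect_monotoneOn ⟨h0.le, by linarith⟩ ⟨by linarith, by linarith⟩ h1.le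
  have h2 := he _ (entropyDefect_nonneg (abs_le.2 ⟨by linarith, by linarith⟩)) hι
  have hy := halfLogOdds_nonneg h0.le (by linarith)
  calc c * √(1 - ρ ^ 2) * halfLogOdds ρ * exp (w * entropyDefect ρ) ≤
        c * √(1 - ρ ^ 2) * halfLogOdds ρ * (0.998 * (massRatio c ^ 2 * invDensity √c) *
          exp (invDensity √c * entropyDefect ρ)) := by gcongr
    _ = _ := by norm_num; ring

lemma overlapGap_of_lt_one {c : ℝ} (h1 : 0.23 ≤ c) (h2 : c < 1) :
    OverlapGap (1 / 1000) (1 / 1000 / 20) √c := by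
  have hc : 0 < c := by linarith
  have ha := invDensity_pos (Real.sqrt_pos.2 hc)
  have ha' := invDensity_le_of_ge h1
  have hι := entropyDefect_four_fifths_bounds
  have hl := log_two_lt_d9
  refine overlapGap_of_sinh_le hc (t₀ := 0.47) (R := 1.28) (ρ₀ := 4 / 5) (by norm_num) (by norm_num)
    exp_forty_seven_le (by norm_num) (by norm_num)
    (fun ρ hρ hρ' => mul_entropy_le_of_four_fifths_le hρ hρ') ?_ ?_ ?_
  · calc invDensity √c * (log 2 - entropyDefect (4 / 5)) ≤ 1.445 * (0.6931472 - 0.368) := by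
          have : 0 ≤ log 2 - entropyDefect (4 / 5) := by linarith [log_two_gt_d9]
          gcongr
          · linarith
          · exact hι.1.le
      _ ≤ _ := by norm_num
  · calc invDensity √c * entropyDefect (4 / 5) ≤ 1.445 * 0.3681 := by
          gcongr
          · linarith [hι.1]
          · exact hι.2.le
      _ ≤ _ := by norm_num
  · intro ρ h0 hρ
    rcases lt_or_ge c 0.4 with h3 | h3
    · refine sinh_le_of_slopeBound_of_exp_le hc ?_ le_rfl (fun z hz hz' => ?_)
        (fun ι hι0 hι' => exp_chord_le_of_lt_two_fifths h1 h3 hι0 (hι'.trans hι.2.le)) h0 hρ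
      · norm_num; linarith
      · obtain ⟨s1, s2, s3, s4⟩ := slopeBound_of_lt_four_fifths hz.le hz'
        exact s1.chord s2 h1 h3.le (by norm_num)
    rcases lt_or_ge c 0.8 with h4 | h4
    · refine sinh_le_of_slopeBound_of_exp_le hc ?_ le_rfl (fun z hz hz' => ?_)
        (fun ι hι0 hι' => exp_chord_le_of_lt_four_fifths h3 h4 hι0 (hι'.trans hι.2.le)) h0 hρ
      · norm_num; linarith
      · obtain ⟨s1, s2, s3, s4⟩ := slopeBound_of_lt_four_fifths hz.le hz'
        exact s2.chord s3 h3 h4.le (by norm_num)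
    · refine sinh_le_of_slopeBound_of_exp_le hc ?_ le_rfl (fun z hz hz' => ?_)
        (fun ι hι0 hι' => exp_chord_le_of_lt_one h4 h2 hι0 (hι'.trans hι.2.le)) h0 hρ
      · norm_num; linarith
      · obtain ⟨s1, s2, s3, s4⟩ := slopeBound_of_lt_four_fifths hz.le hz'
        exact s3.chord s4 h4 h2.le (by norm_num)

/-- For `c ≥ 1` the tail starts at `ρ = 7 / 10`, and only the differential inequality remains. -/
lemma overlapGap_of_one_le_of_sinh_le {c : ℝ} (h1 : 1 ≤ c)
    (h : ∀ ρ, 0 < ρ → ρ < 7 / 10 →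
      exp (-(c * ρ ^ 2 / (1 - ρ ^ 2))) * sinh (c * ρ / (1 - ρ ^ 2)) ≤
        998 / 1000 * c * massRatio c ^ 2 * invDensity √c * √(1 - ρ ^ 2) * halfLogOdds ρ *
          exp (invDensity √c * entropyDefect ρ)) :
    OverlapGap (1 / 1000) (1 / 1000 / 20) √c := by
  have hc : 0 < c := by linarith
  have ha := invDensity_pos (Real.sqrt_pos.2 hc)
  have ha' := invDensity_le_of_one_le h1
  have hι := entropyDefect_seven_tenths_bounds
  have hl := log_two_lt_d9
  refine overlapGap_of_sinh_le hc (t₀ := 0.235) (R := 1.16) (ρ₀ := 7 / 10) (by norm_num)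
    (by norm_num) exp_twenty_three_and_half_le (by norm_num) (by norm_num)
    (fun ρ hρ hρ' => mul_entropy_le_of_seven_tenths_le hρ hρ') ?_ ?_ h
  · calc invDensity √c * (log 2 - entropyDefect (7 / 10)) ≤ 0.555 * (0.6931472 - 0.2704) := by
          have : 0 ≤ log 2 - entropyDefect (7 / 10) := by linarith [log_two_gt_d9]
          gcongr
          · linarith
          · exact hι.1.le
      _ ≤ _ := by norm_num
  · calc invDensity √c * entropyDefect (7 / 10) ≤ 0.555 * 0.2705 := by
          gcongr
          · linarith [hι.1]
          · exact hι.2.le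
      _ ≤ _ := by norm_num

lemma overlapGap_of_lt_fiftythree_twentieths {c : ℝ} (h1 : 1 ≤ c) (h2 : c < 2.65) :
    OverlapGap (1 / 1000) (1 / 1000 / 20) √c := by
  have hc : 0 < c := by linarith
  have hι := entropyDefect_seven_tenths_bounds
  refine overlapGap_of_one_le_of_sinh_le h1 fun ρ h0 hρ => ?_
  rcases lt_or_ge c 1.8 with h3 | h3
  · have he : ∀ ι, 0 ≤ ι → ι ≤ entropyDefect (7 / 10) →
        exp ((0.69 + (0 - 0.69) * ((c - 1) / (1.8 - 1))) * ι) ≤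
        0.998 * (massRatio c ^ 2 * invDensity √c) * exp (invDensity √c * ι) := by
      intro ι hι0 hι'
      rcases lt_or_ge c 1.4 with h4 | h4
      · exact exp_chord_le_of_lt_seven_fifths h1 h4 hι0 (hι'.trans hι.2.le)
      · exact exp_chord_le_of_lt_nine_fifths h4 h3 hι0 (hι'.trans hι.2.le)
    refine sinh_le_of_slopeBound_of_exp_le hc ?_ (by norm_num) (fun z hz hz' => ?_) he h0 hρ
    · norm_num; linarith
    · exact (slopeBound_of_lt_four_fifths hz.le (by linarith)).2.2.2.chord
        (slopeBound_of_lt_seven_tenths hz.le hz').1 h1 h3.le (by norm_num)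
  · have he : ∀ ι, 0 ≤ ι → ι ≤ entropyDefect (7 / 10) →
        exp ((0 + (0.3 - 0) * ((c - 1.8) / (2.65 - 1.8))) * ι) ≤
        0.998 * (massRatio c ^ 2 * invDensity √c) * exp (invDensity √c * ι) := by
      intro ι hι0 hι'
      rcases lt_or_ge c 2.1 with h4 | h4
      · exact exp_chord_le_of_lt_twentyone_tenths h3 h4 hι0 (hι'.trans hι.2.le)
      · exact exp_chord_le_of_lt_fiftythree_twentieths h4 h2 hι0 (hι'.trans hι.2.le)
    refine sinh_le_of_slopeBound_of_exp_le hc ?_ (by norm_num) (fun z hz hz' => ?_) he h0 hρ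
    · norm_num; linarith
    · obtain ⟨s1, s2⟩ := slopeBound_of_lt_seven_tenths hz.le hz'
      exact s1.chord s2 h3 h2.le (by norm_num)

/-! ### Narrow strips -/

/-- A function whose derivative changes sign at most once, from plus to minus, is nonnegative on
an interval as soon as it is nonnegative at both ends. -/
lemma nonneg_of_hasDerivAt_mul_antitoneOn {f u v : ℝ → ℝ} {a b : ℝ} (hf : ContinuousOn f (Icc a b))
    (hd : ∀ x ∈ Ioo a b, HasDerivAt f (u x * v x) x) (hu : ∀ x ∈ Ioo a b, 0 ≤ u x)
    (hv : AntitoneOn v (Ioo a b)) (ha : 0 ≤ f a) (hb : 0 ≤ f b) {x : ℝ} (hx : x ∈ Icc a b) :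
    0 ≤ f x := by
  rcases hx.1.eq_or_lt with h | h
  · rwa [← h]
  rcases hx.2.eq_or_lt with h' | h'
  · rwa [h']
  rcases le_total 0 (v x) with h0 | h0
  · have : MonotoneOn f (Icc a x) := by
      refine monotoneOn_of_hasDerivWithinAt_nonneg (f' := fun x => u x * v x) (convex_Icc _ _)
        (hf.mono (Icc_subset_Icc_right hx.2)) (fun y hy => ?_) fun y hy => ?_
      all_goals
        rw [interior_Icc] at hy
        have hy' : y ∈ Ioo a b := ⟨hy.1, hy.2.trans h'⟩
      · exact (hd y hy').hasDerivWithinAt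
      · exact mul_nonneg (hu y hy') (h0.trans (hv hy' ⟨h, h'⟩ hy.2.le))
    exact ha.trans (this ⟨le_rfl, h.le⟩ ⟨h.le, le_rfl⟩ h.le)
  · have : AntitoneOn f (Icc x b) := by
      refine antitoneOn_of_hasDerivWithinAt_nonpos (f' := fun x => u x * v x) (convex_Icc _ _)
        (hf.mono (Icc_subset_Icc_left hx.1)) (fun y hy => ?_) fun y hy => ?_
      all_goals
        rw [interior_Icc] at hy
        have hy' : y ∈ Ioo a b := ⟨h.trans hy.1, hy.2⟩
      · exact (hd y hy').hasDerivWithinAt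
      · exact mul_nonpos_of_nonneg_of_nonpos (hu y hy') ((hv ⟨h, h'⟩ hy' hy.1.le).trans h0)
    exact hb.trans (this ⟨le_rfl, h'.le⟩ ⟨h'.le, le_rfl⟩ h'.le)

lemma exp_mul_sinh_le_of_le {c ρ : ℝ} (hc : 0 < c) (hc' : c ≤ 0.23) (h0 : 0 < ρ) (h1 : ρ < 1) :
    exp (-(c * ρ ^ 2 / (1 - ρ ^ 2))) * sinh (c * ρ / (1 - ρ ^ 2)) ≤ c * ρ / (1 - ρ ^ 2) := by
  have h2 : 0 < 1 - ρ ^ 2 := by nlinarith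
  set x := c * ρ / (1 - ρ ^ 2) with hx
  have hx0 : 0 < x := by positivity
  have e : c * ρ ^ 2 / (1 - ρ ^ 2) = ρ * x := by rw [hx]; ring
  rw [e]
  rcases le_or_gt x (6 * ρ) with h | h
  · calc exp (-(ρ * x)) * sinh x ≤ exp (-(ρ * x)) * (x * exp (x ^ 2 / 6)) := by
          gcongr; exact sinh_le_mul_exp hx0.le
      _ ≤ exp (-(ρ * x)) * (x * exp (ρ * x)) := by
          gcongr; nlinarith
      _ = x := by rw [exp_neg]; field_simp
  · -- here `ρ` is close to `1` and `(1 - ρ) * x` is small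
    have h3 : 6 * (1 - ρ ^ 2) < c := by
      rw [hx, lt_div_iff₀ h2] at h
      nlinarith
    have h4 : 0.9 < ρ := by nlinarith
    have h5 : (1 - ρ) * x ≤ 0.23 := by
      have : (1 - ρ) * x = c * (ρ / (1 + ρ)) := by
        rw [hx, show 1 - ρ ^ 2 = (1 - ρ) * (1 + ρ) by ring]
        have : 1 - ρ ≠ 0 := by linarith
        field_simp
      have h6 : ρ / (1 + ρ) ≤ 1 := by rw [div_le_one (by linarith)]; linarith
      rw [this]; nlinarith
    have h6 : exp 0.23 ≤ 1.3 := by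
      have h7 := add_one_le_exp (-0.23 : ℝ)
      have h8 : exp 0.23 * exp (-0.23) = 1 := by rw [← exp_add]; norm_num
      nlinarith [exp_pos 0.23]
    have h7 : exp (-(ρ * x)) * sinh x ≤ exp ((1 - ρ) * x) / 2 := by
      have e3 : exp ((1 - ρ) * x) = exp (-(ρ * x)) * exp x := by rw [← exp_add]; congr 1; ring
      rw [e3, sinh_eq, mul_div_assoc]
      have := exp_pos (-x)
      gcongr
      linarith
    have h8 := exp_le_exp.2 h5
    linarith

lemma overlapProb_le_sq_div_sin {c α : ℝ} (hc : 0 < c) (hc' : c ≤ 0.23) (h0 : 0 < α)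
    (h1 : α ≤ π / 4) : overlapProb √c α ≤ pK √c ^ 2 / sin (2 * α) := by
  have hs : ∀ x, 0 < x → x ≤ π / 4 → 0 < sin (2 * x) := fun x h h' =>
    sin_pos_of_pos_of_lt_pi (by linarith) (by linarith [pi_pos])
  refine overlapProb_le_of_rate_le (α₀ := α) (Real.sqrt_pos.2 hc) h0
    (G := fun x => pK √c ^ 2 / sin (2 * x))
    (g := fun x => pK √c ^ 2 * (2 * cos (2 * x)) / sin (2 * x) ^ 2) ?_ ?_ ?_ ?_ le_rfl h1
  · exact ContinuousOn.div (by fun_prop) (by fun_prop) fun x hx => (hs x (h0.trans_le hx.1) hx.2).ne'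
  · rw [show 2 * (π / 4) = π / 2 by ring]; simp
  · intro x hx hx'
    have h2 := hs x (h0.trans hx) hx'.le
    refine ((hasDerivAt_const x (pK √c ^ 2)).div
      (((hasDerivAt_id x).const_mul 2).sin) h2.ne').congr_deriv ?_
    simp only [id]; ring
  · intro x hx hx'
    have hx0 := h0.trans hx
    have h2 := exp_mul_sinh_le_of_le hc hc' (cos_two_mul_pos hx0 hx') (cos_two_mul_lt_one hx0 hx')
    have h3 := one_le_massRatio hc
    have hp := pi_pos
    have hsp := hs x hx0 hx'.le
    have hcp := cos_two_mul_pos hx0 hx'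
    rw [overlapRate_sqrt hc hx0 hx', pK_sqrt_sq_eq hc]
    calc _ ≤ 4 / π * exp (-c) * (c * cos (2 * x) / (1 - cos (2 * x) ^ 2)) := by gcongr
      _ = 2 * c / π * exp (-c) * 1 ^ 2 * (2 * cos (2 * x)) / sin (2 * x) ^ 2 := by
          rw [← sin_sq]; ring
      _ ≤ _ := by gcongr

/-- The factor `1 / √(1 - ρ ^ 2)` is the ratio at the origin of the density of a pair with
correlation `ρ` to that of an independent pair. -/
lemma log_overlapProb_le {c α : ℝ} (hc : 0 < c) (hc' : c ≤ 0.23) (h0 : 0 < α)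
    (h1 : α ≤ π / 4) :
    log (overlapProb √c α) - 2 * log (pK √c) ≤ -(log (1 - cos (2 * α) ^ 2) / 2) := by
  have hK := Real.sqrt_pos.2 hc
  have hs : 0 < sin (2 * α) := sin_pos_of_pos_of_lt_pi (by linarith) (by linarith [pi_pos])
  have h2 := log_le_log (overlapProb_pos hK h0.le h1) (overlapProb_le_sq_div_sin hc hc' h0 h1)
  have hp := pK_pos hK
  rw [log_div (by positivity) hs.ne', log_pow] at h2
  rw [← sin_sq, log_pow]
  push_cast at *
  linarith

lemma hasDerivAt_neg_log_one_sub_sq {ρ : ℝ} (h0 : 0 ≤ ρ) (h1 : ρ < 1) :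
    HasDerivAt (fun x => -(log (1 - x ^ 2) / 2)) (ρ / (1 - ρ ^ 2)) ρ := by
  have h2 : 1 - ρ ^ 2 ≠ 0 := by nlinarith
  refine ((((hasDerivAt_pow 2 ρ).const_sub 1).log h2).div_const 2).neg.congr_deriv ?_
  simp; field_simp

lemma neg_log_one_sub_sq_four_fifths :
    -(log (1 - (4 / 5 : ℝ) ^ 2) / 2) = log 5 - log 3 := by
  rw [show (1 - (4 / 5 : ℝ) ^ 2) = (3 / 5) ^ 2 by norm_num, log_pow,
    log_div (by norm_num) (by norm_num)]
  push_cast; ring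

lemma continuousOn_neg_log_one_sub_sq {ρ : ℝ} (h1 : ρ < 1) :
    ContinuousOn (fun x => -(log (1 - x ^ 2) / 2)) (Icc 0 ρ) := by
  refine (ContinuousOn.div_const (ContinuousOn.log (by fun_prop) ?_) 2).neg
  intro x hx
  nlinarith [hx.1, hx.2]

/-- The difference of the two sides vanishes at `0`, is positive at `4 / 5`, and first increases and
then decreases in between. -/
lemma neg_log_one_sub_sq_le_mul_entropyDefect {ρ : ℝ} (h0 : 0 ≤ ρ) (h1 : ρ ≤ 4 / 5) :
    -(log (1 - ρ ^ 2) / 2) ≤ 1.4 * entropyDefect ρ := by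
  have := nonneg_of_hasDerivAt_mul_antitoneOn (a := 0) (b := 4 / 5)
    (f := fun x => 1.4 * entropyDefect x - -(log (1 - x ^ 2) / 2))
    (u := fun x => x / (1 - x ^ 2)) (v := fun x => 1.4 * (halfLogOdds x * (1 - x ^ 2) / x) - 1)
    ?_ ?_ ?_ ?_ ?_ ?_ ⟨h0, h1⟩
  · exact sub_nonneg.1 this
  · exact (continuous_entropyDefect.continuousOn.const_smul (1.4 : ℝ)).sub
      (continuousOn_neg_log_one_sub_sq (by norm_num))
  · intro x hx
    have h2 : 1 - x ^ 2 ≠ 0 := by nlinarith [hx.1, hx.2]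
    have h3 : x ≠ 0 := hx.1.ne'
    refine (((hasDerivAt_entropyDefect (by linarith [hx.1]) (by linarith [hx.2])).const_mul
      1.4).sub (hasDerivAt_neg_log_one_sub_sq hx.1.le (by linarith [hx.2]))).congr_deriv ?_
    field_simp
  · intro x hx
    have h2 : 0 < 1 - x ^ 2 := by nlinarith [hx.1, hx.2]
    have := hx.1
    positivity
  · have hd : ∀ x ∈ Ioo (0 : ℝ) (4 / 5), HasDerivAt
        (fun x => 1.4 * (halfLogOdds x * (1 - x ^ 2) / x) - 1)
        (1.4 * ((x - halfLogOdds x * (1 + x ^ 2)) / x ^ 2)) x := by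
      intro x hx
      have h2 : 1 - x ^ 2 ≠ 0 := by nlinarith [hx.1, hx.2]
      have h3 : x ≠ 0 := hx.1.ne'
      refine (((((hasDerivAt_halfLogOdds (by linarith [hx.1]) (by linarith [hx.2])).mul
        ((hasDerivAt_pow 2 x).const_sub 1)).div (hasDerivAt_id x) h3).const_mul
        1.4).sub_const 1).congr_deriv ?_
      simp only [id, Pi.mul_apply]
      field_simp
      ring
    refine antitoneOn_of_hasDerivWithinAt_nonpos
      (f' := fun x => 1.4 * ((x - halfLogOdds x * (1 + x ^ 2)) / x ^ 2)) (convex_Ioo _ _)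
      (fun x hx => (hd x hx).continuousAt.continuousWithinAt) (fun x hx => ?_) fun x hx => ?_
    · rw [interior_Ioo] at hx
      exact (hd x hx).hasDerivWithinAt
    · rw [interior_Ioo] at hx
      have h3 := le_halfLogOdds hx.1.le (by linarith [hx.2])
      have h4 : x - halfLogOdds x * (1 + x ^ 2) ≤ 0 := by nlinarith [sq_nonneg x, hx.1]
      have := div_nonpos_of_nonpos_of_nonneg h4 (sq_nonneg x)
      linarith
  · simp
  · have h2 := neg_log_one_sub_sq_four_fifths
    have h3 := entropyDefect_four_fifths_bounds
    have h4 := log_three_bounds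
    have h5 := log_five_bounds
    simp only [h2]
    norm_num at *
    linarith

/-- The body of the gap for `ρ ≥ 4 / 5`, as long as `invDensity K * (log 2 - ι)` is at least `0.47`. -/
lemma entropy_mul_neg_log_one_sub_sq_le {ρ : ℝ} (h0 : 4 / 5 ≤ ρ) (h1 : ρ < 1) :
    (log 2 - entropyDefect ρ) * -(log (1 - ρ ^ 2) / 2) ≤ 0.999 * 0.47 * entropyDefect ρ := by
  have h2 := neg_log_one_sub_sq_four_fifths
  have h3 := entropyDefect_four_fifths_bounds
  have h4 := log_three_bounds
  have h5 := log_five_bounds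
  have h6 := log_two_lt_d9
  have h7 := log_two_gt_d9
  have hd : ∀ x ∈ Ioo (4 / 5) ρ, HasDerivAt
      (fun x => 0.999 * 0.47 * entropyDefect x - (log 2 - entropyDefect x) * -(log (1 - x ^ 2) / 2))
      (0.999 * 0.47 * halfLogOdds x - (-halfLogOdds x * -(log (1 - x ^ 2) / 2) +
        (log 2 - entropyDefect x) * (x / (1 - x ^ 2)))) x := by
    intro x hx
    have hι := hasDerivAt_entropyDefect (ρ := x) (by linarith [hx.1]) (by linarith [hx.2])
    exact (hι.const_mul _).sub ((hι.const_sub (log 2)).mul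
      (hasDerivAt_neg_log_one_sub_sq (by linarith [hx.1]) (by linarith [hx.2])))
  have hm : MonotoneOn (fun x => 0.999 * 0.47 * entropyDefect x -
      (log 2 - entropyDefect x) * -(log (1 - x ^ 2) / 2)) (Icc (4 / 5) ρ) := by
    refine monotoneOn_of_hasDerivWithinAt_nonneg (convex_Icc _ _) ?_
      (fun x hx => (hd x (by rwa [interior_Icc] at hx)).hasDerivWithinAt) fun x hx => ?_
    · have h8 := continuous_entropyDefect
      exact (by fun_prop : ContinuousOn (fun x => 0.999 * 0.47 * entropyDefect x) _).sub
        (ContinuousOn.mul (by fun_prop) ((continuousOn_neg_log_one_sub_sq h1).mono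
          (Icc_subset_Icc_left (by norm_num))))
    · rw [interior_Icc] at hx
      have hx0 : 0 < x := by linarith [hx.1]
      have hx1 : x < 1 := by linarith [hx.2]
      have hs : 0 < 1 - x ^ 2 := by nlinarith
      have hy := halfLogOdds_nonneg hx0.le hx1
      have hH := mul_entropy_le_of_four_fifths_le hx.1.le hx1.le
      have hlc : -(log (1 - (4 / 5 : ℝ) ^ 2) / 2) ≤ -(log (1 - x ^ 2) / 2) := by
        have := log_le_log hs (show 1 - x ^ 2 ≤ 1 - (4 / 5 : ℝ) ^ 2 by nlinarith [hx.1])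
        linarith
      have h8 : 1.28 * ((log 2 - entropyDefect x) * (x / (1 - x ^ 2))) ≤ halfLogOdds x := by
        calc _ = 1.28 * (log 2 - entropyDefect x) * (x / (1 - x ^ 2)) := by ring
          _ ≤ 3 * halfLogOdds x * (1 - x ^ 2) / (2 + x) * (x / (1 - x ^ 2)) := by gcongr
          _ = halfLogOdds x * (3 * x / (2 + x)) := by field_simp
          _ ≤ halfLogOdds x * 1 := by
              gcongr
              rw [div_le_one (by linarith)]; linarith
          _ = _ := mul_one _
      have h9 : halfLogOdds x * 0.5 ≤ halfLogOdds x * -(log (1 - x ^ 2) / 2) := by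
        gcongr
        norm_num at *
        linarith
      norm_num at *
      linarith
  have h8 := hm ⟨le_rfl, h0⟩ ⟨h0, le_rfl⟩ h0
  simp only [h2] at h8
  have h9 : (log 2 - entropyDefect (4 / 5)) * (log 5 - log 3) ≤ 0.32515 * 0.51083 := by
    gcongr
    · linarith
    · norm_num at *; linarith
    · norm_num at *; linarith
  norm_num at *
  linarith

lemma le_invDensity_of_lt {c : ℝ} (hc : 0 < c) (hc' : c < 0.23) : 1.4015 ≤ invDensity √c := by
  refine le_trans ?_ (invDensity_antitone (Real.sqrt_pos.2 hc) (Real.sqrt_le_sqrt hc'.le))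
  refine le_trans ?_ (div_le_invDensity_sqrt (by norm_num)
    (neg_log_pK_sqrt_ge_near_three_tenths (c := 0.23) (by norm_num) (by norm_num)))
  norm_num

/-- The overlap up to which the body of the gap is used; beyond it the tail estimate applies. -/
lemma exists_entropy_threshold (a : ℝ) :
    ∃ ρ₀, 4 / 5 ≤ ρ₀ ∧ ρ₀ < 1 ∧ a * (log 2 - entropyDefect ρ₀) ≤ 0.47 ∧
      ∀ ρ, 4 / 5 < ρ → ρ ≤ ρ₀ → 0.47 ≤ a * (log 2 - entropyDefect ρ) := by
  rcases le_or_gt (a * (log 2 - entropyDefect (4 / 5))) 0.47 with h | h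
  · exact ⟨4 / 5, le_rfl, by norm_num, h, fun ρ h1 h2 => absurd h1 h2.not_gt⟩
  · have h3 := entropyDefect_le_log_two (ρ := 4 / 5) (by norm_num [abs_le])
    have ha : 0 < a := by
      by_contra! h4
      nlinarith
    have hc : ContinuousOn (fun ρ => a * (log 2 - entropyDefect ρ)) (Icc (4 / 5) 1) := by
      have := continuous_entropyDefect
      fun_prop
    obtain ⟨ρ₀, hρ, hρ'⟩ := intermediate_value_Icc' (by norm_num) hc
      (show (0.47 : ℝ) ∈ Icc _ _ from ⟨by norm_num, h.le⟩)
    have hlt : ρ₀ < 1 := by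
      refine lt_of_le_of_ne hρ.2 fun h4 => ?_
      rw [h4] at hρ'
      norm_num at hρ'
    refine ⟨ρ₀, hρ.1, hlt, hρ'.le, fun ρ h1 h2 => ?_⟩
    rw [← hρ']
    have := entropyDefect_monotoneOn ⟨by linarith, by linarith⟩ ⟨by linarith [hρ.1], hlt.le⟩ h2
    simp only
    gcongr

lemma overlapGap_of_lt_twentythree_hundredths {c : ℝ} (hc : 0 < c) (hc' : c < 0.23) :
    OverlapGap (1 / 1000) (1 / 1000 / 20) √c := by
  have hK := Real.sqrt_pos.2 hc
  have ha := le_invDensity_of_lt hc hc'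
  obtain ⟨ρ₀, hρ, hρ1, hH, hge⟩ := exists_entropy_threshold (invDensity √c)
  obtain ⟨α₀, h0, h1, hcos⟩ := exists_cos_two_mul_eq (by linarith : 0 < ρ₀) hρ1
  have hbody : ∀ α, α₀ ≤ α → α ≤ π / 4 → log (overlapProb √c α) - 2 * log (pK √c) ≤
      (1 - 1 / 1000) * invDensity √c * entropyDefect (cos (2 * α)) := by
    intro α hα hα'
    refine (log_overlapProb_le hc hc'.le (h0.trans_le hα) hα').trans ?_
    obtain ⟨hm0, hm1⟩ := cos_two_mul_mem_Icc h0 hα hα'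
    rw [hcos] at hm1
    set ρ := cos (2 * α)
    have hι : 0 ≤ entropyDefect ρ := entropyDefect_nonneg (abs_cos_le_one _)
    rcases le_or_gt ρ (4 / 5) with h | h
    · refine (neg_log_one_sub_sq_le_mul_entropyDefect hm0 h).trans ?_
      gcongr
      norm_num at *
      linarith
    · have h2 := entropy_mul_neg_log_one_sub_sq_le h.le (by linarith)
      have h3 := hge ρ h hm1
      have hHp : 0 < log 2 - entropyDefect ρ := by
        by_contra! h4
        have : invDensity √c * (log 2 - entropyDefect ρ) ≤ 0 :=
          mul_nonpos_of_nonneg_of_nonpos (by linarith) h4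
        linarith
      have h4 : (log 2 - entropyDefect ρ) * -(log (1 - ρ ^ 2) / 2) ≤ (log 2 - entropyDefect ρ) *
          ((1 - 1 / 1000) * invDensity √c * entropyDefect ρ) := by
        refine h2.trans ?_
        have := mul_le_mul_of_nonneg_right h3 hι
        norm_num at *
        nlinarith
      exact le_of_mul_le_mul_left h4 hHp
  exact ⟨α₀, h0, h1, hbody, fun α hα hα' => tail_gap hK (by norm_num) (by norm_num)
    (t₀ := 0.47) (R := 1.28) (ρ₁ := 4 / 5) (by norm_num) (by norm_num) exp_forty_seven_le
    (by norm_num) (fun ρ hρ hρ' => mul_entropy_le_of_four_fifths_le hρ hρ')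
    h0 h1 (by rw [hcos]; exact hρ) (by rw [hcos]; exact hH) (hbody α₀ le_rfl h1.le) hα hα'⟩

/-! ### The mass ratio of wide strips -/

/-- The Mills ratio bound: the derivative of the difference of the two sides is
`-2 √(2 / π) exp (-x ^ 2 / 2) / (1 + x ^ 2) ^ 2`, and the difference tends to `0` at infinity. -/
lemma mills_le_one_sub_pK {K : ℝ} (hK : 0 < K) :
    √(2 / π) * (exp (-K ^ 2 / 2) * (K / (1 + K ^ 2))) ≤ 1 - pK K := by
  set D : ℝ → ℝ := fun x => 1 - pK x - √(2 / π) * (exp (-x ^ 2 / 2) * (x / (1 + x ^ 2))) with hD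
  have hd : ∀ x, 0 < x →
      HasDerivAt D (-(√(2 / π) * (exp (-x ^ 2 / 2) * (2 / (1 + x ^ 2) ^ 2)))) x := by
    intro x hx
    have h1 : 1 + x ^ 2 ≠ 0 := by positivity
    refine (((hasDerivAt_pK hx).const_sub 1).sub (((((hasDerivAt_pow 2 x).neg.div_const
      2).exp).mul ((hasDerivAt_id x).div ((hasDerivAt_pow 2 x).const_add 1) h1)).const_mul
      √(2 / π))).congr_deriv ?_
    simp only [Pi.neg_apply, Pi.div_apply, id]
    field_simp
    ring
  have hanti : AntitoneOn D (Ici K) := by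
    refine antitoneOn_of_hasDerivWithinAt_nonpos
      (f' := fun x => -(√(2 / π) * (exp (-x ^ 2 / 2) * (2 / (1 + x ^ 2) ^ 2)))) (convex_Ici _)
      (fun x hx => (hd x (hK.trans_le hx)).continuousAt.continuousWithinAt)
      (fun x hx => ?_) fun x _ => ?_
    · rw [interior_Ici] at hx
      exact (hd x (hK.trans hx)).hasDerivWithinAt
    · exact neg_nonpos.2 (by positivity)
  have hlim : Filter.Tendsto (fun x : ℝ => -(√(2 / π) * x⁻¹)) Filter.atTop (nhds 0) := by
    simpa using (tendsto_inv_atTop_zero.const_mul √(2 / π)).neg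
  have h0 : 0 ≤ D K := by
    refine le_of_tendsto hlim ((Filter.eventually_ge_atTop K).mono fun y hy => ?_)
    refine le_trans ?_ (hanti self_mem_Ici hy hy)
    have hy0 : 0 < y := hK.trans_le hy
    have h1 : exp (-y ^ 2 / 2) * (y / (1 + y ^ 2)) ≤ 1 * y⁻¹ := by
      gcongr
      · exact exp_le_one_iff.2 (by nlinarith [sq_nonneg y])
      · rw [div_le_iff₀ (by positivity)]
        field_simp
        nlinarith
    have h2 := mul_le_mul_of_nonneg_left h1 (Real.sqrt_nonneg (2 / π))
    have h3 := pK_lt_one y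
    simp only [hD]
    linarith
  simp only [hD] at h0
  linarith

lemma inv_le_neg_log_pK_sqrt {c : ℝ} (hc : 0 < c) :
    1 / (massRatio c * (1 + c) + 1 / 2) ≤ -log (pK √c) := by
  have hK := Real.sqrt_pos.2 hc
  have hp := pK_pos hK
  have hr := massRatio_pos hc
  have h1 := mills_le_one_sub_pK hK
  have h2 : √(2 / π) * (exp (-√c ^ 2 / 2) * (√c / (1 + √c ^ 2))) =
      pK √c * (1 / (massRatio c * (1 + c))) := by
    rw [pK_sqrt_eq' hc, Real.sq_sqrt hc.le]
    field_simp
  rw [h2] at h1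
  set z := 1 / (massRatio c * (1 + c)) with hz
  have hz0 : 0 < z := by positivity
  have h3 : 1 + z ≤ (pK √c)⁻¹ := by
    rw [← one_div, le_div_iff₀ hp]; linarith
  have h4 := log_le_log (by linarith) h3
  rw [log_inv] at h4
  refine le_trans (le_of_eq ?_) ((Real.le_log_one_add_of_nonneg hz0.le).trans h4)
  rw [hz]
  field_simp
  ring

lemma massRatio_sixteen_fifths_ge : 3.214 ≤ massRatio 3.2 :=
  le_trans (by norm_num) (sum_le_massRatio (by norm_num))

lemma le_sq_massRatio_mul_invDensity_of_ge {c : ℝ} (hc : 3.2 ≤ c) :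
    massRatio c / (1.16 + c) / 0.69315 ≤ massRatio c ^ 2 * invDensity √c := by
  have hc0 : 0 < c := by linarith
  have h1 : 3.214 ≤ massRatio c := massRatio_sixteen_fifths_ge.trans
    (massRatio_monotoneOn (by norm_num) hc0 hc)
  have h2 : massRatio c * (1 + c) + 1 / 2 ≤ massRatio c * (1.16 + c) := by linarith
  have h3 := div_le_invDensity_sqrt hc0 (inv_le_neg_log_pK_sqrt hc0)
  have hr := massRatio_pos hc0
  calc massRatio c / (1.16 + c) / 0.69315 =
        massRatio c ^ 2 * (1 / (massRatio c * (1.16 + c)) / 0.69315) := by field_simp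
    _ ≤ massRatio c ^ 2 * (1 / (massRatio c * (1 + c) + 1 / 2) / 0.69315) := by gcongr
    _ ≤ _ := by gcongr

/-- A lower bound for the logarithmic derivative of the mass ratio. -/
lemma mul_massRatio_le_deriv {c : ℝ} (hc : 0 < c) :
    massRatio c * ((c - 1) / (2 * c)) ≤ (1 - massRatio c) / (2 * c) + massRatio c / 2 := by
  have : (1 - massRatio c) / (2 * c) + massRatio c / 2 =
      massRatio c * ((c - 1) / (2 * c)) + 1 / (2 * c) := by field_simp; ring
  rw [this]
  have : 0 < 1 / (2 * c) := by positivity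
  linarith

lemma massRatio_div_monotoneOn : MonotoneOn (fun c => massRatio c / (1.16 + c)) (Ici 3.2) := by
  have hd : ∀ x : ℝ, 3.2 ≤ x → HasDerivAt (fun c => massRatio c / (1.16 + c))
      ((((1 - massRatio x) / (2 * x) + massRatio x / 2) * (1.16 + x) - massRatio x * 1) /
        (1.16 + x) ^ 2) x := fun x hx =>
    (hasDerivAt_massRatio (by linarith)).div ((hasDerivAt_id x).const_add 1.16) (by linarith)
  refine monotoneOn_of_hasDerivWithinAt_nonneg
    (f' := fun x => (((1 - massRatio x) / (2 * x) + massRatio x / 2) * (1.16 + x) -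
      massRatio x * 1) / (1.16 + x) ^ 2) (convex_Ici _)
    (fun x hx => (hd x hx).continuousAt.continuousWithinAt) (fun x hx => ?_) fun x hx => ?_
  all_goals rw [interior_Ici] at hx
  · exact (hd x (le_of_lt hx)).hasDerivWithinAt
  · have hx1 : 3.2 < x := hx
    have hx0 : 0 < x := by linarith
    have h1 := mul_massRatio_le_deriv hx0
    have hr := massRatio_pos hx0
    refine div_nonneg (sub_nonneg.2 ?_) (by positivity)
    calc massRatio x * 1 ≤ massRatio x * ((x - 1) / (2 * x) * (1.16 + x)) := by
          gcongr
          rw [div_mul_eq_mul_div, le_div_iff₀ (by positivity)]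
          nlinarith
      _ = massRatio x * ((x - 1) / (2 * x)) * (1.16 + x) := by ring
      _ ≤ _ := by gcongr

lemma le_sq_massRatio_mul_invDensity_of_le {c₀ S c : ℝ} (hc₀ : 3.2 ≤ c₀) (hc : c₀ ≤ c)
    (hS : S ≤ massRatio c₀) :
    S / (1.16 + c₀) / 0.69315 ≤ massRatio c ^ 2 * invDensity √c := by
  refine le_trans ?_ (le_sq_massRatio_mul_invDensity_of_ge (hc₀.trans hc))
  have h1 := massRatio_div_monotoneOn hc₀ (hc₀.trans hc) hc
  simp only at h1
  refine div_le_div_of_nonneg_right (le_trans ?_ h1) (by norm_num)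
  gcongr

lemma massRatio_mul_exp_monotoneOn :
    MonotoneOn (fun c => massRatio c * exp (-(7 * c / 17)) * (c / (1.16 + c))) (Ici 3.2) := by
  have hd : ∀ x : ℝ, 3.2 ≤ x → HasDerivAt
      (fun c => massRatio c * exp (-(7 * c / 17)) * (c / (1.16 + c)))
      (exp (-(7 * x / 17)) / (1.16 + x) * (((1 - massRatio x) / (2 * x) + massRatio x / 2) * x -
        massRatio x * (7 / 17 * x - 1.16 / (1.16 + x)))) x := by
    intro x hx
    have h1 : 1.16 + x ≠ 0 := by linarith
    refine (((hasDerivAt_massRatio (by linarith)).mul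
      ((((hasDerivAt_id x).const_mul 7).div_const 17).neg.exp)).mul
      ((hasDerivAt_id x).div ((hasDerivAt_id x).const_add 1.16) h1)).congr_deriv ?_
    simp only [Pi.neg_apply, Pi.div_apply, Pi.mul_apply, id]
    field_simp
    ring
  refine monotoneOn_of_hasDerivWithinAt_nonneg (f' := fun x => exp (-(7 * x / 17)) / (1.16 + x) *
      (((1 - massRatio x) / (2 * x) + massRatio x / 2) * x -
        massRatio x * (7 / 17 * x - 1.16 / (1.16 + x)))) (convex_Ici _)
    (fun x hx => (hd x hx).continuousAt.continuousWithinAt) (fun x hx => ?_) fun x hx => ?_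
  all_goals rw [interior_Ici] at hx
  · exact (hd x (le_of_lt hx)).hasDerivWithinAt
  · have hx1 : 3.2 < x := hx
    have hx0 : 0 < x := by linarith
    have h1 := mul_massRatio_le_deriv hx0
    have hr := massRatio_pos hx0
    refine mul_nonneg (by positivity) (sub_nonneg.2 ?_)
    calc massRatio x * (7 / 17 * x - 1.16 / (1.16 + x)) ≤
          massRatio x * ((x - 1) / (2 * x) * x) := by
          gcongr
          rw [← sub_nonneg]
          have e : (x - 1) / (2 * x) * x - (7 / 17 * x - 1.16 / (1.16 + x)) =
              (34 * 1.16 + (3 * x - 17) * (1.16 + x)) / (34 * (1.16 + x)) := by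
            field_simp; ring
          rw [e]
          refine div_nonneg ?_ (by positivity)
          nlinarith
      _ = massRatio x * ((x - 1) / (2 * x)) * x := by ring
      _ ≤ _ := by gcongr

lemma exp_hundredtwelve_eightyfifths_le : exp (7 * 3.2 / 17) ≤ 3.74 := by
  have h2 : exp (27 / 85) ≤ 1.3741 := by
    refine (Real.exp_bound' (by norm_num) (by norm_num) (n := 6) (by norm_num)).trans ?_
    norm_num [Finset.sum_range_succ, Nat.factorial]
  rw [show (7 * 3.2 / 17 : ℝ) = 1 + 27 / 85 by norm_num, exp_add]
  calc exp 1 * exp (27 / 85) ≤ 2.7182818286 * 1.3741 := by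
        gcongr
        exact exp_one_lt_d9.le
    _ ≤ 3.74 := by norm_num

/-- The differential inequality at `ρ = 7 / 10`, up to the value of `√(1 - ρ ^ 2) * halfLogOdds ρ`
there. -/
lemma exp_seven_seventeenths_le {c : ℝ} (hc : 2.65 ≤ c) :
    exp (7 * c / 17) ≤ 1.996 * c * (massRatio c ^ 2 * invDensity √c) * 0.619 := by
  have hc0 : 0 < c := by linarith
  have h0 := exp_hundredtwelve_eightyfifths_le
  rcases lt_or_ge c 3.2 with h | h
  · have hB := sq_massRatio_mul_invDensity_ge_of_lt hc h
    have h1 : exp (7 * c / 17) * (1 + 7 * (3.2 - c) / 17) ≤ 3.74 := by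
      have h2 := add_one_le_exp (7 * (3.2 - c) / 17)
      calc _ ≤ exp (7 * c / 17) * exp (7 * (3.2 - c) / 17) := by
            gcongr; linarith
        _ = exp (7 * 3.2 / 17) := by rw [← exp_add]; congr 1; ring
        _ ≤ 3.74 := h0
    have h3 : exp (7 * c / 17) ≤ 1.996 * c * 1.05 * 0.619 := by
      have h4 : 0 < 1 + 7 * (3.2 - c) / 17 := by linarith
      refine le_of_mul_le_mul_right (h1.trans ?_) h4
      nlinarith
    refine h3.trans ?_
    gcongr
  · have h1 := massRatio_mul_exp_monotoneOn self_mem_Ici h h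
    simp only at h1
    have h2 := le_sq_massRatio_mul_invDensity_of_ge h
    have h3 : (0.63 : ℝ) ≤ massRatio 3.2 * exp (-(7 * 3.2 / 17)) * (3.2 / (1.16 + 3.2)) := by
      calc (0.63 : ℝ) ≤ 3.214 * (3.74)⁻¹ * (3.2 / (1.16 + 3.2)) := by norm_num
        _ ≤ _ := by
            rw [exp_neg]
            gcongr
            · exact (massRatio_pos (by norm_num)).le
            · exact massRatio_sixteen_fifths_ge
    have h4 : 0.63 * exp (7 * c / 17) ≤ massRatio c / (1.16 + c) * c := by
      calc 0.63 * exp (7 * c / 17) ≤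
            massRatio c * exp (-(7 * c / 17)) * (c / (1.16 + c)) * exp (7 * c / 17) := by
            gcongr
            exact h3.trans h1
        _ = _ := by rw [exp_neg]; field_simp
    have h5 := mul_le_mul_of_nonneg_left h2 hc0.le
    have h6 : massRatio c / (1.16 + c) * c = 0.69315 * (c * (massRatio c / (1.16 + c) / 0.69315)) := by
      field_simp
    have h7 := exp_pos (7 * c / 17)
    norm_num at *
    linarith

/-! ### The differential inequality in wide strips -/

lemma log_one_add_le_add_log {w : ℝ} (hw : 0 ≤ w) :
    5 / 2 * log (1 + w) ≤ 7 / 6 * w + log (1 + 4 / 3 * w) := by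
  refine sub_nonneg.1 (nonneg_of_hasDerivAt_nonneg (b := w)
    (f := fun w => 7 / 6 * w + log (1 + 4 / 3 * w) - 5 / 2 * log (1 + w))
    (f' := fun w => (28 * w ^ 2 + 13 * w) / (6 * (3 + 4 * w) * (1 + w)))
    ?_ (fun x hx _ => ?_) (fun x hx _ => by positivity) (by simp) hw le_rfl)
  · refine ContinuousOn.sub (ContinuousOn.add (by fun_prop) (ContinuousOn.log (by fun_prop) ?_))
      (ContinuousOn.mul (by fun_prop) (ContinuousOn.log (by fun_prop) ?_)) <;>
    · intro x hx
      have := hx.1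
      positivity
  · have h1 : 1 + 4 / 3 * x ≠ 0 := by positivity
    have h2 : 1 + x ≠ 0 := by positivity
    have h3 : 3 + 4 * x ≠ 0 := by positivity
    refine ((((hasDerivAt_id x).const_mul (7 / 6)).add
      ((((hasDerivAt_id x).const_mul (4 / 3)).const_add 1).log h1)).sub
      ((((hasDerivAt_id x).const_add 1).log h2).const_mul (5 / 2))).congr_deriv ?_
    simp only [id]
    field_simp
    ring

lemma mul_one_add_sq_le_halfLogOdds {ρ : ℝ} (h0 : 0 ≤ ρ) (h1 : ρ < 1) :
    ρ * (1 + ρ ^ 2 / 3) ≤ halfLogOdds ρ := by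
  refine le_trans (mul_le_mul_of_nonneg_left ?_ h0) (sum_le_halfLogOdds h0 h1)
  have : 0 ≤ ρ ^ 4 / 5 + ρ ^ 6 / 7 + ρ ^ 8 / 9 := by positivity
  linarith

/-- The logarithm of the right side is `-5 / 2 log (1 + w) + log (1 + 4 w / 3)` in the variable
`w = ρ ^ 2 / (1 - ρ ^ 2)`. -/
lemma exp_neg_le_sqrt_mul_halfLogOdds {ρ : ℝ} (h0 : 0 ≤ ρ) (h1 : ρ < 1) :
    exp (-(7 / 6 * (ρ ^ 2 / (1 - ρ ^ 2)))) * ρ ≤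
      √(1 - ρ ^ 2) * (1 - ρ ^ 2) * halfLogOdds ρ := by
  have h2 : 0 < 1 - ρ ^ 2 := by nlinarith
  set w := ρ ^ 2 / (1 - ρ ^ 2) with hw
  have hw0 : 0 ≤ w := by positivity
  have e1 : 1 + w = (1 - ρ ^ 2)⁻¹ := by rw [hw]; field_simp; ring
  have e2 : 1 + 4 / 3 * w = (1 - ρ ^ 2)⁻¹ * (1 + ρ ^ 2 / 3) := by rw [hw]; field_simp; ring
  have h3 := log_one_add_le_add_log hw0
  rw [e2, e1, log_mul (by positivity) (by positivity), log_inv] at h3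
  have h4 : exp (-(7 / 6 * w)) ≤ √(1 - ρ ^ 2) * (1 - ρ ^ 2) * (1 + ρ ^ 2 / 3) := by
    have h5 : 0 < √(1 - ρ ^ 2) := Real.sqrt_pos.2 h2
    rw [← log_le_log_iff (exp_pos _) (by positivity), log_exp, log_mul (by positivity)
      (by positivity), log_mul (by positivity) (by positivity), log_sqrt h2.le]
    linarith
  have h5 := mul_one_add_sq_le_halfLogOdds h0 h1
  calc exp (-(7 / 6 * w)) * ρ ≤ √(1 - ρ ^ 2) * (1 - ρ ^ 2) * (1 + ρ ^ 2 / 3) * ρ := by gcongr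
    _ = √(1 - ρ ^ 2) * (1 - ρ ^ 2) * (ρ * (1 + ρ ^ 2 / 3)) := by ring
    _ ≤ _ := by gcongr

/-- Small overlaps: the bound `sinh x ≤ x exp (x ^ 2 / 6)` suffices. -/
lemma exp_mul_sinh_le_of_mul_le {c M ρ T : ℝ} (hc : 0 < c) (hM : 0 ≤ M) (hT : T < c ^ 2)
    (h : T * (c ^ 4 + (7 - 6 * c) * (c ^ 2 - T)) ≤ 6 * M * (c ^ 2 - T) ^ 2)
    (h0 : 0 < ρ) (h1 : ρ < 1) (hρ : (c * ρ) ^ 2 ≤ T) :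
    exp (-(c * ρ ^ 2 / (1 - ρ ^ 2))) * sinh (c * ρ / (1 - ρ ^ 2)) ≤
      exp M * c * (√(1 - ρ ^ 2) * halfLogOdds ρ) := by
  have h2 : 0 < 1 - ρ ^ 2 := by nlinarith
  set w := ρ ^ 2 / (1 - ρ ^ 2) with hw
  have hw0 : 0 ≤ w := by positivity
  have hcT : 0 < c ^ 2 - T := by linarith
  have hT0 : 0 ≤ T := le_trans (sq_nonneg _) hρ
  have hw1 : w ≤ T / (c ^ 2 - T) := by
    rw [hw, div_le_div_iff₀ h2 hcT]
    nlinarith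
  have hw1M : T / (c ^ 2 - T) * (c ^ 2 * (1 + T / (c ^ 2 - T)) / 6 - c + 7 / 6) ≤ M := by
    have e : T / (c ^ 2 - T) * (c ^ 2 * (1 + T / (c ^ 2 - T)) / 6 - c + 7 / 6) =
        T * (c ^ 4 + (7 - 6 * c) * (c ^ 2 - T)) / (6 * (c ^ 2 - T) ^ 2) := by
      field_simp; ring
    rw [e, div_le_iff₀ (by positivity)]
    linarith
  have hwM : w * (c ^ 2 * (1 + w) / 6 - c + 7 / 6) ≤ M := by
    rcases le_or_gt (c ^ 2 * (1 + w) / 6 - c + 7 / 6) 0 with h3 | h3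
    · exact (mul_nonpos_of_nonneg_of_nonpos hw0 h3).trans hM
    · refine le_trans ?_ hw1M
      gcongr
  have e1 : 1 + w = 1 / (1 - ρ ^ 2) := by rw [hw]; field_simp; ring
  have e2 : c * ρ / (1 - ρ ^ 2) = c * ρ * (1 + w) := by rw [e1]; ring
  have e3 : c * ρ ^ 2 / (1 - ρ ^ 2) = c * w := by rw [hw]; ring
  have e4 : (c * ρ * (1 + w)) ^ 2 / 6 = c ^ 2 * w * (1 + w) / 6 := by
    have : ρ ^ 2 * (1 + w) = w := by rw [e1, hw]; ring
    calc _ = c ^ 2 * (ρ ^ 2 * (1 + w)) * (1 + w) / 6 := by ring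
      _ = _ := by rw [this]
  have h5 := exp_neg_le_sqrt_mul_halfLogOdds h0.le h1
  rw [← hw] at h5
  rw [e2, e3]
  calc exp (-(c * w)) * sinh (c * ρ * (1 + w)) ≤
        exp (-(c * w)) * (c * ρ * (1 + w) * exp ((c * ρ * (1 + w)) ^ 2 / 6)) := by
        gcongr
        exact sinh_le_mul_exp (by positivity)
    _ = exp (w * (c ^ 2 * (1 + w) / 6 - c + 7 / 6)) * c * (1 + w) *
          (exp (-(7 / 6 * w)) * ρ) := by
        rw [e4, show w * (c ^ 2 * (1 + w) / 6 - c + 7 / 6) =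
          -(c * w) + c ^ 2 * w * (1 + w) / 6 + 7 / 6 * w by ring, exp_add, exp_add, exp_neg (7 / 6 * w)]
        field_simp
    _ ≤ exp M * c * (1 + w) * (√(1 - ρ ^ 2) * (1 - ρ ^ 2) * halfLogOdds ρ) := by gcongr
    _ = _ := by rw [e1]; field_simp

lemma antitoneOn_inv_halfLogOdds : AntitoneOn
    (fun x => (1 / halfLogOdds x - x) * ((1 + x) / (1 - x))) (Ioo 0 1) := by
  have hd : ∀ x ∈ Ioo (0 : ℝ) 1, HasDerivAt
      (fun x => (1 / halfLogOdds x - x) * ((1 + x) / (1 - x)))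
      (-((1 / halfLogOdds x - 1) ^ 2 + x * (2 - x)) / (1 - x) ^ 2) x := by
    intro x hx
    have hy : halfLogOdds x ≠ 0 := (hx.1.trans_le (le_halfLogOdds hx.1.le hx.2)).ne'
    have h1 : 1 - x ≠ 0 := by linarith [hx.2]
    have h2 : 1 + x ≠ 0 := by linarith [hx.1]
    have h3 : 1 - x ^ 2 ≠ 0 := by
      rw [show 1 - x ^ 2 = (1 - x) * (1 + x) by ring]; exact mul_ne_zero h1 h2
    refine ((((hasDerivAt_const x (1 : ℝ)).div (hasDerivAt_halfLogOdds (by linarith [hx.1]) hx.2)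
      hy).sub (hasDerivAt_id x)).mul (((hasDerivAt_id x).const_add 1).div
      ((hasDerivAt_id x).const_sub 1) h1)).congr_deriv ?_
    simp only [Pi.div_apply, Pi.sub_apply, id]
    rw [show 1 - x ^ 2 = (1 - x) * (1 + x) by ring]
    field_simp
    ring
  refine antitoneOn_of_hasDerivWithinAt_nonpos
    (f' := fun x => -((1 / halfLogOdds x - 1) ^ 2 + x * (2 - x)) / (1 - x) ^ 2) (convex_Ioo _ _)
    (fun x hx => (hd x hx).continuousAt.continuousWithinAt) (fun x hx => ?_) fun x hx => ?_
  all_goals rw [interior_Ioo] at hx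
  · exact (hd x hx).hasDerivWithinAt
  · have h1 : 0 ≤ x * (2 - x) := mul_nonneg hx.1.le (by linarith [hx.2])
    exact div_nonpos_of_nonpos_of_nonneg (neg_nonpos.2 (by positivity)) (sq_nonneg _)

/-- Larger overlaps: with `sinh x ≤ exp x / 2` in place of the hyperbolic sine, the inequality has
to be checked only at the ends of an interval. -/
lemma exp_le_mul_sqrt_mul_halfLogOdds {a b c D : ℝ} (ha : 0 < a) (hb : b < 1) (hD : 0 < D)
    (h1 : exp (c * a / (1 + a)) ≤ D * (√(1 - a ^ 2) * halfLogOdds a))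
    (h2 : exp (c * b / (1 + b)) ≤ D * (√(1 - b ^ 2) * halfLogOdds b)) {ρ : ℝ}
    (hρ : ρ ∈ Icc a b) :
    exp (c * ρ / (1 + ρ)) ≤ D * (√(1 - ρ ^ 2) * halfLogOdds ρ) := by
  have hpos : ∀ x ∈ Icc a b, 0 < 1 - x ^ 2 ∧ 0 < halfLogOdds x := fun x hx =>
    ⟨by nlinarith [hx.1, hx.2],
      (ha.trans_le hx.1).trans_le (le_halfLogOdds (by linarith [hx.1]) (by linarith [hx.2]))⟩
  have hiff : ∀ x ∈ Icc a b, (exp (c * x / (1 + x)) ≤ D * (√(1 - x ^ 2) * halfLogOdds x) ↔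
      0 ≤ log D + (log (1 - x ^ 2) / 2 + log (halfLogOdds x)) - c * x / (1 + x)) := by
    intro x hx
    obtain ⟨h3, h4⟩ := hpos x hx
    have h5 := Real.sqrt_pos.2 h3
    rw [← log_le_log_iff (exp_pos _) (by positivity), log_exp, log_mul hD.ne' (by positivity),
      log_mul h5.ne' h4.ne', log_sqrt h3.le, sub_nonneg]
  have hab : a ≤ b := hρ.1.trans hρ.2
  have hd : ∀ x ∈ Icc a b, HasDerivAt
      (fun x => log D + (log (1 - x ^ 2) / 2 + log (halfLogOdds x)) - c * x / (1 + x))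
      (1 / (1 + x) ^ 2 * ((1 / halfLogOdds x - x) * ((1 + x) / (1 - x)) - c)) x := by
    intro x hx
    obtain ⟨h3, h4⟩ := hpos x hx
    have h5 : 1 - x ≠ 0 := by linarith [hx.2]
    have h6 : 1 + x ≠ 0 := by linarith [hx.1]
    refine (((((((hasDerivAt_pow 2 x).const_sub 1).log h3.ne').div_const 2).add
      ((hasDerivAt_halfLogOdds (by linarith [hx.1]) (by linarith [hx.2])).log h4.ne')).const_add
      (log D)).sub (((hasDerivAt_id x).const_mul c).div ((hasDerivAt_id x).const_add 1)
      h6)).congr_deriv ?_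
    simp only [id]
    rw [show 1 - x ^ 2 = (1 - x) * (1 + x) by ring]
    field_simp
    ring
  refine (hiff ρ hρ).2 (nonneg_of_hasDerivAt_mul_antitoneOn (a := a) (b := b)
    (f := fun x => log D + (log (1 - x ^ 2) / 2 + log (halfLogOdds x)) - c * x / (1 + x))
    (u := fun x => 1 / (1 + x) ^ 2)
    (v := fun x => (1 / halfLogOdds x - x) * ((1 + x) / (1 - x)) - c)
    (fun x hx => (hd x hx).continuousAt.continuousWithinAt)
    (fun x hx => hd x (Ioo_subset_Icc_self hx)) (fun x _ => by positivity)
    (fun x hx z hz hxz => ?_) ((hiff a ⟨le_rfl, hab⟩).1 h1) ((hiff b ⟨hab, le_rfl⟩).1 h2) hρ)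
  exact sub_le_sub_right (antitoneOn_inv_halfLogOdds ⟨ha.trans hx.1, hx.2.trans hb⟩
    ⟨ha.trans hz.1, hz.2.trans hb⟩ hxz) c

lemma exp_mul_sinh_le_exp {c ρ : ℝ} (h0 : 0 < ρ) (h1 : ρ < 1) :
    exp (-(c * ρ ^ 2 / (1 - ρ ^ 2))) * sinh (c * ρ / (1 - ρ ^ 2)) ≤ exp (c * ρ / (1 + ρ)) / 2 := by
  have h2 : 1 - ρ ≠ 0 := by linarith
  have h3 : 1 + ρ ≠ 0 := by linarith
  have e : c * ρ / (1 + ρ) = -(c * ρ ^ 2 / (1 - ρ ^ 2)) + c * ρ / (1 - ρ ^ 2) := by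
    rw [show 1 - ρ ^ 2 = (1 - ρ) * (1 + ρ) by ring]; field_simp; ring
  rw [e, exp_add, sinh_eq, mul_div_assoc (exp _)]
  have := exp_pos (-(c * ρ / (1 - ρ ^ 2)))
  gcongr
  linarith

lemma le_sqrt_mul_halfLogOdds {c ρ σ T : ℝ} (hc : 0 < c) (h0 : 0 < ρ) (hσ : 0 ≤ σ) (hT : T ≤ 1)
    (hρ : ρ ^ 2 ≤ T) (h1 : ρ < 1) (hσT : σ ^ 2 ≤ 1 - T / 3 - 2 / 3 * T ^ 2) :
    c * ρ * σ ≤ c * (√(1 - ρ ^ 2) * halfLogOdds ρ) := by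
  have h2 : 0 < 1 - ρ ^ 2 := by nlinarith
  have h5 := mul_one_add_sq_le_halfLogOdds h0.le h1
  have h6 : σ ≤ √(1 - ρ ^ 2) * (1 + ρ ^ 2 / 3) := by
    refine (sq_le_sq₀ hσ (by positivity)).1 ?_
    rw [mul_pow, Real.sq_sqrt h2.le]
    set t := ρ ^ 2
    have ht : 0 ≤ t := by positivity
    nlinarith [mul_nonneg ht ht, mul_nonneg (mul_nonneg ht ht) (sub_nonneg.2 (hρ.trans hT)),
      mul_nonneg ht (sub_nonneg.2 hρ)]
  calc c * ρ * σ ≤ c * ρ * (√(1 - ρ ^ 2) * (1 + ρ ^ 2 / 3)) := by gcongr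
    _ = c * (√(1 - ρ ^ 2) * (ρ * (1 + ρ ^ 2 / 3))) := by ring
    _ ≤ _ := by gcongr

lemma sqrt_mul_halfLogOdds_seven_tenths :
    0.619 ≤ √(1 - (7 / 10 : ℝ) ^ 2) * halfLogOdds (7 / 10) := by
  have h1 := log_three_bounds
  have h2 := log_seventeen_bounds
  have h3 : (0.714 : ℝ) ≤ √(1 - (7 / 10 : ℝ) ^ 2) := Real.le_sqrt_of_sq_le (by norm_num)
  have h4 : 0.8672 ≤ halfLogOdds (7 / 10) := by
    rw [halfLogOdds_seven_tenths]
    norm_num at *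
    linarith
  calc (0.619 : ℝ) ≤ 0.714 * 0.8672 := by norm_num
    _ ≤ _ := by gcongr

/-- Wide strips: the small overlaps `ρ ≤ 1.3 / c` and the larger ones are handled separately, given
a lower bound `B` for `massRatio c ^ 2 * invDensity √c`. -/
lemma overlapGap_of_le_sq_massRatio {B M T c E σ : ℝ} (hc : 2.65 ≤ c) (hB0 : 0 < B)
    (hB : B ≤ massRatio c ^ 2 * invDensity √c) (hM : 0 ≤ M) (hMB : exp M ≤ 0.998 * B)
    (hsmall : 1.69 * (c ^ 4 + (7 - 6 * c) * (c ^ 2 - 1.69)) ≤ 6 * M * (c ^ 2 - 1.69) ^ 2)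
    (hσ : 0 ≤ σ) (hT : T ≤ 1) (hTc : 1.69 ≤ T * c ^ 2) (hσT : σ ^ 2 ≤ 1 - T / 3 - 2 / 3 * T ^ 2)
    (hE : exp (1.3 * c / (c + 1.3)) ≤ E) (hEσ : E ≤ 1.996 * B * (1.3 * σ)) :
    OverlapGap (1 / 1000) (1 / 1000 / 20) √c := by
  have hc0 : 0 < c := by linarith
  refine overlapGap_of_one_le_of_sinh_le (by linarith) fun ρ h0 hρ => ?_
  have ha := invDensity_pos (Real.sqrt_pos.2 hc0)
  have hι : 0 ≤ entropyDefect ρ := entropyDefect_nonneg (abs_le.2 ⟨by linarith, by linarith⟩)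
  have hy := halfLogOdds_nonneg h0.le (by linarith)
  have h1 : 1 ≤ exp (invDensity √c * entropyDefect ρ) := one_le_exp (mul_nonneg ha.le hι)
  have hr := massRatio_pos hc0
  suffices h : exp (-(c * ρ ^ 2 / (1 - ρ ^ 2))) * sinh (c * ρ / (1 - ρ ^ 2)) ≤
      0.998 * (massRatio c ^ 2 * invDensity √c) * c * (√(1 - ρ ^ 2) * halfLogOdds ρ) by
    calc _ ≤ _ := h
      _ = 0.998 * (massRatio c ^ 2 * invDensity √c) * c *
          (√(1 - ρ ^ 2) * halfLogOdds ρ) * 1 := by ring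
      _ ≤ 0.998 * (massRatio c ^ 2 * invDensity √c) * c *
          (√(1 - ρ ^ 2) * halfLogOdds ρ) * exp (invDensity √c * entropyDefect ρ) := by gcongr
      _ = _ := by norm_num; ring
  rcases le_or_gt ρ (1.3 / c) with hs | hs
  · rw [le_div_iff₀ hc0] at hs
    refine (exp_mul_sinh_le_of_mul_le (T := 1.69) hc0 hM (by nlinarith) hsmall h0 (by linarith)
      (by nlinarith [mul_pos h0 hc0])).trans ?_
    gcongr
    linarith
  · have ha0 : 0 < 1.3 / c := by positivity
    have ha1 : 1.3 / c < 7 / 10 := hs.trans hρ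
    have hend := exp_le_mul_sqrt_mul_halfLogOdds (a := 1.3 / c) (b := 7 / 10) (c := c)
      (D := 1.996 * c * (massRatio c ^ 2 * invDensity √c)) ha0 (by norm_num) (by positivity)
      ?_ ?_ ⟨hs.le, hρ.le⟩
    · refine (exp_mul_sinh_le_exp h0 (by linarith)).trans ?_
      norm_num at *
      linarith
    · have h2 := le_sqrt_mul_halfLogOdds (c := c) (ρ := 1.3 / c) hc0 ha0 hσ hT ?_ (by linarith) hσT
      · rw [mul_div_cancel₀ _ hc0.ne'] at h2
        have e : c * (1.3 / c) / (1 + 1.3 / c) = 1.3 * c / (c + 1.3) := by field_simp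
        have hσ' : 0 ≤ √(1 - (1.3 / c) ^ 2) * halfLogOdds (1.3 / c) :=
          mul_nonneg (Real.sqrt_nonneg _) (halfLogOdds_nonneg ha0.le (by linarith))
        rw [e]
        calc exp (1.3 * c / (c + 1.3)) ≤ 1.996 * B * (1.3 * σ) := hE.trans hEσ
          _ ≤ 1.996 * B * (c * (√(1 - (1.3 / c) ^ 2) * halfLogOdds (1.3 / c))) := by gcongr
          _ ≤ 1.996 * (massRatio c ^ 2 * invDensity √c) *
              (c * (√(1 - (1.3 / c) ^ 2) * halfLogOdds (1.3 / c))) := by gcongr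
          _ = _ := by ring
      · rw [div_pow, div_le_iff₀ (by positivity)]
        norm_num at *
        linarith
    · rw [show c * (7 / 10) / (1 + 7 / 10) = 7 * c / 17 by ring]
      refine (exp_seven_seventeenths_le hc).trans ?_
      gcongr
      exact sqrt_mul_halfLogOdds_seven_tenths

lemma exp_div_add_le {c d : ℝ} (hc : 0 < c) (h : c ≤ d) :
    exp (1.3 * c / (c + 1.3)) ≤ exp (1.3 * d / (d + 1.3)) := by
  rw [exp_le_exp, div_le_div_iff₀ (by positivity) (by linarith)]
  nlinarith

/-- The parameters `T` and `E` bound `(1.3 / c) ^ 2` and `exp (1.3 c / (c + 1.3))` on the interval, and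
`σ` bounds `√(1 - ρ ^ 2) artanh ρ / ρ` at `ρ = 1.3 / c` from below. -/
lemma overlapGap_of_lt_sixteen_fifths {c : ℝ} (h1 : 2.65 ≤ c) (h2 : c < 3.2) :
    OverlapGap (1 / 1000) (1 / 1000 / 20) √c := by
  refine overlapGap_of_le_sq_massRatio (B := 1.05) (M := 0.045) (T := 0.2408) (E := 2.53)
    (σ := 0.938) h1 (by norm_num) (sq_massRatio_mul_invDensity_ge_of_lt h1 h2) (by norm_num) ?_ ?_
    (by norm_num) (by norm_num) (by nlinarith) (by norm_num) ?_ (by norm_num)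
  · refine (Real.exp_bound' (by norm_num) (by norm_num) (n := 3) (by norm_num)).trans ?_
    norm_num [Finset.sum_range_succ, Nat.factorial]
  · obtain ⟨u, hu, e⟩ := exists_nonneg_eq_div h1 h2
    subst e
    rw [← sub_nonneg]
    field_simp
    ring_nf
    positivity
  · refine (exp_div_add_le (by linarith) h2.le).trans ?_
    refine (Real.exp_bound' (by norm_num) (by norm_num) (n := 7) (by norm_num)).trans ?_
    norm_num [Finset.sum_range_succ, Nat.factorial]

lemma overlapGap_of_lt_eighteen_fifths {c : ℝ} (h1 : 3.2 ≤ c) (h2 : c < 3.6) :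
    OverlapGap (1 / 1000) (1 / 1000 / 20) √c := by
  refine overlapGap_of_le_sq_massRatio (B := 1.06) (M := 0.05) (T := 0.1651) (E := 2.61)
    (σ := 0.9625) (by linarith) (by norm_num) (le_trans (by norm_num)
    (le_sq_massRatio_mul_invDensity_of_le le_rfl h1 massRatio_sixteen_fifths_ge)) (by norm_num)
    ?_ ?_ (by norm_num) (by norm_num) (by nlinarith) (by norm_num) ?_ (by norm_num)
  · refine (Real.exp_bound' (by norm_num) (by norm_num) (n := 3) (by norm_num)).trans ?_
    norm_num [Finset.sum_range_succ, Nat.factorial]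
  · obtain ⟨u, hu, e⟩ := exists_nonneg_eq_div h1 h2
    subst e
    rw [← sub_nonneg]
    field_simp
    ring_nf
    positivity
  · refine (exp_div_add_le (by linarith) h2.le).trans ?_
    refine (Real.exp_bound' (by norm_num) (by norm_num) (n := 7) (by norm_num)).trans ?_
    norm_num [Finset.sum_range_succ, Nat.factorial]

lemma overlapGap_of_lt_five {c : ℝ} (h1 : 3.6 ≤ c) (h2 : c < 5) :
    OverlapGap (1 / 1000) (1 / 1000 / 20) √c := by
  refine overlapGap_of_le_sq_massRatio (B := 1.14) (M := 0.05) (T := 0.1305) (E := 2.83)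
    (σ := 0.972) (by linarith) (by norm_num) (le_trans (by norm_num)
    (le_sq_massRatio_mul_invDensity_of_le (by norm_num) h1 (sum_le_massRatio (by norm_num))))
    (by norm_num) ?_ ?_ (by norm_num) (by norm_num) (by nlinarith) (by norm_num) ?_ (by norm_num)
  · refine (Real.exp_bound' (by norm_num) (by norm_num) (n := 3) (by norm_num)).trans ?_
    norm_num [Finset.sum_range_succ, Nat.factorial]
  · obtain ⟨u, hu, e⟩ := exists_nonneg_eq_div h1 h2
    subst e
    rw [← sub_nonneg]
    field_simp
    ring_nf
    positivity
  · refine (exp_div_add_le (by linarith) h2.le).trans ?_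
    rw [show (1.3 * 5 / (5 + 1.3) : ℝ) = 1 + 2 / 63 by norm_num, exp_add]
    have h3 : exp (2 / 63) ≤ 1.0324 := by
      refine (Real.exp_bound' (by norm_num) (by norm_num) (n := 3) (by norm_num)).trans ?_
      norm_num [Finset.sum_range_succ, Nat.factorial]
    calc exp 1 * exp (2 / 63) ≤ 2.7182818286 * 1.0324 := by
          gcongr
          exact exp_one_lt_d9.le
      _ ≤ 2.83 := by norm_num

lemma overlapGap_of_ge_five {c : ℝ} (h1 : 5 ≤ c) :
    OverlapGap (1 / 1000) (1 / 1000 / 20) √c := by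
  refine overlapGap_of_le_sq_massRatio (B := 1.55) (M := 0.29) (T := 0.0676) (E := 3.7)
    (σ := 0.987) (by linarith) (by norm_num) (le_trans (by norm_num)
    (le_sq_massRatio_mul_invDensity_of_le (by norm_num) h1 (sum_le_massRatio (by norm_num))))
    (by norm_num) ?_ ?_ (by norm_num) (by norm_num) (by nlinarith) (by norm_num) ?_ (by norm_num)
  · refine (Real.exp_bound' (by norm_num) (by norm_num) (n := 4) (by norm_num)).trans ?_
    norm_num [Finset.sum_range_succ, Nat.factorial]
  · obtain ⟨u, rfl⟩ : ∃ u, c = 5 + u := ⟨c - 5, by ring⟩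
    have hu : 0 ≤ u := by linarith
    rw [← sub_nonneg]
    ring_nf
    positivity
  · have h2 : 1.3 * c / (c + 1.3) ≤ 1 + 0.3 := by
      rw [div_le_iff₀ (by linarith)]; linarith
    refine (exp_le_exp.2 h2).trans ?_
    rw [exp_add]
    have h3 : exp 0.3 ≤ 1.351 := by
      refine (Real.exp_bound' (by norm_num) (by norm_num) (n := 4) (by norm_num)).trans ?_
      norm_num [Finset.sum_range_succ, Nat.factorial]
    calc exp 1 * exp 0.3 ≤ 2.7182818286 * 1.351 := by
          gcongr
          exact exp_one_lt_d9.le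
      _ ≤ 3.7 := by norm_num

/-- The overlap gap, with constants that do not depend on `K`. -/
theorem overlapGap {K : ℝ} (hK : 0 < K) : OverlapGap (1 / 1000) (1 / 1000 / 20) K := by
  rw [← Real.sqrt_sq hK.le]
  have hc : 0 < K ^ 2 := by positivity
  rcases lt_or_ge (K ^ 2) 0.23 with h1 | h1
  · exact overlapGap_of_lt_twentythree_hundredths hc h1
  rcases lt_or_ge (K ^ 2) 1 with h2 | h2
  · exact overlapGap_of_lt_one h1 h2
  rcases lt_or_ge (K ^ 2) 2.65 with h3 | h3
  · exact overlapGap_of_lt_fiftythree_twentieths h2 h3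
  rcases lt_or_ge (K ^ 2) 3.2 with h4 | h4
  · exact overlapGap_of_lt_sixteen_fifths h3 h4
  rcases lt_or_ge (K ^ 2) 3.6 with h5 | h5
  · exact overlapGap_of_lt_eighteen_fifths h4 h5
  rcases lt_or_ge (K ^ 2) 5 with h6 | h6
  · exact overlapGap_of_lt_five h5 h6
  · exact overlapGap_of_ge_five h6

end SymPerceptron

/-- The matrix has `⌊α n * n⌋₊` rows, which is exactly `α n * n` when that is an integer. -/
theorem mainTheorem5 (K : ℝ) (hK : 0 < K) :
    ∃ C : ℝ, 0 < C ∧ ∀ α : ℕ → ℝ,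
      (∀ n, 0 < α n) → (∀ n, α n ≤ SymPerceptron.criticalDensity K) → ∀ n : ℕ, 1 ≤ n →
      (∫ A, ((SymPerceptron.solutions K A).card : ℝ) ^ 2
          ∂(SymPerceptron.gaussianEnsemble ⌊α n * n⌋₊ n)) /
        (∫ A, ((SymPerceptron.solutions K A).card : ℝ)
          ∂(SymPerceptron.gaussianEnsemble ⌊α n * n⌋₊ n)) ^ 2 < C ∧
      C⁻¹ < (SymPerceptron.gaussianEnsemble ⌊α n * n⌋₊ n).real
          {A | SymPerceptron.disc A ≤ SymPerceptron.criticalK (α n)} := by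
  exact SymPerceptron.second_moment_method (by norm_num) (by norm_num) (by norm_num)
    (fun _ h => SymPerceptron.overlapGap h) K hK
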